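/- **Setting.** An instance of online firefighting consists of a finite graph $G$, a fire source $r\in V(G)$ and a sequence $(f_i)_{i\ge1}$ of non-negative integers. At first only $r$ burns. In round $i$ the player learns $f_i$ and protects at most $f_i$ vertices that are not burning; then every unprotected neighbour of a burning vertex catches fire. A vertex is saved if it never burns. A deterministic online algorithm chooses the vertices protected in round $i$ as a function of $G,r,f_1,\dots,f_i$. Let $\mathrm{OPT}(\mathcal I)$ be the maximum number of vertices that can be saved on the instance $\mathcal I$ when the whole sequence is known. An algorithm is $c(n)$-competitive on a graph class if, on every instance $\mathcal I$ with a graph on $n$ vertices from the class, $\mathrm{OPT}(\mathcal I)\le c(n)\cdot \mathrm{ALG}(\mathcal I)$, where $\mathrm{ALG}(\mathcal I)$ is the number of vertices that the algorithm saves. A $1$-almost-tree is a connected graph with at most one cycle. A tadpole graph is a cycle together with a path with at least one further vertex, one end of which is joined by an edge to a vertex of the cycle. **The algorithm $\mathrm{ALG_A}$.** At any moment let $\widetilde G$ be the graph obtained from $G$ by contracting all burning vertices to $r$ and removing all protected and saved vertices. In $\widetilde G$, let $\kappa(S)$ be the set of vertices all of whose paths to $r$ meet $S\setminus\{r\}$,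 let $w(S)=|\kappa(S)|$ and $w(v)=w(\{v\})$, and let $N(r)$ be the neighbourhood of $r$. A root cycle is a cycle of $\widetilde G$ through $r$. For a root cycle $C$, a vertex $u\in C\setminus\{r\}$ and a real $m$, let $\mathrm{tol}(u,C,m)$ be the largest integer $d\ge 0$ such that at least $m$ vertices have distance at least $d$ from $r$ in the subgraph of $\widetilde G$ induced by $\{r\}\cup\kappa(C)\setminus\kappa(u)$. In each round $\mathrm{ALG_A}$ repeats the following step, updating $\widetilde G$ after each repetition, until none of the round's firefighters is left or $\widetilde G$ consists of $r$ only. Let $k$ be the number of firefighters left in the round. - If $\widetilde G$ has no root cycle, protect a vertex of $N(r)$ of maximum weight $w$. - If $\widetilde G$ has a root cycle $C$, let $v_1,v_2$ be a heaviest and a second heaviest vertex of $(N(r)\cup C)\setminus\{r\}$. - If $k\ge2$ and $w(v_1)+w(v_2)\ge w(C)$, protect $v_1$. - If $k\ge2$ and $w(v_1)+w(v_2)<w(C)$, protect both vertices of $N(r)\cap C$. - If $k=1$ and $w(v_1)\ge\sqrt{w(C)}$, protect $v_1$. - If $k=1$ and $w(v_1)<\sqrt{w(C)}$, protect a vertex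 $u\in N(r)\cap C$ with maximum $\mathrm{tol}(u,C,\sqrt{w(C)})$. **Theorem.** There is a deterministic online algorithm that plays according to $\mathrm{ALG_A}$ on all $1$-almost-trees, and every such algorithm (however ties are broken) is $(6\sqrt n+1)$-competitive on $1$-almost-trees. This is asymptotically optimal, already on tadpole graphs: every tadpole graph is a $1$-almost-tree, and there is a constant $\varepsilon>0$ such that, for every deterministic online algorithm that is $c(n)$-competitive on tadpole graphs, $c(n)\ge\varepsilon\sqrt n$ for all sufficiently large $n$. -/

import Mathlib

namespace Firefighting

variable {V : Type}

/-! ### The game -/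

/-- The vertices that received a firefighter in the rounds `0, …, i - 1` when the set `σ j` is
protected in round `j`. -/
def guarded (σ : ℕ → Finset V) (i : ℕ) : Set V := {v | ∃ j < i, v ∈ σ j}

/-- The vertices that burn at the beginning of round `i`. Rounds are numbered from `0`; in each
round the firefighters are placed first, and then the fire spreads from every burning vertex to all
its unprotected neighbours. -/
def burning (G : SimpleGraph V) (r : V) (σ : ℕ → Finset V) : ℕ → Set V
  | 0 => {r}
  | i + 1 => burning G r σ i ∪ {v | v ∉ guarded σ (i + 1) ∧ ∃ x ∈ burning G r σ i, G.Adj x v}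

/-- In round `i` at most `f i` vertices are protected, none of which is burning. -/
def IsLegal (G : SimpleGraph V) (r : V) (f : ℕ → ℕ) (σ : ℕ → Finset V) : Prop :=
  ∀ i, (σ i).card ≤ f i ∧ ∀ v ∈ σ i, v ∉ burning G r σ i

/-- The number of saved vertices, that is, of those that never burn. -/
noncomputable def profit (G : SimpleGraph V) (r : V) (σ : ℕ → Finset V) : ℕ :=
  {v | ∀ i, v ∉ burning G r σ i}.ncard

/-- The maximum number of vertices that can be saved, knowing the whole sequence `f`. -/
noncomputable def opt (G : SimpleGraph V) (r : V) (f : ℕ → ℕ) : ℕ :=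
  sSup {k | ∃ σ, IsLegal G r f σ ∧ profit G r σ = k}

/-- A deterministic online algorithm: on the instance `(G, r, f)` it protects `move V G r f i` in
round `i`, which may depend on `f 0, …, f i` but not on later values of `f`. -/
structure OnlineAlgorithm where
  move : (V : Type) → SimpleGraph V → V → (ℕ → ℕ) → ℕ → Finset V
  online : ∀ (V : Type) (G : SimpleGraph V) (r : V) (f f' : ℕ → ℕ) (i : ℕ),
    (∀ j ≤ i, f j = f' j) → move V G r f i = move V G r f' i
  legal : ∀ (V : Type) (G : SimpleGraph V) (r : V) (f : ℕ → ℕ), IsLegal G r f (move V G r f)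

/-- `A` is `c(n)`-competitive on the finite graphs of a class, `n` being the number of vertices. -/
def OnlineAlgorithm.IsCompetitiveOn (A : OnlineAlgorithm)
    (cls : (V : Type) → SimpleGraph V → Prop) (c : ℕ → ℝ) : Prop :=
  ∀ (V : Type) [Finite V] (G : SimpleGraph V), cls V G → ∀ (r : V) (f : ℕ → ℕ),
    (opt G r f : ℝ) ≤ c (Nat.card V) * profit G r (A.move V G r f)

/-! ### The graph classes -/

/-- A connected graph with at most one cycle. -/
def IsOneAlmostTree (G : SimpleGraph V) : Prop :=
  G.Connected ∧ ∀ (u v : V) (p : G.Walk u u) (q : G.Walk v v), p.IsCycle → q.IsCycle →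
    ∀ e, e ∈ p.edges ↔ e ∈ q.edges

/-- A cycle with `k + 3` vertices and a path with `l + 1` further vertices, one end of which is
joined by an edge to a vertex of the cycle. -/
def tadpoleGraph (k l : ℕ) : SimpleGraph (Fin (k + 3) ⊕ Fin (l + 1)) :=
  (SimpleGraph.cycleGraph (k + 3) ⊕g SimpleGraph.pathGraph (l + 1)) ⊔
    SimpleGraph.edge (Sum.inl 0) (Sum.inr 0)

def IsTadpole (G : SimpleGraph V) : Prop := ∃ k l : ℕ, Nonempty (G ≃g tadpoleGraph k l)

/-! ### The reduced graph, covered sets, weights and tolerance -/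

open Classical in
/-- The graph seen by the algorithm when the vertices of `B` burn and those of `P` are protected:
`P` is deleted and `B` is contracted to the fire source `r`. The graph keeps the vertex type `V`;
its actual vertices are those in the connected component of `r` (the vertices of `P`, those of `B`
other than `r`, and the saved vertices are not reachable from `r`). -/
def reduced (G : SimpleGraph V) (r : V) (B P : Set V) : SimpleGraph V where
  Adj a b := a ≠ b ∧ ∃ x y, G.Adj x y ∧ x ∉ P ∧ y ∉ P ∧
    (if x ∈ B then r else x) = a ∧ (if y ∈ B then r else y) = b
  symm := ⟨fun _ _ ⟨hne, x, y, h, hx, hy, hxa, hyb⟩ => ⟨hne.symm, y, x, h.symm, hy, hx, hyb, hxa⟩⟩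
  loopless := ⟨fun _ h => h.1 rfl⟩

/-- The covered set `κ(S \ {r})` in the component of `r` in `H`: the vertices all of whose paths to
`r` meet `S \ {r}`. -/
def covered (H : SimpleGraph V) (r : V) (S : Set V) : Set V :=
  {u | H.Reachable u r ∧ ∀ p : H.Walk u r, p.IsPath → ∃ x ∈ p.support, x ∈ S ∧ x ≠ r}

noncomputable def weight (H : SimpleGraph V) (r : V) (S : Set V) : ℕ := (covered H r S).ncard

/-- `C` is the vertex set of a cycle of `H` through `r`. -/
def IsRootCycle (H : SimpleGraph V) (r : V) (C : Set V) : Prop :=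
  ∃ p : H.Walk r r, p.IsCycle ∧ C = {v | v ∈ p.support}

/-- The vertex set of the subgraph that is induced by `{r} ∪ κ(C) \ κ(u)`. -/
def brokenVerts (H : SimpleGraph V) (r : V) (C : Set V) (u : V) : Set V :=
  {r} ∪ (covered H r C \ covered H r {u})

/-- The number of vertices at distance at least `d` from `r` in the subgraph induced by
`{r} ∪ κ(C) \ κ(u)`. -/
noncomputable def brokenCount (H : SimpleGraph V) (r : V) (C : Set V) (u : V) (d : ℕ) : ℕ :=
  {v ∈ brokenVerts H r C u |
    d ≤ (H.induce (brokenVerts H r C u)).spanningCoe.dist r v}.ncard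

/-- The tolerance of `u` with respect to `m`: the largest `d` for which at least `m` vertices are
at distance at least `d` from `r` after the root cycle `C` has been broken at `u`. -/
noncomputable def tol (H : SimpleGraph V) (r : V) (C : Set V) (u : V) (m : ℝ) : ℕ :=
  sSup {d : ℕ | m ≤ brokenCount H r C u d}

/-! ### The algorithm -/

/-- `v₁` and `v₂` are a heaviest and a second heaviest vertex of `(N(r) ∪ C) \ {r}`. -/
def AreHeaviest (H : SimpleGraph V) (r : V) (C : Set V) (v₁ v₂ : V) : Prop :=
  v₁ ∈ (H.neighborSet r ∪ C) \ {r} ∧ v₂ ∈ (H.neighborSet r ∪ C) \ {r} ∧ v₁ ≠ v₂ ∧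
    weight H r {v₂} ≤ weight H r {v₁} ∧
    ∀ u ∈ (H.neighborSet r ∪ C) \ {r}, u ≠ v₁ → weight H r {u} ≤ weight H r {v₂}

/-- `AlgAChoice H r k Q`: in one iteration, on the graph `H` with fire source `r` and with `k`
firefighters left, the algorithm may choose to protect `Q`. Ties are broken arbitrarily. -/
inductive AlgAChoice (H : SimpleGraph V) (r : V) : ℕ → Set V → Prop
  | noRootCycle (k : ℕ) (v : V) (hk : 1 ≤ k) (hC : ¬ ∃ C, IsRootCycle H r C)
      (hv : v ∈ H.neighborSet r)
      (hmax : ∀ u ∈ H.neighborSet r, weight H r {u} ≤ weight H r {v}) :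
      AlgAChoice H r k {v}
  | manyHeaviest (k : ℕ) (C : Set V) (v₁ v₂ : V) (hk : 2 ≤ k) (hC : IsRootCycle H r C)
      (hv : AreHeaviest H r C v₁ v₂)
      (hw : weight H r C ≤ weight H r {v₁} + weight H r {v₂}) :
      AlgAChoice H r k {v₁}
  | manyCycle (k : ℕ) (C : Set V) (v₁ v₂ : V) (hk : 2 ≤ k) (hC : IsRootCycle H r C)
      (hv : AreHeaviest H r C v₁ v₂)
      (hw : weight H r {v₁} + weight H r {v₂} < weight H r C) :
      AlgAChoice H r k (H.neighborSet r ∩ C)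
  | oneHeaviest (C : Set V) (v₁ v₂ : V) (hC : IsRootCycle H r C)
      (hv : AreHeaviest H r C v₁ v₂)
      (hw : √(weight H r C : ℝ) ≤ weight H r {v₁}) :
      AlgAChoice H r 1 {v₁}
  | breakCycle (C : Set V) (v₁ v₂ u : V) (hC : IsRootCycle H r C)
      (hv : AreHeaviest H r C v₁ v₂)
      (hw : (weight H r {v₁} : ℝ) < √(weight H r C : ℝ))
      (hu : u ∈ H.neighborSet r ∩ C)
      (hmax : ∀ u' ∈ H.neighborSet r ∩ C,
        tol H r C u' √(weight H r C : ℝ) ≤ tol H r C u √(weight H r C : ℝ)) :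
      AlgAChoice H r 1 {u}

/-- There is an available vertex, that is, one that is neither burning nor saved. -/
def HasAvailable (H : SimpleGraph V) (r : V) : Prop := ∃ v, v ≠ r ∧ H.Reachable r v

/-- `AlgARound G r B P k Q`: in a round (or the rest of one) in which `B` burns, `P` is protected
and `k` firefighters are left, the algorithm may protect `Q`. It iterates until no firefighter or
no available vertex is left. -/
inductive AlgARound (G : SimpleGraph V) (r : V) (B : Set V) : Set V → ℕ → Set V → Prop
  | finish (P : Set V) (k : ℕ) (h : k = 0 ∨ ¬ HasAvailable (reduced G r B P) r) :
      AlgARound G r B P k ∅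
  | step (P : Set V) (k : ℕ) (Q Q' : Set V) (hk : 0 < k) (h : HasAvailable (reduced G r B P) r)
      (hQ : AlgAChoice (reduced G r B P) r k Q)
      (hQ' : AlgARound G r B (P ∪ Q) (k - Q.ncard) Q') :
      AlgARound G r B P k (Q ∪ Q')

/-- `A` runs the algorithm on all finite `1`-almost-trees (with some way of breaking ties). -/
def OnlineAlgorithm.IsAlgA (A : OnlineAlgorithm) : Prop :=
  ∀ (V : Type) [Finite V] (G : SimpleGraph V), IsOneAlmostTree G →
    ∀ (r : V) (f : ℕ → ℕ) (i : ℕ),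
      AlgARound G r (burning G r (A.move V G r f) i) (guarded (A.move V G r f) i) (f i)
        (A.move V G r f i : Set V)

end Firefighting

/-! Upper bound. Let `σ` be the play of the algorithm, `ω` any other play, and `s = √w(C)` for the
root cycle `C`. It suffices to bound by `O(√n)` times the profit of `σ` the number of lost vertices
`x`: those that `ω` saves and `σ` does not. The fire of `σ` reaches `x` along a path, on which `ω`
protects some `y` in time, in a round `i` when `y` does not yet burn in `σ`.

If `y` cuts `x` off in the graph of round `i`, then `x` is dominated. In one round `ω` has no more
firefighters than the algorithm, and `AlgAChoice.ncard_mul_weight_le` says that each firefighter of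
the algorithm gains at least `w(y) / (2√n)` on average over its choice. Gains are differences of
reachable regions of `G`, so they telescope to at most the profit, and `Compared.dominated_le` gives
`2√n` times the profit.

Otherwise `y` is bypassed: some path to `x` uses `y`, another avoids it. With a single cycle, the
paths from `r` to `x` are then the two ways around the cycle followed by a common tail. Let `i₀` be
the first round in which `ω` protects a bypassed vertex. All undominated lost vertices are bypassed
in the graph of round `i₀`, and by `AlgAChoice.bypassed_bound` the first choice of the algorithm in
that round pays for all of them, unless a lone firefighter breaks the cycle.

In that case the fire of `σ` can only follow the other direction of the cycle. `ω` blocked this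
direction in round `i₀` with its only firefighter, so it needs a second blocker on the other way, `t
≥ 1` rounds later (`BreakRound.exists_blocking`). Let `d` be the tolerance of the protected vertex.
If the second blocker is on the cycle, then the firefighter of that round lets the algorithm save a
long arc, which bounds the number of branches involved. If it is on a tail and `t < d`, either the
algorithm gains a vertex per firefighter or it saves everything left, at least `s` vertices. If `t ≥
d`, the way is longer than the tolerance of the other neighbour, and fewer than `s` vertices are
that far away. As every single vertex has weight below `s`, each case loses at most `s` times the
profit.

Lower bound. The tadpole has a path of about `√n` vertices, and the fire starts opposite the
junction. After one firefighter, an algorithm that has not secured the junction or the path gets no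
other; one that has gets a second firefighter just when the fire reaches the junction, too late for
the cycle, half of which was savable. -/

namespace Firefighting

open SimpleGraph

variable {V : Type}

/-! ### Vertex deletion and reachable regions -/

/-- The graph in which all edges at the vertices of `S` are deleted. -/
def removeVerts (G : SimpleGraph V) (S : Set V) : SimpleGraph V where
  Adj a b := G.Adj a b ∧ a ∉ S ∧ b ∉ S
  symm := ⟨fun _ _ h => ⟨h.1.symm, h.2.2, h.2.1⟩⟩
  loopless := ⟨fun _ h => G.loopless.irrefl _ h.1⟩

/-- The vertices that can be reached from `r` without passing through `S`. -/
def region (G : SimpleGraph V) (r : V) (S : Set V) : Set V :=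
  {x | (removeVerts G S).Reachable r x}

theorem removeVerts_le (G : SimpleGraph V) (S : Set V) : removeVerts G S ≤ G :=
  fun _ _ h => h.1

theorem removeVerts_anti (G : SimpleGraph V) {S T : Set V} (h : S ⊆ T) :
    removeVerts G T ≤ removeVerts G S :=
  fun _ _ hab => ⟨hab.1, fun ha => hab.2.1 (h ha), fun hb => hab.2.2 (h hb)⟩

theorem region_anti (G : SimpleGraph V) (r : V) {S T : Set V} (h : S ⊆ T) :
    region G r T ⊆ region G r S :=
  fun _ hx => Reachable.mono (removeVerts_anti G h) hx

theorem self_mem_region (G : SimpleGraph V) (r : V) (S : Set V) : r ∈ region G r S :=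
  Reachable.refl _

theorem removeVerts_empty (G : SimpleGraph V) : removeVerts G ∅ = G := by
  ext a b
  simp [removeVerts]

theorem mem_region_empty {G : SimpleGraph V} {r x : V} :
    x ∈ region G r ∅ ↔ G.Reachable r x := by
  simp [region, removeVerts_empty]

theorem mem_region_of_adj {G : SimpleGraph V} {r x y : V} {S : Set V}
    (hx : x ∈ region G r S) (hxS : x ∉ S) (h : G.Adj x y) (hy : y ∉ S) : y ∈ region G r S :=
  Reachable.trans hx (Adj.reachable (G := removeVerts G S) ⟨h, hxS, hy⟩)

theorem mem_region_of_walk {G : SimpleGraph V} {r x : V} {S : Set V} (w : G.Walk r x)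
    (hw : ∀ v ∈ w.support, v ∉ S) : x ∈ region G r S := by
  induction w with
  | nil => exact Reachable.refl _
  | cons h w ih =>
    refine Reachable.trans (Adj.reachable (G := removeVerts G S) ⟨h, hw _ (by simp), ?_⟩)
      (ih fun v hv => hw v (by simp [hv]))
    exact hw _ (by simp)

theorem exists_path_of_mem_region {G : SimpleGraph V} {r x : V} {S : Set V} (hr : r ∉ S)
    (hx : x ∈ region G r S) : ∃ w : G.Walk r x, w.IsPath ∧ ∀ v ∈ w.support, v ∉ S := by
  classical
  obtain ⟨w⟩ := (hx : (removeVerts G S).Reachable r x)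
  have key : ∀ v ∈ w.support, v ∉ S := by
    induction w with
    | nil => simpa using hr
    | cons h w ih =>
      intro v hv
      rcases List.mem_cons.1 (by simpa using hv) with rfl | hv
      · exact h.2.1
      · exact ih h.2.2 v hv
  refine ⟨(w.mapLe (removeVerts_le G S)).bypass, Walk.bypass_isPath _, fun v hv => key v ?_⟩
  simpa using Walk.support_bypass_subset_support _ hv

theorem mem_region_iff {G : SimpleGraph V} {r x : V} {S : Set V} (hr : r ∉ S) :
    x ∈ region G r S ↔ ∃ w : G.Walk r x, w.IsPath ∧ ∀ v ∈ w.support, v ∉ S :=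
  ⟨exists_path_of_mem_region hr, fun ⟨w, _, hw⟩ => mem_region_of_walk w hw⟩

/-- Regions are antitone in the deleted set, so in this form the weights of successive choices
telescope. -/
theorem covered_eq (H : SimpleGraph V) (r : V) (S : Set V) :
    covered H r S = region H r ∅ \ region H r (S \ {r}) := by
  ext x
  simp only [covered, Set.mem_ofPred_eq, Set.mem_sdiff, mem_region_empty]
  refine and_congr reachable_comm ?_
  rw [mem_region_iff (by simp)]
  constructor
  · rintro h ⟨w, hw, hwS⟩
    obtain ⟨y, hy, hyS, hyr⟩ := h w.reverse hw.reverse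
    exact hwS y (by simpa using hy) ⟨hyS, hyr⟩
  · intro h p hp
    by_contra hcon
    push Not at hcon
    exact h ⟨p.reverse, hp.reverse, fun v hv hvS => hvS.2 (hcon v (by simpa using hv) hvS.1)⟩

/-! ### Graphs with at most one cycle -/

def AtMostOneCycle (G : SimpleGraph V) : Prop :=
  ∀ (u v : V) (p : G.Walk u u) (q : G.Walk v v), p.IsCycle → q.IsCycle →
    ∀ e, e ∈ p.edges ↔ e ∈ q.edges

/-- Two different paths with common ends contain a cycle in their union. It has the same edges as
`p`, hence contains `e`, which neither path uses. -/
theorem AtMostOneCycle.path_eq {H : SimpleGraph V} (hH : AtMostOneCycle H) {u : V}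
    {p : H.Walk u u} (hp : p.IsCycle) {e : Sym2 V} (he : e ∈ p.edges) {a b : V}
    {w w' : H.Walk a b} (hw : w.IsPath) (hw' : w'.IsPath) (hwe : e ∉ w.edges)
    (hwe' : e ∉ w'.edges) : w = w' := by
  by_contra hne
  obtain ⟨a', b', q, q', hq, hq', hc⟩ := hw.exists_isCycle_of_ne hw' hne
  have h1 := (hH _ _ p _ hp hc e).1 he
  rw [Walk.edges_append, Walk.edges_reverse, List.mem_append, List.mem_reverse] at h1
  rcases h1 with h1 | h1
  · exact hwe (hq.edges_subset h1)
  · exact hwe' (hq'.edges_subset h1)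

theorem isPath_append {G : SimpleGraph V} {a b c : V} {p : G.Walk a b} {q : G.Walk b c}
    (hp : p.IsPath) (hq : q.IsPath) (h : ∀ v ∈ p.support, v ∈ q.support → v = b) :
    (p.append q).IsPath := by
  rw [Walk.isPath_def, Walk.support_append, List.nodup_append]
  have hq' := hq.support_nodup
  rw [← Walk.cons_tail_support] at hq'
  refine ⟨hp.support_nodup, (List.nodup_cons.1 hq').2, ?_⟩
  rintro x hx y hy rfl
  have := h x hx (List.mem_of_mem_tail hy)
  subst this
  exact (List.nodup_cons.1 hq').1 hy

/-- `τ` leads from the cycle `p` to `x`, and meets `p` only in its first vertex. -/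
def IsTail {H : SimpleGraph V} {r x : V} (p : H.Walk r r) (e : ℕ)
    (τ : H.Walk (p.getVert e) x) : Prop :=
  τ.IsPath ∧ ∀ v ∈ τ.support, v ∈ p.support → v = p.getVert e

theorem exists_isTail {H : SimpleGraph V} {r x : V} (p : H.Walk r r) (hp : p.IsCycle)
    (hx : H.Reachable r x) :
    ∃ e, e < p.length ∧ ∃ τ : H.Walk (p.getVert e) x, IsTail p e τ := by
  classical
  have key : ∀ {z y : V} (w : H.Walk y z), z ∈ p.support →
      ∃ c ∈ p.support, ∃ τ : H.Walk c y, ∀ v ∈ τ.support, v ∈ p.support → v = c := by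
    intro z y w hz
    induction w with
    | nil => exact ⟨_, hz, Walk.nil, by simp⟩
    | @cons a b c h w ih =>
      by_cases ha : a ∈ p.support
      · exact ⟨a, ha, Walk.nil, by simp⟩
      · obtain ⟨c', hc', τ, hτ⟩ := ih hz
        refine ⟨c', hc', τ.concat h.symm, fun v hv hvp => ?_⟩
        rw [Walk.support_concat, List.mem_append, List.mem_singleton] at hv
        rcases hv with hv | rfl
        · exact hτ v hv hvp
        · exact absurd hvp ha
  obtain ⟨w⟩ := hx.symm
  obtain ⟨c, hc, τ, hτ⟩ := key w (Walk.start_mem_support p)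
  obtain ⟨n, rfl, hn⟩ := Walk.mem_support_iff_exists_getVert.1 hc
  -- The indices `0` and `p.length` both denote `r`; the latter is replaced by the former.
  have : ∃ e, e < p.length ∧ p.getVert e = p.getVert n := by
    have := hp.three_le_length
    rcases hn.lt_or_eq with h | rfl
    · exact ⟨n, h, rfl⟩
    · exact ⟨0, by omega, by simp⟩
  obtain ⟨e, he, hen⟩ := this
  refine ⟨e, he, (τ.copy hen.symm rfl).bypass, Walk.bypass_isPath _, fun v hv hvp => ?_⟩
  rw [hen]
  exact hτ v (by simpa using Walk.support_bypass_subset_support _ hv) hvp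

/-! ### The two paths from the root to a vertex hanging off a root cycle -/

section RootCycle

variable {H : SimpleGraph V} {r x : V} {p : H.Walk r r}

/-- The path from `r` to the end of a tail that follows the cycle in its direction. -/
def leftPath (p : H.Walk r r) (e : ℕ) (τ : H.Walk (p.getVert e) x) : H.Walk r x :=
  (p.take e).append τ

/-- The path from `r` to the end of a tail that follows the cycle against its direction. -/
def rightPath (p : H.Walk r r) (e : ℕ) (τ : H.Walk (p.getVert e) x) : H.Walk r x :=
  (p.drop e).reverse.append τ

theorem IsTail.notMem_edges {e : ℕ} {τ : H.Walk (p.getVert e) x} (hτ : IsTail p e τ) {a b : V}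
    (ha : a ∈ p.support) (hb : b ∈ p.support) : s(a, b) ∉ τ.edges := by
  intro h
  have h1 := hτ.2 a (Walk.fst_mem_support_of_mem_edges _ h) ha
  have h2 := hτ.2 b (Walk.snd_mem_support_of_mem_edges _ h) hb
  exact (Walk.adj_of_mem_edges _ h).ne (h1.trans h2.symm)

theorem disjoint_edges_take_drop (hp : p.IsCycle) (e : ℕ) :
    List.Disjoint (p.take e).edges (p.drop e).edges := by
  have := hp.edges_nodup
  rw [← Walk.append_take_drop_eq p e, Walk.edges_append] at this
  exact List.disjoint_of_nodup_append this

theorem support_take_subset (p : H.Walk r r) (e : ℕ) : (p.take e).support ⊆ p.support :=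
  (Walk.isSubwalk_take p e).support_subset

theorem support_drop_subset (p : H.Walk r r) (e : ℕ) : (p.drop e).support ⊆ p.support :=
  (Walk.isSubwalk_drop p e).support_subset

theorem first_edge_mem_take (hp : p.IsCycle) {e : ℕ} (he : 1 ≤ e) :
    s(r, p.getVert 1) ∈ (p.take e).edges := by
  cases p with
  | nil => exact absurd hp (by simp)
  | cons h q =>
    obtain ⟨e, rfl⟩ : ∃ k, e = k + 1 := ⟨e - 1, by omega⟩
    simp [Walk.take]

theorem last_edge_mem_drop {e : ℕ} (he : e < p.length) :
    s(p.getVert (p.length - 1), r) ∈ (p.drop e).edges := by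
  have h1 : (p.drop e).getVert (p.length - 1 - e) = p.getVert (p.length - 1) := by
    rw [Walk.drop_getVert]; congr 1; omega
  have h2 : (p.drop e).getVert (p.length - 1 - e + 1) = r := by
    rw [Walk.drop_getVert, Walk.getVert_of_length_le]; omega
  have h4 : s((p.drop e).getVert (p.length - 1 - e), (p.drop e).getVert (p.length - 1 - e + 1))
      ∈ (p.drop e).edges := by
    rw [Walk.mk_mem_edges_iff_exists]
    exact ⟨p.length - 1 - e, by simp; omega, rfl⟩
  rwa [h1, h2] at h4

theorem mem_edges_of_mem_take {e : ℕ} {f : Sym2 V} (h : f ∈ (p.take e).edges) : f ∈ p.edges :=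
  (Walk.isSubwalk_take p e).edges_subset h

theorem mem_edges_of_mem_drop {e : ℕ} {f : Sym2 V} (h : f ∈ (p.drop e).edges) : f ∈ p.edges :=
  (Walk.isSubwalk_drop p e).edges_subset h

theorem getVert_inj (hp : p.IsCycle) {i j : ℕ} (hi : i < p.length) (hj : j < p.length)
    (h : p.getVert i = p.getVert j) : i = j :=
  hp.getVert_injOn' (by simp; omega) (by simp; omega) h

theorem getVert_ne_root (hp : p.IsCycle) {i : ℕ} (hi : 1 ≤ i) (hi' : i < p.length) :
    p.getVert i ≠ r := by
  intro h
  have := getVert_inj hp (i := i) (j := 0) hi' (by omega) (by simpa using h)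
  omega

theorem mem_support_iff_getVert (hp : p.IsCycle) {v : V} :
    v ∈ p.support ↔ ∃ i < p.length, p.getVert i = v := by
  rw [Walk.mem_support_iff_exists_getVert]
  constructor
  · rintro ⟨n, rfl, hn⟩
    rcases hn.lt_or_eq with h | rfl
    · exact ⟨n, h, rfl⟩
    · exact ⟨0, by have := hp.three_le_length; omega, by simp⟩
  · rintro ⟨n, hn, rfl⟩
    exact ⟨n, rfl, hn.le⟩

theorem mem_support_take_iff {e : ℕ} (he : e < p.length) {v : V} :
    v ∈ (p.take e).support ↔ ∃ i ≤ e, p.getVert i = v := by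
  rw [Walk.mem_support_iff_exists_getVert]
  simp only [Walk.take_getVert, Walk.take_length]
  constructor
  · rintro ⟨n, rfl, hn⟩
    exact ⟨e ⊓ n, by omega, rfl⟩
  · rintro ⟨n, hn, rfl⟩
    exact ⟨n, by rw [min_eq_right hn], by omega⟩

theorem mem_support_drop_iff {e : ℕ} (he : e < p.length) {v : V} :
    v ∈ (p.drop e).support ↔ ∃ i, e ≤ i ∧ i ≤ p.length ∧ p.getVert i = v := by
  rw [Walk.mem_support_iff_exists_getVert]
  simp only [Walk.drop_getVert, Walk.drop_length]
  constructor
  · rintro ⟨n, rfl, hn⟩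
    exact ⟨e + n, by omega, by omega, rfl⟩
  · rintro ⟨n, hn, hn', rfl⟩
    exact ⟨n - e, by congr 1; omega, by omega⟩

variable {e : ℕ} {τ : H.Walk (p.getVert e) x}

theorem leftPath_isPath (hp : p.IsCycle) (he : e < p.length) (hτ : IsTail p e τ) :
    (leftPath p e τ).IsPath :=
  isPath_append (hp.isPath_take he) hτ.1 fun v hv hvτ => hτ.2 v hvτ (support_take_subset p e hv)

theorem rightPath_isPath (hp : p.IsCycle) (he : 1 ≤ e) (hτ : IsTail p e τ) :
    (rightPath p e τ).IsPath :=
  isPath_append (hp.isPath_drop he).reverse hτ.1 fun v hv hvτ =>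
    hτ.2 v hvτ (support_drop_subset p e (by simpa using hv))

/-- A path starting in `r` uses at most one of the two cycle edges at `r`. `AtMostOneCycle.path_eq`,
applied to an edge that it avoids, identifies it with the canonical path avoiding that edge. For `e
= 0` the left path is the tail itself and avoids both. -/
theorem eq_leftPath_or_rightPath (hH : AtMostOneCycle H) (hp : p.IsCycle) (he : e < p.length)
    (hτ : IsTail p e τ) {w : H.Walk r x} (hw : w.IsPath) :
    w = leftPath p e τ ∨ (1 ≤ e ∧ w = rightPath p e τ) := by
  have h3 := hp.three_le_length
  have hf2 := last_edge_mem_drop he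
  have hf1 : s(r, p.getVert 1) ∈ p.edges := mem_edges_of_mem_take (first_edge_mem_take hp le_rfl)
  have hτf : ∀ i, s(p.getVert i, r) ∉ τ.edges := fun i =>
    hτ.notMem_edges (Walk.getVert_mem_support _ _) (Walk.start_mem_support _)
  by_cases h2 : s(p.getVert (p.length - 1), r) ∈ w.edges
  · have hs : p.getVert (p.length - 1) = w.snd := hw.eq_snd_of_mem_edges (by rwa [Sym2.eq_swap])
    have h1 : s(r, p.getVert 1) ∉ w.edges := by
      intro h1
      have := getVert_inj hp (by omega) (by omega) ((hw.eq_snd_of_mem_edges h1).trans hs.symm)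
      omega
    rcases Nat.eq_zero_or_pos e with rfl | h0
    · left
      refine hH.path_eq hp hf1 hw (leftPath_isPath hp he hτ) h1 ?_
      rw [leftPath, Walk.edges_append, List.mem_append, not_or]
      refine ⟨by simp, ?_⟩
      rw [Sym2.eq_swap]
      exact hτf 1
    · right
      refine ⟨h0, hH.path_eq hp hf1 hw (rightPath_isPath hp h0 hτ) h1 ?_⟩
      rw [rightPath, Walk.edges_append, List.mem_append, not_or]
      refine ⟨?_, by rw [Sym2.eq_swap]; exact hτf 1⟩
      rw [Walk.edges_reverse, List.mem_reverse]
      exact fun h => disjoint_edges_take_drop hp e (first_edge_mem_take hp h0) h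
  · left
    refine hH.path_eq hp (mem_edges_of_mem_drop hf2) hw (leftPath_isPath hp he hτ) h2 ?_
    rw [leftPath, Walk.edges_append, List.mem_append, not_or]
    exact ⟨fun h => disjoint_edges_take_drop hp e h hf2, hτf _⟩

theorem mem_support_leftPath_iff (he : e < p.length) {v : V} :
    v ∈ (leftPath p e τ).support ↔ (∃ i ≤ e, p.getVert i = v) ∨ v ∈ τ.support := by
  rw [leftPath, Walk.mem_support_append_iff, mem_support_take_iff he]

theorem mem_support_rightPath_iff (he : e < p.length) {v : V} :
    v ∈ (rightPath p e τ).support ↔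
      (∃ i, e ≤ i ∧ i ≤ p.length ∧ p.getVert i = v) ∨ v ∈ τ.support := by
  rw [rightPath, Walk.mem_support_append_iff, Walk.support_reverse, List.mem_reverse,
    mem_support_drop_iff he]

/-- Every vertex of a tail is on all paths from `r` to the end of the tail. -/
theorem mem_support_of_mem_tail (hH : AtMostOneCycle H) (hp : p.IsCycle) (he : e < p.length)
    (hτ : IsTail p e τ) {w : H.Walk r x} (hw : w.IsPath) {v : V} (hv : v ∈ τ.support) :
    v ∈ w.support := by
  rcases eq_leftPath_or_rightPath hH hp he hτ hw with rfl | ⟨_, rfl⟩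
  · exact (mem_support_leftPath_iff he).2 (Or.inr hv)
  · exact (mem_support_rightPath_iff he).2 (Or.inr hv)

theorem notMem_region_of_mem_tail (hH : AtMostOneCycle H) (hp : p.IsCycle) (he : e < p.length)
    (hτ : IsTail p e τ) {v : V} (hv : v ∈ τ.support) {S : Set V} (hvS : v ∈ S)
    (hr : r ∉ S) : x ∉ region H r S := by
  rw [mem_region_iff hr]
  rintro ⟨w, hw, hwS⟩
  exact hwS v (mem_support_of_mem_tail hH hp he hτ hw hv) hvS

theorem IsTail.root_notMem (hp : p.IsCycle) (he : e < p.length) (h1 : 1 ≤ e)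
    (hτ : IsTail p e τ) : r ∉ τ.support :=
  fun h => getVert_ne_root hp h1 he (hτ.2 r h (Walk.start_mem_support _)).symm

theorem isTail_nil (p : H.Walk r r) (e : ℕ) : IsTail p e (Walk.nil : H.Walk (p.getVert e) _) :=
  ⟨Walk.IsPath.nil, by simp⟩

theorem reachable_getVert (p : H.Walk r r) (i : ℕ) : H.Reachable r (p.getVert i) :=
  ⟨p.take i⟩

theorem neighbor_iff (hH : AtMostOneCycle H) (hp : p.IsCycle) {v : V} (hv : v ∈ p.support) :
    H.Adj r v ↔ v = p.getVert 1 ∨ v = p.getVert (p.length - 1) := by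
  have h3 := hp.three_le_length
  constructor
  · intro h
    obtain ⟨i, hi, rfl⟩ := (mem_support_iff_getVert hp).1 hv
    have hi0 : 1 ≤ i := by
      by_contra h0
      obtain rfl : i = 0 := by omega
      simp at h
    have key := eq_leftPath_or_rightPath hH hp hi (isTail_nil p i) (Walk.IsPath.of_adj h)
    have hl : ∀ q : H.Walk r (p.getVert i), h.toWalk = q → q.length = 1 := by
      rintro _ rfl; rfl
    rcases key with hk | ⟨_, hk⟩
    · have := hl _ hk
      simp [leftPath] at this
      left; congr 1; omega
    · have := hl _ hk
      simp [rightPath] at this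
      right; congr 1; omega
  · rintro (rfl | rfl)
    · simpa using p.adj_getVert_succ (i := 0) (by omega)
    · have := p.adj_getVert_succ (i := p.length - 1) (by omega)
      rw [show p.length - 1 + 1 = p.length by omega, Walk.getVert_length] at this
      exact this.symm

theorem neighborSet_inter_eq (hH : AtMostOneCycle H) (hp : p.IsCycle) :
    H.neighborSet r ∩ {v | v ∈ p.support} = {p.getVert 1, p.getVert (p.length - 1)} := by
  ext v
  simp only [Set.mem_inter_iff, mem_neighborSet, Set.mem_ofPred_eq, Set.mem_insert_iff,
    Set.mem_singleton_iff]
  constructor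
  · rintro ⟨h, hv⟩
    exact (neighbor_iff hH hp hv).1 h
  · intro h
    have hv : v ∈ p.support := by rcases h with rfl | rfl <;> exact Walk.getVert_mem_support _ _
    exact ⟨(neighbor_iff hH hp hv).2 h, hv⟩

theorem mem_covered_cycle_iff (hH : AtMostOneCycle H) (hp : p.IsCycle) (he : e < p.length)
    (hτ : IsTail p e τ) : x ∈ covered H r {v | v ∈ p.support} ↔ 1 ≤ e := by
  have hx : H.Reachable r x := (reachable_getVert p e).trans ⟨τ⟩
  rw [covered_eq, Set.mem_sdiff, mem_region_empty, and_iff_right hx]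
  constructor
  · intro h
    by_contra h0
    obtain rfl : e = 0 := by omega
    refine h (mem_region_of_walk (leftPath p 0 τ) fun v hv hvS => hvS.2 ?_)
    rcases (mem_support_leftPath_iff he).1 hv with ⟨i, hi, rfl⟩ | hv
    · obtain rfl : i = 0 := by omega
      simp
    · simpa using hτ.2 v hv hvS.1
  · intro h
    exact notMem_region_of_mem_tail hH hp he hτ (Walk.start_mem_support _)
      ⟨Walk.getVert_mem_support _ _, getVert_ne_root hp h he⟩ (by simp)

/-- Each of the two possible paths to a covered vertex enters the cycle through a neighbour of `r`.
So two firefighters secure all of `w(C)`. -/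
theorem covered_neighbors_eq (hH : AtMostOneCycle H) (hp : p.IsCycle) :
    covered H r (H.neighborSet r ∩ {v | v ∈ p.support}) = covered H r {v | v ∈ p.support} := by
  have h3 := hp.three_le_length
  ext x
  constructor
  · rintro ⟨h1, h2⟩
    refine ⟨h1, fun q hq => ?_⟩
    obtain ⟨y, hy, hyS, hyr⟩ := h2 q hq
    exact ⟨y, hy, hyS.2, hyr⟩
  · intro h
    obtain ⟨e, he, τ, hτ⟩ := exists_isTail p hp h.1.symm
    have h1 := (mem_covered_cycle_iff hH hp he hτ).1 h
    refine ⟨h.1, fun q hq => ?_⟩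
    rw [neighborSet_inter_eq hH hp]
    have hsup : q.reverse.support = q.support.reverse := Walk.support_reverse q
    rcases eq_leftPath_or_rightPath hH hp he hτ hq.reverse with hw | ⟨_, hw⟩
    · refine ⟨p.getVert 1, ?_, by simp, getVert_ne_root hp le_rfl (by omega)⟩
      rw [← List.mem_reverse, ← hsup, hw]
      exact (mem_support_leftPath_iff he).2 (Or.inl ⟨1, h1, rfl⟩)
    · refine ⟨p.getVert (p.length - 1), ?_, by simp,
        getVert_ne_root hp (by omega) (by omega)⟩
      rw [← List.mem_reverse, ← hsup, hw]
      exact (mem_support_rightPath_iff he).2 (Or.inl ⟨p.length - 1, by omega, by omega, rfl⟩)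

end RootCycle

/-! ### Domination -/

theorem mem_covered_singleton {H : SimpleGraph V} {r v x : V} (hv : v ≠ r) :
    x ∈ covered H r {v} ↔ H.Reachable r x ∧ x ∉ region H r {v} := by
  rw [covered_eq, Set.mem_sdiff, mem_region_empty]
  have : ({v} : Set V) \ {r} = {v} := by simpa using hv
  rw [this]

theorem mem_covered_of_forall_path {H : SimpleGraph V} {r v x : V} (hv : v ≠ r)
    (hx : H.Reachable r x) (h : ∀ w : H.Walk r x, w.IsPath → v ∈ w.support) :
    x ∈ covered H r {v} := by
  rw [mem_covered_singleton hv, mem_region_iff (by simpa using hv.symm)]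
  exact ⟨hx, fun ⟨w, hw, hwv⟩ => hwv v (h w hw) rfl⟩

theorem mem_path_of_covered {H : SimpleGraph V} {r v x : V} (hx : x ∈ covered H r {v})
    {w : H.Walk r x} (hw : w.IsPath) : v ∈ w.support ∧ v ≠ r := by
  obtain ⟨y, hy, rfl, hyr⟩ := hx.2 w.reverse hw.reverse
  exact ⟨by simpa using hy, hyr⟩

/-- A path to `x` passes through `y`, and its initial part up to `y` passes through `v`. -/
theorem covered_trans {H : SimpleGraph V} {r v y : V} (hy : y ∈ covered H r {v}) :
    covered H r {y} ⊆ covered H r {v} := by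
  classical
  rintro x ⟨hx, hx'⟩
  refine ⟨hx, fun q hq => ?_⟩
  obtain ⟨z, hz, rfl, hzr⟩ := hx' q hq
  obtain ⟨u, hu, rfl, hur⟩ := hy.2 _ (hq.dropUntil hz)
  exact ⟨u, Walk.support_dropUntil_subset_support _ hz hu, rfl, hur⟩

theorem self_mem_covered {H : SimpleGraph V} {r v : V} (hv : v ≠ r) (h : H.Reachable r v) :
    v ∈ covered H r {v} :=
  ⟨h.symm, fun q _ => ⟨v, q.start_mem_support, rfl, hv⟩⟩

theorem weight_mono [Finite V] {H : SimpleGraph V} {r : V} {S T : Set V}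
    (h : covered H r S ⊆ covered H r T) : weight H r S ≤ weight H r T :=
  Set.ncard_le_ncard h (Set.toFinite _)

/-- `y` lies on a path from `r` to `x`, but `x` can also be reached without passing through `y`. -/
def Bypassed (H : SimpleGraph V) (r y x : V) : Prop :=
  y ≠ r ∧ x ∈ region H r {y} ∧ ∃ w : H.Walk r x, w.IsPath ∧ y ∈ w.support

theorem Bypassed.exists_paths {H : SimpleGraph V} {r y x : V} (h : Bypassed H r y x) :
    ∃ w w' : H.Walk r x, w.IsPath ∧ w'.IsPath ∧ y ∈ w.support ∧ y ∉ w'.support := by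
  obtain ⟨hyr, hx, w, hw, hy⟩ := h
  obtain ⟨w', hw', h'⟩ := exists_path_of_mem_region (by simpa using hyr.symm) hx
  exact ⟨w, w', hw, hw', hy, fun h => h' y h rfl⟩

theorem Bypassed.reachable {H : SimpleGraph V} {r y x : V} (h : Bypassed H r y x) :
    H.Reachable r x := by
  obtain ⟨_, _, w, _⟩ := h
  exact ⟨w⟩

section RootCycle

variable {H : SimpleGraph V} {r x : V} {p : H.Walk r r} {e : ℕ} {τ : H.Walk (p.getVert e) x}

theorem mem_covered_of_mem_tail (hH : AtMostOneCycle H) (hp : p.IsCycle) (he : e < p.length)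
    (h1 : 1 ≤ e) (hτ : IsTail p e τ) {v : V} (hv : v ∈ τ.support) : x ∈ covered H r {v} :=
  mem_covered_of_forall_path (fun h => hτ.root_notMem hp he h1 (h ▸ hv))
    ((reachable_getVert p e).trans ⟨τ⟩) fun _ hw => mem_support_of_mem_tail hH hp he hτ hw hv

/-- A path through `y` and a path around `y` must be the two different canonical paths. Hence the
tail does not start in `r`, and `y` is not on the tail, which both paths share. -/
theorem Bypassed.mem_cycle (hH : AtMostOneCycle H) (hp : p.IsCycle) (he : e < p.length)
    (hτ : IsTail p e τ) {y : V} (h : Bypassed H r y x) :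
    1 ≤ e ∧ ∃ a, 1 ≤ a ∧ a < p.length ∧ p.getVert a = y := by
  obtain ⟨w, w', hw, hw', hy, hy'⟩ := h.exists_paths
  have hyτ : y ∉ τ.support := fun hy => hy' (mem_support_of_mem_tail hH hp he hτ hw' hy)
  have h1 : 1 ≤ e := by
    by_contra h0
    have h1 := (eq_leftPath_or_rightPath hH hp he hτ hw).resolve_right fun h => h0 h.1
    have h2 := (eq_leftPath_or_rightPath hH hp he hτ hw').resolve_right fun h => h0 h.1
    exact hy' (h2 ▸ h1 ▸ hy)
  have hyp : y ∈ p.support := by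
    rcases eq_leftPath_or_rightPath hH hp he hτ hw with rfl | ⟨_, rfl⟩
    · rcases (mem_support_leftPath_iff he).1 hy with ⟨i, _, rfl⟩ | h
      · exact Walk.getVert_mem_support _ _
      · exact absurd h hyτ
    · rcases (mem_support_rightPath_iff he).1 hy with ⟨i, _, _, rfl⟩ | h
      · exact Walk.getVert_mem_support _ _
      · exact absurd h hyτ
  obtain ⟨a, ha, hay⟩ := (mem_support_iff_getVert hp).1 hyp
  refine ⟨h1, a, ?_, ha, hay⟩
  by_contra h0
  obtain rfl : a = 0 := by omega
  exact h.1 (by simpa using hay.symm)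

/-- This is why the algorithm need only inspect `N(r) ∪ C`. The dominator is the vertex where the
tail leaves the cycle or, for a tail starting in `r`, the first vertex after `r`. -/
theorem exists_dominator_rootCycle (hH : AtMostOneCycle H) (hp : p.IsCycle) {y : V} (hy : y ≠ r)
    (hry : H.Reachable r y) :
    ∃ v ∈ (H.neighborSet r ∪ {v | v ∈ p.support}) \ {r}, y ∈ covered H r {v} := by
  obtain ⟨e, he, τ, hτ⟩ := exists_isTail p hp hry
  rcases Nat.eq_zero_or_pos e with rfl | h1
  · have hnil : ¬ (leftPath p 0 τ).Nil := Walk.not_nil_of_ne hy.symm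
    have hadj := Walk.adj_snd hnil
    refine ⟨(leftPath p 0 τ).snd, ⟨Or.inl hadj, hadj.ne'⟩,
      mem_covered_of_forall_path hadj.ne' hry fun w hw => ?_⟩
    rw [(eq_leftPath_or_rightPath hH hp he hτ hw).resolve_right fun h => by omega]
    exact Walk.getVert_mem_support _ _
  · exact ⟨p.getVert e, ⟨Or.inr (Walk.getVert_mem_support _ _), getVert_ne_root hp h1 he⟩,
      mem_covered_of_mem_tail hH hp he h1 hτ (Walk.start_mem_support _)⟩

end RootCycle

/-! ### Graphs without a root cycle -/

/-- If two paths leave `r` by different edges, going out on one and back on the other shows that the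
first edge is not a bridge, so it lies on a cycle through `r`. -/
theorem snd_eq_of_no_rootCycle {H : SimpleGraph V} {r y : V} (hno : ¬ ∃ C, IsRootCycle H r C)
    (hy : y ≠ r) {w w' : H.Walk r y} (hw : w.IsPath) (hw' : w'.IsPath) : w.snd = w'.snd := by
  classical
  cases w with
  | nil => exact absurd rfl hy
  | @cons _ v _ h q =>
    cases w' with
    | nil => exact absurd rfl hy
    | @cons _ v' _ h' q' =>
      by_contra hne
      have hne : v ≠ v' := by simpa using hne
      rw [Walk.cons_isPath_iff] at hw hw'
      have : H.Adj r v ∧ (H.deleteEdges {s(r, v)}).Reachable r v := by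
        refine ⟨h, reachable_deleteEdges_iff_exists_walk.2
          ⟨Walk.cons h' (q'.append q.reverse), ?_⟩⟩
        rw [Walk.edges_cons, List.mem_cons, Walk.edges_append, List.mem_append,
          Walk.edges_reverse, List.mem_reverse]
        rintro (h1 | h1 | h1)
        · rw [Sym2.eq_iff] at h1
          rcases h1 with ⟨_, h1⟩ | ⟨h1, _⟩
          · exact hne h1
          · exact h'.ne h1
        · exact hw'.2 (Walk.fst_mem_support_of_mem_edges _ h1)
        · exact hw.2 (Walk.fst_mem_support_of_mem_edges _ h1)
      obtain ⟨u, c, hc, hce⟩ := adj_and_reachable_delete_edges_iff_exists_cycle.1 this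
      have hr := Walk.fst_mem_support_of_mem_edges _ hce
      exact hno ⟨_, c.rotate r hr, hc.rotate hr, rfl⟩

theorem mem_covered_snd {H : SimpleGraph V} {r y : V} (hno : ¬ ∃ C, IsRootCycle H r C)
    (hy : y ≠ r) {w : H.Walk r y} (hw : w.IsPath) :
    w.snd ∈ H.neighborSet r ∧ y ∈ covered H r {w.snd} := by
  have hadj := Walk.adj_snd (p := w) (Walk.not_nil_of_ne hy.symm)
  refine ⟨hadj, mem_covered_of_forall_path hadj.ne' ⟨w⟩ fun w' hw' => ?_⟩
  rw [snd_eq_of_no_rootCycle hno hy hw hw']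
  exact Walk.getVert_mem_support _ _

theorem exists_dominator_of_no_rootCycle {H : SimpleGraph V} {r y : V}
    (hno : ¬ ∃ C, IsRootCycle H r C) (hy : y ≠ r) (hry : H.Reachable r y) :
    ∃ v ∈ H.neighborSet r, y ∈ covered H r {v} := by
  obtain ⟨w, hw⟩ := hry.exists_isPath
  exact ⟨_, mem_covered_snd hno hy hw⟩

/-- Of two paths witnessing a bypass, one contains a fixed edge of the only cycle, hence a fixed end
`a ≠ r` of it. Without a root cycle all paths to `a` leave `r` through the same vertex `z`, which
therefore covers all bypassed vertices at once. -/
theorem exists_dominator_of_bypassed {H : SimpleGraph V} {r : V} (hH : AtMostOneCycle H)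
    (hno : ¬ ∃ C, IsRootCycle H r C) :
    ∃ z, ∀ y x, Bypassed H r y x → z ∈ H.neighborSet r ∧ x ∈ covered H r {z} := by
  classical
  by_cases hex : ∃ y x, Bypassed H r y x
  swap
  · exact ⟨r, fun y x h => absurd ⟨y, x, h⟩ hex⟩
  obtain ⟨a, ha, hkey⟩ : ∃ a, a ≠ r ∧ ∀ y x, Bypassed H r y x →
      ∃ w : H.Walk r x, w.IsPath ∧ a ∈ w.support := by
    obtain ⟨y, x, h⟩ := hex
    obtain ⟨w, w', hw, hw', hy, hy'⟩ := h.exists_paths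
    obtain ⟨u, v, q, q', -, -, hc⟩ := hw.exists_isCycle_of_ne hw' (fun h => hy' (h ▸ hy))
    obtain ⟨a, har, f, haf, hf⟩ : ∃ a, a ≠ r ∧ ∃ f, a ∈ f ∧ f ∈ (q.append q'.reverse).edges := by
      have hnil := hc.not_nil
      have hadj := Walk.adj_snd hnil
      have hmem := Walk.mk_start_snd_mem_edges hnil
      by_cases hu : u = r
      · exact ⟨_, fun h => hadj.ne (hu.trans h.symm), _, Sym2.mem_mk_right _ _, hmem⟩
      · exact ⟨u, hu, _, Sym2.mem_mk_left _ _, hmem⟩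
    refine ⟨a, har, fun y x h => ?_⟩
    obtain ⟨w, w', hw, hw', hy, hy'⟩ := h.exists_paths
    by_cases h1 : f ∈ w.edges
    · exact ⟨w, hw, Walk.mem_support_of_mem_edges h1 haf⟩
    by_cases h2 : f ∈ w'.edges
    · exact ⟨w', hw', Walk.mem_support_of_mem_edges h2 haf⟩
    · exact absurd (hH.path_eq hc hf hw hw' h1 h2 ▸ hy) hy'
  obtain ⟨y₀, x₀, h₀⟩ := hex
  obtain ⟨w₀, hw₀, ha₀⟩ := hkey y₀ x₀ h₀
  refine ⟨(w₀.takeUntil a ha₀).snd, fun y x h => ?_⟩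
  obtain ⟨w, hw, haw⟩ := hkey y x h
  have hxr : x ≠ r := by
    rintro rfl
    rw [(Walk.isPath_iff_nil.1 hw).eq_nil] at haw
    exact ha (by simpa using haw)
  rw [snd_eq_of_no_rootCycle hno ha (hw₀.takeUntil ha₀) (hw.takeUntil haw),
    Walk.snd_takeUntil ha]
  exact mem_covered_snd hno hxr hw

/-! ### The reduced graph -/

open Classical in
/-- The contraction of `B` to `r`. -/
noncomputable def contract (B : Set V) (r x : V) : V := if x ∈ B then r else x

theorem contract_of_mem {B : Set V} {r x : V} (h : x ∈ B) : contract B r x = r := if_pos h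

theorem contract_of_notMem {B : Set V} {r x : V} (h : x ∉ B) : contract B r x = x := if_neg h

theorem reduced_adj {G : SimpleGraph V} {r : V} {B P : Set V} {a b : V} :
    (reduced G r B P).Adj a b ↔ a ≠ b ∧ ∃ x y, G.Adj x y ∧ x ∉ P ∧ y ∉ P ∧
      contract B r x = a ∧ contract B r y = b :=
  Iff.rfl

/-- `B` contains `r`, is connected, and has no vertex in `P`. -/
structure IsState (G : SimpleGraph V) (r : V) (B P : Set V) : Prop where
  root : r ∈ B
  disj : ∀ v ∈ B, v ∉ P
  conn : ∀ b ∈ B, b ∈ region G r Bᶜ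

namespace IsState

variable {G : SimpleGraph V} {r : V} {B P : Set V}

theorem union (h : IsState G r B P) {S : Set V} (hS : ∀ v ∈ S, v ∉ B) :
    IsState G r B (P ∪ S) :=
  ⟨h.root, fun v hv hvP => hvP.elim (h.disj v hv) fun hvS => hS v hvS hv, h.conn⟩

theorem mem_or_eq (h : IsState G r B P) {x y : V} (hxy : contract B r x = contract B r y) :
    x = y ∨ (x ∈ B ∧ y ∈ B) := by
  by_cases hx : x ∈ B <;> by_cases hy : y ∈ B
  · exact Or.inr ⟨hx, hy⟩
  · rw [contract_of_mem hx, contract_of_notMem hy] at hxy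
    exact absurd (hxy ▸ h.root) hy
  · rw [contract_of_notMem hx, contract_of_mem hy] at hxy
    exact absurd (hxy ▸ h.root) hx
  · rw [contract_of_notMem hx, contract_of_notMem hy] at hxy
    exact Or.inl hxy

theorem subset_region (h : IsState G r B P) : B ⊆ region G r P := fun b hb =>
  region_anti G r (fun v hv hvB => h.disj v hvB hv) (h.conn b hb)

theorem notMem_of_adj {a b : V} (hab : (reduced G r B P).Adj a b)
    (ha : a ≠ r) : a ∉ B ∧ a ∉ P := by
  obtain ⟨_, x, y, _, hx, _, hxa, _⟩ := reduced_adj.1 hab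
  by_cases hxB : x ∈ B
  · rw [contract_of_mem hxB] at hxa
    exact absurd hxa.symm ha
  · rw [contract_of_notMem hxB] at hxa
    exact hxa ▸ ⟨hxB, hx⟩

theorem notMem_of_reachable {a : V} (hra : (reduced G r B P).Reachable r a)
    (ha : a ≠ r) : a ∉ B ∧ a ∉ P := by
  obtain ⟨w⟩ := hra.symm
  cases w with
  | nil => exact absurd rfl ha
  | cons hab _ => exact IsState.notMem_of_adj hab ha

theorem adj_of_notMem {a b : V} (hab : G.Adj a b) (ha : a ∉ B)
    (hb : b ∉ B) (haP : a ∉ P) (hbP : b ∉ P) : (reduced G r B P).Adj a b :=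
  reduced_adj.2 ⟨hab.ne, a, b, hab, haP, hbP, contract_of_notMem ha, contract_of_notMem hb⟩

theorem root_adj (h : IsState G r B P) {a b : V} (hab : G.Adj a b) (ha : a ∈ B)
    (hb : b ∉ B) (hbP : b ∉ P) : (reduced G r B P).Adj r b :=
  reduced_adj.2 ⟨fun hrb => hb (hrb ▸ h.root), a, b, hab, h.disj a ha, hbP,
    contract_of_mem ha, contract_of_notMem hb⟩

/-- An edge of the contraction comes from an edge of `G` outside `P`; consecutive ones fail to match
up only inside `B`, and all of `B` is reachable anyway. -/
theorem mem_region_of_reachable (h : IsState G r B P) {c : V}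
    (hc : (reduced G r B P).Reachable r c) {x : V} (hx : contract B r x = c) (hxP : x ∉ P) :
    x ∈ region G r P := by
  have key : ∀ {a d : V} (_ : (reduced G r B P).Walk a d), d = r → ∀ x, contract B r x = a →
      x ∉ P → x ∈ region G r P := by
    intro a d w
    induction w with
    | nil =>
      rintro rfl x hx -
      apply h.subset_region
      by_contra hxB
      rw [contract_of_notMem hxB] at hx
      exact hxB (hx ▸ h.root)
    | @cons a b d hab w ih =>
      intro hd x hx hxP
      obtain ⟨_, y, z, hyz, hy, hz, hya, hzb⟩ := reduced_adj.1 hab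
      have hz' := ih hd z hzb hz
      rcases h.mem_or_eq (hx.trans hya.symm) with rfl | ⟨hxB, _⟩
      · exact mem_region_of_adj hz' hz hyz.symm hy
      · exact h.subset_region hxB
  obtain ⟨w⟩ := hc.symm
  exact key w rfl x hx hxP

theorem reachable_of_mem_region (h : IsState G r B P) {x : V} (hx : x ∈ region G r P) :
    (reduced G r B P).Reachable r (contract B r x) := by
  have key : ∀ {a d : V} (_ : (removeVerts G P).Walk a d), d = r →
      (reduced G r B P).Reachable r (contract B r a) := by
    intro a d w
    induction w with
    | nil => rintro rfl; rw [contract_of_mem h.root]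
    | @cons a b d hab w ih =>
      intro hd
      by_cases heq : contract B r a = contract B r b
      · rw [heq]; exact ih hd
      · refine (ih hd).trans (Adj.reachable ?_)
        exact reduced_adj.2 ⟨Ne.symm heq, b, a, hab.1.symm, hab.2.2, hab.2.1, rfl, rfl⟩
  obtain ⟨w⟩ := (hx : (removeVerts G P).Reachable r x).symm
  exact key w rfl

theorem reachable_iff (h : IsState G r B P) {x : V} (hx : x ∉ B) :
    (reduced G r B P).Reachable r x ↔ x ∈ region G r P := by
  constructor
  · intro hrx
    have hxr : x ≠ r := fun hxr => hx (hxr ▸ h.root)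
    exact h.mem_region_of_reachable hrx (contract_of_notMem hx)
      (IsState.notMem_of_reachable hrx hxr).2
  · intro hrx
    simpa [contract_of_notMem hx] using h.reachable_of_mem_region hrx

theorem removeVerts_reduced (h : IsState G r B P) {S : Set V} (hS : ∀ v ∈ S, v ∉ B) :
    removeVerts (reduced G r B P) S = reduced G r B (P ∪ S) := by
  have key : ∀ x, x ∉ P → (contract B r x ∉ S ↔ x ∉ P ∪ S) := by
    intro x hx
    by_cases hxB : x ∈ B
    · rw [contract_of_mem hxB]
      exact iff_of_true (fun hr => hS r hr h.root) fun hx' => hx'.elim hx fun hxS => hS x hxS hxB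
    · rw [contract_of_notMem hxB]
      simp [hx]
  ext a b
  constructor
  · rintro ⟨hab, ha, hb⟩
    obtain ⟨hne, x, y, hxy, hx, hy, rfl, rfl⟩ := reduced_adj.1 hab
    exact reduced_adj.2 ⟨hne, x, y, hxy, (key x hx).1 ha, (key y hy).1 hb, rfl, rfl⟩
  · intro hab
    obtain ⟨hne, x, y, hxy, hx, hy, rfl, rfl⟩ := reduced_adj.1 hab
    have hx' := fun h => hx (Or.inl h)
    have hy' := fun h => hy (Or.inl h)
    exact ⟨reduced_adj.2 ⟨hne, x, y, hxy, hx', hy', rfl, rfl⟩, (key x hx').2 hx, (key y hy').2 hy⟩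

theorem mem_region_reduced (h : IsState G r B P) {S : Set V} (hS : ∀ v ∈ S, v ∉ B) {x : V}
    (hx : x ∉ B) : x ∈ region (reduced G r B P) r S ↔ x ∈ region G r (P ∪ S) := by
  rw [region, Set.mem_ofPred_eq, h.removeVerts_reduced hS]
  exact (h.union hS).reachable_iff hx

/-- Weights in the changing reduced graphs become differences of regions in the fixed graph `G`.
Burning vertices lie in both regions and do not contribute. -/
theorem covered_reduced (h : IsState G r B P) {S : Set V} (hS : ∀ v ∈ S \ {r}, v ∉ B) :
    covered (reduced G r B P) r S = region G r P \ region G r (P ∪ S \ {r}) := by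
  rw [covered_eq]
  ext x
  rw [Set.mem_sdiff, Set.mem_sdiff, mem_region_empty]
  by_cases hx : x ∈ B
  · refine iff_of_false (fun hx' => ?_) fun hx' => hx'.2 ((h.union hS).subset_region hx)
    by_cases hxr : x = r
    · exact hx'.2 (hxr ▸ self_mem_region _ _ _)
    · exact (IsState.notMem_of_reachable hx'.1 hxr).1 hx
  · rw [h.reachable_iff hx, h.mem_region_reduced hS hx]

theorem covered_reduced' (h : IsState G r B P) {S : Set V} (hS : ∀ v ∈ S, v ∉ B) :
    covered (reduced G r B P) r S = region G r P \ region G r (P ∪ S) := by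
  rw [h.covered_reduced fun v hv => hS v hv.1, Set.sdiff_singleton_eq_self]
  exact fun hr => hS r hr h.root

/-- Edges of the contraction lift to `G`, and consecutive lifts are joined inside `B`. The edges
within `B` contract to loops, so `hF` keeps them when the preimage of `F` is deleted. -/
theorem lift_reachable (h : IsState G r B P) {F : Set (Sym2 V)} (hF : ∀ v, s(v, v) ∉ F)
    {a c : V} (hac : ((reduced G r B P).deleteEdges F).Reachable a c) {x y : V}
    (hx : contract B r x = a) (hy : contract B r y = c) :
    (G.deleteEdges (Sym2.map (contract B r) ⁻¹' F)).Reachable x y := by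
  have hB : ∀ b ∈ B, (G.deleteEdges (Sym2.map (contract B r) ⁻¹' F)).Reachable r b := by
    intro b hb
    refine Reachable.mono (fun u v huv => ?_) (h.conn b hb)
    refine deleteEdges_adj.2 ⟨huv.1, fun hF' => hF r ?_⟩
    rw [Set.mem_preimage, Sym2.map_mk, contract_of_mem (not_not.1 huv.2.1),
      contract_of_mem (not_not.1 huv.2.2)] at hF'
    exact hF'
  have hfib : ∀ u v, contract B r u = contract B r v →
      (G.deleteEdges (Sym2.map (contract B r) ⁻¹' F)).Reachable u v := by
    intro u v huv
    rcases h.mem_or_eq huv with rfl | ⟨hu, hv⟩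
    · exact Reachable.refl _
    · exact (hB u hu).symm.trans (hB v hv)
  obtain ⟨w⟩ := hac
  induction w generalizing x with
  | nil => exact hfib x y (hx.trans hy.symm)
  | @cons a b c hab w ih =>
    obtain ⟨hab, habF⟩ := deleteEdges_adj.1 hab
    obtain ⟨_, u, v, huv, _, _, hua, hvb⟩ := reduced_adj.1 hab
    refine (hfib x u (hx.trans hua.symm)).trans ((Adj.reachable ?_).trans (ih hvb hy))
    refine deleteEdges_adj.2 ⟨huv, fun hF' => habF ?_⟩
    rwa [Set.mem_preimage, Sym2.map_mk, hua, hvb] at hF'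

/-- Cycle edges are the edges that are not bridges, and this property lifts. An edge of `p` outside
`q` would lift to an edge `xy` on a cycle of `G`; as `q` survives its deletion, `G` would have
another cycle that avoids `xy`. -/
theorem atMostOneCycle (h : IsState G r B P) (hG : AtMostOneCycle G) :
    AtMostOneCycle (reduced G r B P) := by
  have key : ∀ (u v : V) (p : (reduced G r B P).Walk u u) (q : (reduced G r B P).Walk v v),
      p.IsCycle → q.IsCycle → ∀ e, e ∈ p.edges → e ∈ q.edges := by
    intro u v p q hp hq e hep
    by_contra heq
    induction e with
    | _ a b =>
    obtain ⟨hab, hreach⟩ := adj_and_reachable_delete_edges_iff_exists_cycle.2 ⟨u, p, hp, hep⟩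
    obtain ⟨hne, x, y, hxy, _, _, hxa, hyb⟩ := reduced_adj.1 hab
    have hdiag : ∀ v, s(v, v) ≠ s(a, b) := by
      intro v hv
      rw [Sym2.eq_iff] at hv
      rcases hv with ⟨h1, h2⟩ | ⟨h1, h2⟩
      · exact hne (h1.symm.trans h2)
      · exact hne (h2.symm.trans h1)
    have hmap : Sym2.map (contract B r) s(x, y) = s(a, b) := by rw [Sym2.map_mk, hxa, hyb]
    have h1 : (G.deleteEdges {s(x, y)}).Reachable x y := by
      refine Reachable.mono (deleteEdges_anti ?_) (h.lift_reachable hdiag hreach hxa hyb)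
      rintro f rfl
      exact hmap
    obtain ⟨u', p', hp', hep'⟩ :=
      adj_and_reachable_delete_edges_iff_exists_cycle.1 ⟨hxy, h1⟩
    have hnil := hq.not_nil
    obtain ⟨c, d, hmem, hcd⟩ : ∃ c d, s(c, d) ∈ q.edges ∧ (reduced G r B P).Adj c d :=
      ⟨v, q.snd, Walk.mk_start_snd_mem_edges hnil, Walk.adj_snd hnil⟩
    have hq' := hq.toDeleteEdges (G := reduced G r B P) {s(a, b)} fun f hf hfe =>
      heq (Set.mem_singleton_iff.1 hfe ▸ hf)
    obtain ⟨-, hreach'⟩ := adj_and_reachable_delete_edges_iff_exists_cycle.2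
      ⟨v, _, hq', (by rwa [Walk.edges_transfer] : s(c, d) ∈ _)⟩
    rw [deleteEdges_deleteEdges] at hreach'
    obtain ⟨hne', x', y', hxy', _, _, hxc, hyd⟩ := reduced_adj.1 hcd
    have hmap' : Sym2.map (contract B r) s(x', y') = s(c, d) := by rw [Sym2.map_mk, hxc, hyd]
    have hdiag' : ∀ v, s(v, v) ∉ ({s(a, b)} ∪ {s(c, d)} : Set (Sym2 V)) := by
      rintro v (hv | hv)
      · exact hdiag v hv
      · rw [Set.mem_singleton_iff, Sym2.eq_iff] at hv
        rcases hv with ⟨h1, h2⟩ | ⟨h1, h2⟩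
        · exact hne' (h1.symm.trans h2)
        · exact hne' (h2.symm.trans h1)
    have h2 : ((G.deleteEdges {s(x, y)}).deleteEdges {s(x', y')}).Reachable x' y' := by
      rw [deleteEdges_deleteEdges]
      refine Reachable.mono (deleteEdges_anti ?_) (h.lift_reachable hdiag' hreach' hxc hyd)
      rintro f (rfl | rfl)
      · exact Or.inl hmap
      · exact Or.inr hmap'
    have hne2 : s(x', y') ≠ s(x, y) := by
      intro heq'
      rw [heq', hmap] at hmap'
      exact heq (hmap' ▸ hmem)
    obtain ⟨u2, q2, hq2, -⟩ := adj_and_reachable_delete_edges_iff_exists_cycle.1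
      ⟨deleteEdges_adj.2 ⟨hxy', hne2⟩, h2⟩
    have h3 := (hG _ _ p' (q2.mapLe (deleteEdges_le _)) hp'
      ((Walk.isCycle_mapLe (deleteEdges_le _)).2 hq2) s(x, y)).1 hep'
    rw [Walk.edges_mapLe_eq_edges] at h3
    have := Walk.edges_subset_edgeSet _ h3
    simp at this
  exact fun u v p q hp hq e => ⟨key u v p q hp hq e, key v u q p hq hp e⟩

end IsState

/-! ### A single iteration of the algorithm -/

theorem one_le_two_mul_sqrt_card [Finite V] [Nonempty V] : 1 ≤ 2 * √(Nat.card V : ℝ) := by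
  have : (1 : ℝ) ≤ √(Nat.card V : ℝ) := by
    rw [Real.one_le_sqrt]
    exact_mod_cast Nat.card_pos
  linarith

theorem weight_le_card [Finite V] (H : SimpleGraph V) (r : V) (S : Set V) :
    weight H r S ≤ Nat.card V :=
  Set.ncard_le_card _

theorem sqrt_weight_le [Finite V] (H : SimpleGraph V) (r : V) (S : Set V) :
    √(weight H r S : ℝ) ≤ √(Nat.card V : ℝ) :=
  Real.sqrt_le_sqrt (by exact_mod_cast weight_le_card H r S)

theorem subset_covered {H : SimpleGraph V} {r : V} {Q : Set V}
    (hQ : ∀ v ∈ Q, H.Reachable r v ∧ v ≠ r) : Q ⊆ covered H r Q :=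
  fun v hv => ⟨(hQ v hv).1.symm, fun q _ => ⟨v, q.start_mem_support, hv, (hQ v hv).2⟩⟩

theorem ncard_le_weight [Finite V] {H : SimpleGraph V} {r : V} {Q : Set V}
    (hQ : ∀ v ∈ Q, H.Reachable r v ∧ v ≠ r) : Q.ncard ≤ weight H r Q :=
  Set.ncard_le_ncard (subset_covered hQ) (Set.toFinite _)

theorem AreHeaviest.le {H : SimpleGraph V} {r : V} {C : Set V} {v₁ v₂ u : V}
    (h : AreHeaviest H r C v₁ v₂) (hu : u ∈ (H.neighborSet r ∪ C) \ {r}) :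
    weight H r {u} ≤ weight H r {v₁} := by
  obtain ⟨_, _, _, h4, h5⟩ := h
  by_cases huv : u = v₁
  · rw [huv]
  · exact (h5 u hu huv).trans h4

theorem IsRootCycle.reachable {H : SimpleGraph V} {r : V} {C : Set V} (hC : IsRootCycle H r C)
    {v : V} (hv : v ∈ (H.neighborSet r ∪ C) \ {r}) : H.Reachable r v ∧ v ≠ r := by
  classical
  obtain ⟨p, hp, rfl⟩ := hC
  refine ⟨?_, hv.2⟩
  rcases hv.1 with h | h
  · exact Adj.reachable h
  · exact ⟨p.takeUntil v h⟩

theorem weight_le_of_areHeaviest [Finite V] {H : SimpleGraph V} {r : V} {C : Set V} {v₁ v₂ y : V}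
    (hH : AtMostOneCycle H) (hC : IsRootCycle H r C) (hv : AreHeaviest H r C v₁ v₂) (hy : y ≠ r)
    (hry : H.Reachable r y) : weight H r {y} ≤ weight H r {v₁} := by
  obtain ⟨p, hp, rfl⟩ := hC
  obtain ⟨v, hvS, hyv⟩ := exists_dominator_rootCycle hH hp hy hry
  exact (weight_mono (covered_trans hyv)).trans (hv.le hvS)

namespace IsRootCycle

variable {H : SimpleGraph V} {r : V} {C : Set V}

theorem exists_neighbors (hC : IsRootCycle H r C) (hH : AtMostOneCycle H) :
    ∃ a b, a ≠ b ∧ H.neighborSet r ∩ C = {a, b} := by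
  obtain ⟨p, hp, rfl⟩ := hC
  have h3 := hp.three_le_length
  refine ⟨_, _, fun h => ?_, neighborSet_inter_eq hH hp⟩
  have := getVert_inj hp (by omega) (by omega) h
  omega

theorem covered_neighbors (hC : IsRootCycle H r C) (hH : AtMostOneCycle H) :
    covered H r (H.neighborSet r ∩ C) = covered H r C := by
  obtain ⟨p, hp, rfl⟩ := hC
  exact covered_neighbors_eq hH hp

theorem inter_subset (H : SimpleGraph V) (r : V) (C : Set V) :
    H.neighborSet r ∩ C ⊆ (H.neighborSet r ∪ C) \ {r} :=
  fun _ hv => ⟨Or.inl hv.1, fun h => H.loopless.irrefl r (Set.mem_singleton_iff.1 h ▸ hv.1)⟩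

theorem mem_covered_of_bypassed (hC : IsRootCycle H r C) (hH : AtMostOneCycle H) {y x : V}
    (h : Bypassed H r y x) : x ∈ covered H r C := by
  obtain ⟨p, hp, rfl⟩ := hC
  obtain ⟨e, he, τ, hτ⟩ := exists_isTail p hp h.reachable
  exact (mem_covered_cycle_iff hH hp he hτ).2 (h.mem_cycle hH hp he hτ).1

end IsRootCycle

namespace AlgAChoice

variable {H : SimpleGraph V} {r : V} {k : ℕ} {Q : Set V}

theorem reachable (h : AlgAChoice H r k Q) : ∀ v ∈ Q, H.Reachable r v ∧ v ≠ r := by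
  cases h with
  | noRootCycle _ v hk hC hv hmax =>
    rintro _ rfl
    exact ⟨Adj.reachable hv, (Adj.ne hv).symm⟩
  | manyHeaviest _ C v₁ v₂ hk hC hv hw =>
    rintro _ rfl
    exact hC.reachable hv.1
  | manyCycle _ C v₁ v₂ hk hC hv hw =>
    exact fun v hv => hC.reachable (IsRootCycle.inter_subset H r C hv)
  | oneHeaviest C v₁ v₂ hC hv hw =>
    rintro _ rfl
    exact hC.reachable hv.1
  | breakCycle C v₁ v₂ u hC hv hw hu hmax =>
    rintro _ rfl
    exact hC.reachable (IsRootCycle.inter_subset H r C hu)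

theorem ncard_bounds (hH : AtMostOneCycle H) (h : AlgAChoice H r k Q) :
    1 ≤ Q.ncard ∧ Q.ncard ≤ k := by
  cases h with
  | noRootCycle _ v hk hC hv hmax => simpa using hk
  | manyHeaviest _ C v₁ v₂ hk hC hv hw => simp; omega
  | manyCycle _ C v₁ v₂ hk hC hv hw =>
    obtain ⟨a, b, hab, heq⟩ := hC.exists_neighbors hH
    rw [heq, Set.ncard_pair hab]
    omega
  | oneHeaviest C v₁ v₂ hC hv hw => simp
  | breakCycle C v₁ v₂ u hC hv hw hu hmax => simp

/-- Protecting a heaviest vertex is immediate. Protecting both cycle neighbours costs two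
firefighters and gains `w(C) ≥ w(y)`, whence the factor 2. Breaking the cycle gains at least one
vertex, while `w(y) < √w(C) ≤ √n`. -/
theorem ncard_mul_weight_le [Finite V] (hH : AtMostOneCycle H) (h : AlgAChoice H r k Q) {y : V}
    (hy : y ≠ r) (hry : H.Reachable r y) :
    (Q.ncard : ℝ) * weight H r {y} ≤ 2 * √(Nat.card V : ℝ) * weight H r Q := by
  have : Nonempty V := ⟨r⟩
  have h1 := one_le_two_mul_sqrt_card (V := V)
  have key : ∀ v : V, weight H r {y} ≤ weight H r {v} →
      ((({v} : Set V).ncard : ℕ) : ℝ) * weight H r {y} ≤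
        2 * √(Nat.card V : ℝ) * weight H r {v} := by
    intro v hv
    have hv' : (weight H r {y} : ℝ) ≤ weight H r {v} := by exact_mod_cast hv
    rw [Set.ncard_singleton, Nat.cast_one, one_mul]
    refine hv'.trans (le_mul_of_one_le_left (Nat.cast_nonneg _) h1)
  have hreach := h.reachable
  cases h with
  | noRootCycle _ v hk hC hv hmax =>
    obtain ⟨u, hu, hyu⟩ := exists_dominator_of_no_rootCycle hC hy hry
    exact key v ((weight_mono (covered_trans hyu)).trans (hmax u hu))
  | manyHeaviest _ C v₁ v₂ hk hC hv hw => exact key _ (weight_le_of_areHeaviest hH hC hv hy hry)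
  | manyCycle _ C v₁ v₂ hk hC hv hw =>
    obtain ⟨a, b, hab, heq⟩ := hC.exists_neighbors hH
    have hQ : weight H r (H.neighborSet r ∩ C) = weight H r C := by
      rw [weight, hC.covered_neighbors hH, weight]
    have h2 : weight H r {y} ≤ weight H r C := by
      have := weight_le_of_areHeaviest hH hC hv hy hry
      omega
    have h2' : (weight H r {y} : ℝ) ≤ weight H r C := by exact_mod_cast h2
    rw [hQ, heq, Set.ncard_pair hab]
    push_cast
    have h3 : (1 : ℝ) ≤ √(Nat.card V : ℝ) := by
      rw [Real.one_le_sqrt]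
      exact_mod_cast Nat.card_pos
    have h4 : (0 : ℝ) ≤ weight H r C := Nat.cast_nonneg _
    nlinarith
  | oneHeaviest C v₁ v₂ hC hv hw => exact key _ (weight_le_of_areHeaviest hH hC hv hy hry)
  | breakCycle C v₁ v₂ u hC hv hw hu hmax =>
    have h2 : (weight H r {y} : ℝ) ≤ weight H r {v₁} := by
      exact_mod_cast weight_le_of_areHeaviest hH hC hv hy hry
    have h3 : (1 : ℝ) ≤ weight H r {u} := by
      have := ncard_le_weight hreach
      rw [Set.ncard_singleton] at this
      exact_mod_cast this
    have h4 := sqrt_weight_le H r C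
    have h5 : 0 ≤ √(Nat.card V : ℝ) := Real.sqrt_nonneg _
    rw [Set.ncard_singleton, Nat.cast_one, one_mul]
    nlinarith

theorem weight_le_of_no_rootCycle [Finite V] (h : AlgAChoice H r k Q)
    (hno : ¬ ∃ C, IsRootCycle H r C) {y : V} (hy : y ≠ r) (hry : H.Reachable r y) :
    weight H r {y} ≤ weight H r Q := by
  cases h with
  | noRootCycle _ v hk hC hv hmax =>
    obtain ⟨u, hu, hyu⟩ := exists_dominator_of_no_rootCycle hC hy hry
    exact (weight_mono (covered_trans hyu)).trans (hmax u hu)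
  | manyHeaviest _ C v₁ v₂ hk hC hv hw => exact absurd ⟨C, hC⟩ hno
  | manyCycle _ C v₁ v₂ hk hC hv hw => exact absurd ⟨C, hC⟩ hno
  | oneHeaviest C v₁ v₂ hC hv hw => exact absurd ⟨C, hC⟩ hno
  | breakCycle C v₁ v₂ u hC hv hw hu hmax => exact absurd ⟨C, hC⟩ hno

/-- The algorithm chooses to break the root cycle `C` at `u`. -/
structure Breaks (H : SimpleGraph V) (r : V) (C : Set V) (u : V) : Prop where
  rootCycle : IsRootCycle H r C
  light : ∀ y, y ≠ r → H.Reachable r y → (weight H r {y} : ℝ) < √(weight H r C : ℝ)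
  mem : u ∈ H.neighborSet r ∩ C
  tol_le : ∀ u' ∈ H.neighborSet r ∩ C,
    tol H r C u' √(weight H r C : ℝ) ≤ tol H r C u √(weight H r C : ℝ)

/-- Bypassed vertices lie in `κ(C)` or, without a root cycle, below a single neighbour of `r`. So
`w(C)` is compared with the gain: at least `w(C) / 2` or all of it with several firefighters, and at
least `√w(C) ≥ w(C) / √n` when a lone one takes the heaviest vertex. Only breaking the cycle
escapes. -/
theorem bypassed_bound [Finite V] (hH : AtMostOneCycle H) (h : AlgAChoice H r k Q) {X : Set V}
    (hX : ∀ x ∈ X, ∃ y, Bypassed H r y x) :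
    (X.ncard : ℝ) ≤ 2 * √(Nat.card V : ℝ) * weight H r Q ∨
      k = 1 ∧ ∃ C u, Breaks H r C u ∧ Q = {u} := by
  have : Nonempty V := ⟨r⟩
  have h1 := one_le_two_mul_sqrt_card (V := V)
  have hcyc : ∀ C, IsRootCycle H r C → (X.ncard : ℝ) ≤ weight H r C := by
    intro C hC
    have : X ⊆ covered H r C := fun x hx =>
      (hX x hx).elim fun y hy => hC.mem_covered_of_bypassed hH hy
    exact_mod_cast Set.ncard_le_ncard this (Set.toFinite _)
  have hone : ∀ a : ℝ, (X.ncard : ℝ) ≤ a → (X.ncard : ℝ) ≤ 2 * √(Nat.card V : ℝ) * a :=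
    fun a ha => ha.trans (le_mul_of_one_le_left (le_trans (Nat.cast_nonneg _) ha) h1)
  cases h with
  | noRootCycle _ v hk hC hv hmax =>
    left
    refine hone _ ?_
    rcases X.eq_empty_or_nonempty with rfl | ⟨x₀, hx₀⟩
    · simp
    obtain ⟨z, hz⟩ := exists_dominator_of_bypassed hH hC
    obtain ⟨y₀, hy₀⟩ := hX x₀ hx₀
    have h2 : X ⊆ covered H r {z} := fun x hx =>
      (hX x hx).elim fun y hy => (hz y x hy).2
    have h3 := (Set.ncard_le_ncard h2 (Set.toFinite _)).trans (hmax z (hz y₀ x₀ hy₀).1)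
    exact_mod_cast h3
  | manyHeaviest _ C v₁ v₂ hk hC hv hw =>
    left
    have h2 := hcyc C hC
    have h3 : (weight H r C : ℝ) ≤ 2 * weight H r {v₁} := by
      have := hv.2.2.2.1
      have h4 : weight H r C ≤ 2 * weight H r {v₁} := by omega
      exact_mod_cast h4
    have h3' : (1 : ℝ) ≤ √(Nat.card V : ℝ) := by
      rw [Real.one_le_sqrt]
      exact_mod_cast Nat.card_pos
    have h4 : (0 : ℝ) ≤ weight H r {v₁} := Nat.cast_nonneg _
    nlinarith
  | manyCycle _ C v₁ v₂ hk hC hv hw =>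
    left
    refine hone _ ?_
    rw [weight, hC.covered_neighbors hH]
    exact hcyc C hC
  | oneHeaviest C v₁ v₂ hC hv hw =>
    left
    have h2 := hcyc C hC
    have h3 : (weight H r C : ℝ) = √(weight H r C : ℝ) * √(weight H r C : ℝ) :=
      (Real.mul_self_sqrt (Nat.cast_nonneg _)).symm
    have h4 := sqrt_weight_le H r C
    have h5 : 0 ≤ √(weight H r C : ℝ) := Real.sqrt_nonneg _
    nlinarith
  | breakCycle C v₁ v₂ u hC hv hw hu hmax =>
    refine Or.inr ⟨rfl, C, u, ⟨hC, fun y hy hry => ?_, hu, hmax⟩, rfl⟩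
    refine lt_of_le_of_lt ?_ hw
    exact_mod_cast weight_le_of_areHeaviest hH hC hv hy hry

theorem nonempty [Finite V] (hH : AtMostOneCycle H) (hk : 1 ≤ k) (hav : HasAvailable H r) :
    ∃ Q, AlgAChoice H r k Q := by
  by_cases hno : ∃ C, IsRootCycle H r C
  · obtain ⟨C, hC⟩ := hno
    obtain ⟨a, b, hab, heq⟩ := hC.exists_neighbors hH
    have ha : a ∈ H.neighborSet r ∩ C := heq ▸ by simp
    have hb : b ∈ H.neighborSet r ∩ C := heq ▸ by simp
    have ha' := IsRootCycle.inter_subset H r C ha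
    have hb' := IsRootCycle.inter_subset H r C hb
    obtain ⟨v₁, hv₁, hmax₁⟩ := Set.exists_max_image ((H.neighborSet r ∪ C) \ {r})
      (fun v => weight H r {v}) (Set.toFinite _) ⟨a, ha'⟩
    obtain ⟨v₂, hv₂, hmax₂⟩ := Set.exists_max_image (((H.neighborSet r ∪ C) \ {r}) \ {v₁})
      (fun v => weight H r {v}) (Set.toFinite _) (by
        by_cases h : a = v₁
        · exact ⟨b, hb', fun hbv => hab (h.trans hbv.symm)⟩
        · exact ⟨a, ha', h⟩)
    have hv : AreHeaviest H r C v₁ v₂ :=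
      ⟨hv₁, hv₂.1, Ne.symm hv₂.2, hmax₁ v₂ hv₂.1, fun u hu hne => hmax₂ u ⟨hu, hne⟩⟩
    rcases hk.eq_or_lt with rfl | hk
    · by_cases hw : √(weight H r C : ℝ) ≤ weight H r {v₁}
      · exact ⟨_, oneHeaviest C v₁ v₂ hC hv hw⟩
      · obtain ⟨u, hu, hmax⟩ := Set.exists_max_image (H.neighborSet r ∩ C)
          (fun v => tol H r C v √(weight H r C : ℝ)) (Set.toFinite _) ⟨a, ha⟩
        exact ⟨_, breakCycle C v₁ v₂ u hC hv (not_le.1 hw) hu hmax⟩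
    · by_cases hw : weight H r C ≤ weight H r {v₁} + weight H r {v₂}
      · exact ⟨_, manyHeaviest k C v₁ v₂ hk hC hv hw⟩
      · exact ⟨_, manyCycle k C v₁ v₂ hk hC hv (not_le.1 hw)⟩
  · obtain ⟨y, hy, hry⟩ := hav
    obtain ⟨v₀, hv₀, -⟩ := exists_dominator_of_no_rootCycle hno hy hry
    obtain ⟨v, hv, hmax⟩ := Set.exists_max_image (H.neighborSet r)
      (fun v => weight H r {v}) (Set.toFinite _) ⟨v₀, hv₀⟩
    exact ⟨_, noRootCycle k v hk hno hv hmax⟩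

end AlgAChoice

/-! ### A round of the algorithm -/

section Round

variable {G : SimpleGraph V} {r : V} {B P Q : Set V} {k : ℕ}

theorem AlgAChoice.notMem
    (hQ : AlgAChoice (reduced G r B P) r k Q) : ∀ v ∈ Q, v ∉ B :=
  fun v hv => (IsState.notMem_of_reachable (hQ.reachable v hv).1 (hQ.reachable v hv).2).1

theorem IsState.weight_choice (h : IsState G r B P)
    (hQ : AlgAChoice (reduced G r B P) r k Q) :
    weight (reduced G r B P) r Q = (region G r P \ region G r (P ∪ Q)).ncard := by
  rw [weight, h.covered_reduced' (hQ.notMem)]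

theorem IsState.hasAvailable_iff (h : IsState G r B P) :
    HasAvailable (reduced G r B P) r ↔ ∃ y, y ∉ B ∧ y ∈ region G r P := by
  constructor
  · rintro ⟨y, hy, hry⟩
    have := (IsState.notMem_of_reachable hry hy).1
    exact ⟨y, this, (h.reachable_iff this).1 hry⟩
  · rintro ⟨y, hy, hry⟩
    exact ⟨y, fun hyr => hy (hyr ▸ h.root), (h.reachable_iff hy).2 hry⟩

theorem ncard_region_sdiff [Finite V] (G : SimpleGraph V) (r : V) {P₁ P₂ P₃ : Set V}
    (h₁ : P₁ ⊆ P₂) (h₂ : P₂ ⊆ P₃) : (region G r P₁ \ region G r P₃).ncard =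
      (region G r P₁ \ region G r P₂).ncard + (region G r P₂ \ region G r P₃).ncard := by
  rw [← Set.ncard_union_eq (Set.disjoint_left.2 fun x hx hx' => hx.2 hx'.1) (Set.toFinite _)
    (Set.toFinite _)]
  congr 1
  ext x
  have := @region_anti _ G r _ _ h₁ x
  have := @region_anti _ G r _ _ h₂ x
  simp only [Set.mem_sdiff, Set.mem_union]
  tauto

theorem AlgARound.ncard_le [Finite V] (hG : AtMostOneCycle G) (hR : AlgARound G r B P k Q)
    (h : IsState G r B P) : Q.ncard ≤ k ∧ ∀ v ∈ Q, v ∉ B := by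
  induction hR with
  | finish P k hk => simp
  | step P k Q Q' hk hav hQ hQ' ih =>
    have hB := hQ.notMem
    obtain ⟨h1, h2⟩ := ih (h.union hB)
    have h3 := (hQ.ncard_bounds (h.atMostOneCycle hG)).2
    have h4 := Set.ncard_union_le Q Q'
    exact ⟨by omega, fun v hv => hv.elim (hB v) (h2 v)⟩

/-- Sums `AlgAChoice.ncard_mul_weight_le` over the iterations. As `y` stays reachable, no
firefighter is left over. The set on the left contains only vertices surviving the whole round, so
in every intermediate graph it is part of what `y` covers. -/
theorem AlgARound.mul_ncard_le [Finite V] (hG : AtMostOneCycle G)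
    (hR : AlgARound G r B P k Q) (h : IsState G r B P) {y : V} (hyB : y ∉ B)
    (hy : y ∈ region G r (P ∪ Q)) :
    (k : ℝ) * (region G r (P ∪ Q) \ region G r (P ∪ {y})).ncard ≤
      2 * √(Nat.card V : ℝ) * (region G r P \ region G r (P ∪ Q)).ncard := by
  induction hR with
  | finish P k hk =>
    rcases hk with rfl | hk
    · simp only [Nat.cast_zero, zero_mul]
      positivity
    · exact absurd (h.hasAvailable_iff.2 ⟨y, hyB, by simpa using hy⟩) hk
  | step P k Q Q' hk hav hQ hQ' ih =>
    have hB := hQ.notMem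
    have hH := h.atMostOneCycle hG
    have hyr : y ≠ r := fun hyr => hyB (hyr ▸ h.root)
    have hyP : y ∈ region G r P := region_anti G r Set.subset_union_left hy
    rw [← Set.union_assoc] at hy ⊢
    have h1 := ih (h.union hB) hy
    have h2 := hQ.ncard_mul_weight_le hH hyr ((h.reachable_iff hyB).2 hyP)
    rw [h.weight_choice hQ, weight, h.covered_reduced' (by rintro _ rfl; exact hyB)] at h2
    have h3 := (hQ.ncard_bounds hH).2
    rw [Nat.cast_sub h3] at h1
    have h4 : (region G r (P ∪ Q ∪ Q') \ region G r (P ∪ {y})).ncard ≤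
        (region G r (P ∪ Q ∪ Q') \ region G r (P ∪ Q ∪ {y})).ncard := by
      refine Set.ncard_le_ncard (fun x hx => ⟨hx.1, fun hx' => hx.2 ?_⟩) (Set.toFinite _)
      exact region_anti G r (Set.union_subset_union_left _ Set.subset_union_left) hx'
    have h5 : (region G r (P ∪ Q ∪ Q') \ region G r (P ∪ {y})).ncard ≤
        (region G r P \ region G r (P ∪ {y})).ncard := by
      refine Set.ncard_le_ncard (fun x hx => ⟨?_, hx.2⟩) (Set.toFinite _)
      rw [Set.union_assoc] at hx
      exact region_anti G r Set.subset_union_left hx.1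
    have h4' : ((region G r (P ∪ Q ∪ Q') \ region G r (P ∪ {y})).ncard : ℝ) ≤
        (region G r (P ∪ Q ∪ Q') \ region G r (P ∪ Q ∪ {y})).ncard := by exact_mod_cast h4
    have h5' : ((region G r (P ∪ Q ∪ Q') \ region G r (P ∪ {y})).ncard : ℝ) ≤
        (region G r P \ region G r (P ∪ {y})).ncard := by exact_mod_cast h5
    rw [ncard_region_sdiff G r (P₂ := P ∪ Q) Set.subset_union_left Set.subset_union_left]
    push_cast
    have h6 : (0 : ℝ) ≤ (k : ℝ) - Q.ncard := sub_nonneg.2 (by exact_mod_cast h3)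
    have h7 : (0 : ℝ) ≤ Q.ncard := Nat.cast_nonneg _
    have h8 := mul_le_mul_of_nonneg_left h4' h6
    have h9 := mul_le_mul_of_nonneg_left h5' h7
    linarith

/-- Every protected vertex was reachable and so leaves the region itself; while `y` is reachable, no
firefighter stays idle. -/
theorem AlgARound.le_gain [Finite V]
    (hR : AlgARound G r B P k Q) (h : IsState G r B P) {y : V} (hyB : y ∉ B)
    (hy : y ∈ region G r (P ∪ Q)) : k ≤ (region G r P \ region G r (P ∪ Q)).ncard := by
  induction hR with
  | finish P k hk =>
    rcases hk with rfl | hk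
    · simp
    · exact absurd (h.hasAvailable_iff.2 ⟨y, hyB, by simpa using hy⟩) hk
  | step P k Q Q' hk hav hQ hQ' ih =>
    have hB := hQ.notMem
    rw [← Set.union_assoc] at hy ⊢
    have h1 := ih (h.union hB) hy
    have h2 := ncard_le_weight hQ.reachable
    rw [h.weight_choice hQ] at h2
    rw [ncard_region_sdiff G r (P₂ := P ∪ Q) Set.subset_union_left Set.subset_union_left]
    omega

/-- Later choices of the round only shrink the region further, so the first one may be analysed
alone. -/
theorem AlgARound.exists_first_choice [Finite V] (hR : AlgARound G r B P k Q)
    (h : IsState G r B P) (hk : 1 ≤ k) {y : V} (hyB : y ∉ B) (hy : y ∈ region G r P) :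
    ∃ Q₁ ⊆ Q, AlgAChoice (reduced G r B P) r k Q₁ ∧
      weight (reduced G r B P) r Q₁ ≤ (region G r P \ region G r (P ∪ Q)).ncard := by
  cases hR with
  | finish _ _ h0 =>
    rcases h0 with rfl | h0
    · omega
    · exact absurd (h.hasAvailable_iff.2 ⟨y, hyB, hy⟩) h0
  | step _ _ Q₁ Q₂ hk hav hQ hQ' =>
    refine ⟨Q₁, Set.subset_union_left, hQ, ?_⟩
    rw [h.weight_choice hQ]
    refine Set.ncard_le_ncard (fun x hx => ⟨hx.1, fun hx' => hx.2 ?_⟩) (Set.toFinite _)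
    exact region_anti G r (Set.union_subset_union_right _ Set.subset_union_left) hx'

theorem AlgARound.exists_round [Finite V] (hG : AtMostOneCycle G) (h : IsState G r B P) (k : ℕ) :
    ∃ Q, AlgARound G r B P k Q := by
  induction k using Nat.strong_induction_on generalizing P with
  | _ k ih =>
  by_cases hk : k = 0 ∨ ¬ HasAvailable (reduced G r B P) r
  · exact ⟨∅, finish P k hk⟩
  · push Not at hk
    have hH := h.atMostOneCycle hG
    obtain ⟨Q, hQ⟩ := AlgAChoice.nonempty hH (Nat.pos_of_ne_zero hk.1) hk.2
    have h1 := hQ.ncard_bounds hH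
    obtain ⟨Q', hQ'⟩ := ih (k - Q.ncard) (by omega) (h.union (hQ.notMem))
    exact ⟨Q ∪ Q', step P k Q Q' (Nat.pos_of_ne_zero hk.1) hk.2 hQ hQ'⟩

end Round

/-! ### Properties of the game -/

section Game

variable {G : SimpleGraph V} {r : V} {f : ℕ → ℕ} {σ : ℕ → Finset V}

theorem guarded_mono (σ : ℕ → Finset V) {i j : ℕ} (h : i ≤ j) : guarded σ i ⊆ guarded σ j :=
  fun _ ⟨k, hk, hv⟩ => ⟨k, hk.trans_le h, hv⟩

theorem guarded_succ (σ : ℕ → Finset V) (i : ℕ) :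
    guarded σ (i + 1) = guarded σ i ∪ (σ i : Set V) := by
  ext v
  simp only [guarded, Set.mem_ofPred_eq, Set.mem_union, Finset.mem_coe]
  constructor
  · rintro ⟨j, hj, hv⟩
    rcases (Nat.lt_succ_iff.1 hj).lt_or_eq with h | rfl
    · exact Or.inl ⟨j, h, hv⟩
    · exact Or.inr hv
  · rintro (⟨j, hj, hv⟩ | hv)
    · exact ⟨j, by omega, hv⟩
    · exact ⟨i, by omega, hv⟩

theorem burning_mono (G : SimpleGraph V) (r : V) (σ : ℕ → Finset V) {i j : ℕ} (h : i ≤ j) :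
    burning G r σ i ⊆ burning G r σ j :=
  monotone_nat_of_le_succ (f := burning G r σ) (fun _ => Set.subset_union_left) h

theorem root_mem_burning (G : SimpleGraph V) (r : V) (σ : ℕ → Finset V) (i : ℕ) :
    r ∈ burning G r σ i :=
  burning_mono G r σ (Nat.zero_le i) rfl

theorem mem_burning_succ {i : ℕ} {x v : V} (hx : x ∈ burning G r σ i) (h : G.Adj x v)
    (hv : v ∉ guarded σ (i + 1)) : v ∈ burning G r σ (i + 1) :=
  Or.inr ⟨hv, x, hx, h⟩

/-- There is no condition on `i` and `j`: earlier protection would have stopped the fire, and later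
protection is illegal. -/
theorem IsLegal.notMem_guarded (hσ : IsLegal G r f σ) {i j : ℕ} {v : V}
    (hv : v ∈ burning G r σ i) : v ∉ guarded σ j := by
  rintro ⟨k, -, hk⟩
  have hvk := (hσ k).2 v hk
  induction i with
  | zero => exact hvk (burning_mono G r σ (Nat.zero_le k) hv)
  | succ i ih =>
    rcases hv with hv | ⟨hv, hx⟩
    · exact ih hv
    · by_cases hki : k < i + 1
      · exact hv ⟨k, hki, hk⟩
      · have hvi : v ∈ burning G r σ (i + 1) := Or.inr ⟨hv, hx⟩
        exact hvk (burning_mono G r σ (by omega) hvi)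

theorem IsLegal.isState (hσ : IsLegal G r f σ) (i : ℕ) :
    IsState G r (burning G r σ i) (guarded σ i) where
  root := root_mem_burning G r σ i
  disj := fun _ hv => hσ.notMem_guarded hv
  conn := by
    have key : ∀ j ≤ i, burning G r σ j ⊆ region G r (burning G r σ i)ᶜ := by
      intro j
      induction j with
      | zero => rintro _ _ rfl; exact self_mem_region _ _ _
      | succ j ih =>
        rintro hj v (hv | ⟨hvg, x, hx, hxv⟩)
        · exact ih (by omega) hv
        · refine mem_region_of_adj (ih (by omega) hx) ?_ hxv ?_
          · exact fun h => h (burning_mono G r σ (by omega) hx)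
          · exact fun h => h (burning_mono G r σ hj (Or.inr ⟨hvg, x, hx, hxv⟩))
    exact key i le_rfl

theorem IsLegal.burning_subset_region (hσ : IsLegal G r f σ) (i j : ℕ) :
    burning G r σ i ⊆ region G r (guarded σ j) := fun _ hv =>
  region_anti G r (fun _ hw hw' => hσ.notMem_guarded hw' hw : guarded σ j ⊆ (burning G r σ i)ᶜ)
    ((hσ.isState i).conn _ hv)

theorem burning_congr {σ' : ℕ → Finset V} {i : ℕ} (h : ∀ j < i, σ j = σ' j) :
    burning G r σ i = burning G r σ' i ∧ guarded σ i = guarded σ' i := by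
  have hg : ∀ k ≤ i, guarded σ k = guarded σ' k := by
    intro k hk
    ext v
    constructor
    · rintro ⟨j, hj, hv⟩; exact ⟨j, hj, h j (by omega) ▸ hv⟩
    · rintro ⟨j, hj, hv⟩; exact ⟨j, hj, (h j (by omega)).symm ▸ hv⟩
  refine ⟨?_, hg i le_rfl⟩
  have key : ∀ k ≤ i, burning G r σ k = burning G r σ' k := by
    intro k
    induction k with
    | zero => intro _; rfl
    | succ k ih =>
      intro hk
      rw [burning, burning, ih (by omega), hg (k + 1) hk]
  exact key i le_rfl

end Game

/-! ### Existence of the algorithm -/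

theorem IsOneAlmostTree.atMostOneCycle {G : SimpleGraph V} (h : IsOneAlmostTree G) :
    AtMostOneCycle G := h.2

/-- `Q` may be protected in round `i` after the moves `σ` of the previous rounds. -/
def IsAlgAMove (G : SimpleGraph V) (r : V) (σ : ℕ → Finset V) (i k : ℕ) (Q : Finset V) : Prop :=
  (Q.card ≤ k ∧ ∀ v ∈ Q, v ∉ burning G r σ i) ∧
    AlgARound G r (burning G r σ i) (guarded σ i) k (Q : Set V)

-- The default `∅` makes the algorithm total and legal also on graphs where no admissible move
-- exists.
open Classical in
noncomputable def algAMove (G : SimpleGraph V) (r : V) (σ : ℕ → Finset V) (i k : ℕ) : Finset V :=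
  if h : ∃ Q, IsAlgAMove G r σ i k Q then h.choose else ∅

theorem algAMove_legal (G : SimpleGraph V) (r : V) (σ : ℕ → Finset V) (i k : ℕ) :
    (algAMove G r σ i k).card ≤ k ∧ ∀ v ∈ algAMove G r σ i k, v ∉ burning G r σ i := by
  rw [algAMove]
  split_ifs with h
  · exact h.choose_spec.1
  · simp

/-- The moves of the first `n` rounds. -/
noncomputable def algAHistory (G : SimpleGraph V) (r : V) (f : ℕ → ℕ) : ℕ → ℕ → Finset V
  | 0 => fun _ => ∅
  | n + 1 => Function.update (algAHistory G r f n) n (algAMove G r (algAHistory G r f n) n (f n))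

noncomputable def algAPlay (G : SimpleGraph V) (r : V) (f : ℕ → ℕ) (i : ℕ) : Finset V :=
  algAMove G r (algAHistory G r f i) i (f i)

theorem algAHistory_eq (G : SimpleGraph V) (r : V) (f : ℕ → ℕ) {n j : ℕ} (h : j < n) :
    algAHistory G r f n j = algAPlay G r f j := by
  induction n with
  | zero => omega
  | succ n ih =>
    rw [algAHistory]
    rcases (Nat.lt_succ_iff.1 h).lt_or_eq with h | rfl
    · rw [Function.update_of_ne h.ne, ih h]
    · rw [Function.update_self, algAPlay]

theorem algAHistory_congr (G : SimpleGraph V) (r : V) {f f' : ℕ → ℕ} {n : ℕ}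
    (h : ∀ j < n, f j = f' j) : algAHistory G r f n = algAHistory G r f' n := by
  induction n with
  | zero => rfl
  | succ n ih => rw [algAHistory, algAHistory, ih fun j hj => h j (by omega), h n (by omega)]

theorem algAPlay_burning (G : SimpleGraph V) (r : V) (f : ℕ → ℕ) (i : ℕ) :
    burning G r (algAHistory G r f i) i = burning G r (algAPlay G r f) i ∧
      guarded (algAHistory G r f i) i = guarded (algAPlay G r f) i :=
  burning_congr fun _ hj => algAHistory_eq G r f hj

theorem algAPlay_legal (G : SimpleGraph V) (r : V) (f : ℕ → ℕ) :
    IsLegal G r f (algAPlay G r f) := fun i => by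
  have := algAMove_legal G r (algAHistory G r f i) i (f i)
  rwa [(algAPlay_burning G r f i).1] at this

theorem exists_isAlgA : ∃ A : OnlineAlgorithm, A.IsAlgA := by
  refine ⟨⟨fun V G r f => algAPlay G r f, fun V G r f f' i h => ?_, fun V => algAPlay_legal⟩, ?_⟩
  · show algAPlay G r f i = algAPlay G r f' i
    rw [algAPlay, algAPlay, algAHistory_congr G r fun j hj => h j hj.le, h i le_rfl]
  · intro V _ G hG r f i
    show AlgARound G r (burning G r (algAPlay G r f) i) (guarded (algAPlay G r f) i) (f i)
      (algAPlay G r f i : Set V)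
    have hb := algAPlay_burning G r f i
    have hS := (algAPlay_legal G r f).isState i
    have hex : ∃ Q, IsAlgAMove G r (algAHistory G r f i) i (f i) Q := by
      obtain ⟨Q, hQ⟩ := AlgARound.exists_round hG.atMostOneCycle hS (f i)
      obtain ⟨h1, h2⟩ := hQ.ncard_le hG.atMostOneCycle hS
      have hfin : Q.Finite := Set.toFinite Q
      refine ⟨hfin.toFinset, ⟨?_, ?_⟩, ?_⟩
      · rwa [← Set.ncard_eq_toFinset_card Q hfin]
      · intro v hv
        rw [hb.1]
        exact h2 v (by simpa using hv)
      · rw [hb.1, hb.2]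
        simpa using hQ
    have := hex.choose_spec.2
    rw [hb.1, hb.2] at this
    rw [algAPlay, algAMove, dif_pos hex]
    exact this

/-! ### Fire paths -/

section Fire

variable {G : SimpleGraph V} {r : V} {f : ℕ → ℕ} {σ ω : ℕ → Finset V}

/-- The path is traced back through predecessors and runs at the speed of the fire: its `j`-th
vertex burns in round `j` and not before. -/
theorem exists_fire_path {i : ℕ} {v : V} (hv : v ∈ burning G r σ i) :
    ∃ w : G.Walk r v, w.IsPath ∧ w.length ≤ i ∧ (∀ j ≤ w.length, w.getVert j ∈ burning G r σ j) ∧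
      ∀ j < w.length, w.getVert (j + 1) ∉ burning G r σ j := by
  induction i generalizing v with
  | zero =>
    obtain rfl : v = r := hv
    exact ⟨Walk.nil, Walk.IsPath.nil, le_rfl, fun j hj => root_mem_burning G v σ j, by simp⟩
  | succ i ih =>
    by_cases hvi : v ∈ burning G r σ i
    · obtain ⟨w, hw, hl, h⟩ := ih hvi
      exact ⟨w, hw, by omega, h⟩
    · obtain ⟨hvg, x, hx, hxv⟩ := hv.resolve_left hvi
      obtain ⟨w, hw, hl, h1, h2⟩ := ih hx
      -- A shorter path to `x` would have set `v` on fire in an earlier round.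
      have hli : w.length = i := by
        by_contra hne
        refine hvi (burning_mono G r σ (i := w.length + 1) (by omega) ?_)
        have hxl := h1 w.length le_rfl
        rw [Walk.getVert_length] at hxl
        exact mem_burning_succ hxl hxv fun hg => hvg (guarded_mono σ (by omega) hg)
      have hget : ∀ j ≤ i, (w.concat hxv).getVert j = w.getVert j := by
        intro j hj
        rw [Walk.concat_eq_append, Walk.getVert_append]
        split_ifs with h
        · rfl
        · obtain rfl : j = w.length := by omega
          simp
      have hlast : (w.concat hxv).getVert (i + 1) = v := by
        rw [Walk.getVert_of_length_le]
        simp [hli]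
      refine ⟨w.concat hxv, hw.concat ?_ hxv, by simp [hli], ?_, ?_⟩
      · intro hvw
        obtain ⟨n, rfl, hn⟩ := Walk.mem_support_iff_exists_getVert.1 hvw
        exact hvi (burning_mono G r σ (by omega) (h1 n hn))
      · intro j hj
        rw [Walk.length_concat, hli] at hj
        rcases hj.lt_or_eq with hj | rfl
        · rw [hget j (by omega)]
          exact h1 j (by omega)
        · rw [hlast]
          exact Or.inr ⟨hvg, x, hx, hxv⟩
      · intro j hj
        rw [Walk.length_concat, hli] at hj
        rcases (Nat.lt_succ_iff.1 hj).lt_or_eq with hj | rfl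
        · rw [hget (j + 1) (by omega)]
          exact h2 j (by omega)
        · rw [hlast]
          exact hvi

/-- A walk to a saved vertex is blocked by a vertex that is protected in time. -/
theorem exists_blocking {x : V} (hx : ∀ i, x ∉ burning G r ω i) (w : G.Walk r x) :
    ∃ j i, i < j ∧ j ≤ w.length ∧ w.getVert j ∈ ω i := by
  by_contra! hcon
  have key : ∀ j ≤ w.length, w.getVert j ∈ burning G r ω j := by
    intro j
    induction j with
    | zero => intro _; rw [Walk.getVert_zero]; exact root_mem_burning G r ω 0
    | succ j ih =>
      intro hj
      refine mem_burning_succ (ih (by omega)) (w.adj_getVert_succ (by omega)) ?_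
      rintro ⟨i, hi, hmem⟩
      exact hcon (j + 1) i hi hj hmem
  have := key w.length le_rfl
  rw [Walk.getVert_length] at this
  exact hx _ this

/-- Only the start of the path burns, so contraction merely renames it to `r`. -/
theorem IsState.exists_contracted_path {B P : Set V} (h : IsState G r B P) {a x : V}
    (w : G.Walk a x) (hw : w.IsPath) (ha : a ∈ B) (hx : x ∉ B)
    (hwB : ∀ j, 1 ≤ j → j ≤ w.length → w.getVert j ∉ B ∧ w.getVert j ∉ P) :
    ∃ w' : (reduced G r B P).Walk r x, w'.IsPath ∧ w'.length = w.length ∧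
      ∀ j, 1 ≤ j → w'.getVert j = w.getVert j := by
  cases w with
  | nil => exact absurd ha hx
  | @cons _ b _ hab q =>
    rw [Walk.cons_isPath_iff] at hw
    have hq : ∀ v ∈ q.support, v ∉ B ∧ v ∉ P := by
      intro v hv
      obtain ⟨n, rfl, hn⟩ := Walk.mem_support_iff_exists_getVert.1 hv
      simpa using hwB (n + 1) (by omega) (by simpa using hn)
    have hb := hq b (Walk.start_mem_support _)
    have hedge : ∀ e ∈ q.edges, e ∈ (reduced G r B P).edgeSet := by
      intro e he
      induction e with
      | _ c d =>
      have hc := hq c (Walk.fst_mem_support_of_mem_edges _ he)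
      have hd := hq d (Walk.snd_mem_support_of_mem_edges _ he)
      exact IsState.adj_of_notMem (Walk.adj_of_mem_edges _ he) hc.1 hd.1 hc.2 hd.2
    refine ⟨Walk.cons (h.root_adj hab ha hb.1 hb.2) (q.transfer _ hedge), ?_, by simp, ?_⟩
    · rw [Walk.cons_isPath_iff]
      refine ⟨hw.1.transfer _, ?_⟩
      rw [Walk.support_transfer]
      exact fun hr => (hq r hr).1 h.root
    · intro j hj
      obtain ⟨j, rfl⟩ : ∃ k, j = k + 1 := ⟨j - 1, by omega⟩
      rw [Walk.getVert_cons_succ, Walk.getVert_cons_succ]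
      rw [Walk.getVert_eq_getD_support, Walk.getVert_eq_getD_support, Walk.support_transfer]

/-- The way along which the fire reaches a vertex, seen in the reduced graph of round `i`. -/
theorem IsLegal.exists_reduced_fire_path (hσ : IsLegal G r f σ) {v : V} {m : ℕ} {w : G.Walk r v}
    (hw : w.IsPath) (hm : w.length = m) (h1 : ∀ j ≤ m, w.getVert j ∈ burning G r σ j)
    (h2 : ∀ j < m, w.getVert (j + 1) ∉ burning G r σ j) {i : ℕ} (hi : i < m) :
    ∃ w' : (reduced G r (burning G r σ i) (guarded σ i)).Walk r v, w'.IsPath ∧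
      w'.length = m - i ∧ ∀ j, 1 ≤ j → w'.getVert j = w.getVert (i + j) := by
  have hnot : ∀ j, i < j → j ≤ m → w.getVert j ∉ burning G r σ i := by
    intro j hij hj hmem
    have := h2 (j - 1) (by omega)
    rw [Nat.sub_add_cancel (by omega)] at this
    exact this (burning_mono G r σ (by omega) hmem)
  obtain ⟨w', hw', hl, hget⟩ := (hσ.isState i).exists_contracted_path (w.drop i) (hw.drop i)
    (h1 i hi.le) (by simpa [← hm] using hnot m hi le_rfl) (by
      intro j hj hjl
      rw [Walk.drop_length] at hjl
      rw [Walk.drop_getVert]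
      exact ⟨hnot _ (by omega) (by omega), hσ.notMem_guarded (h1 (i + j) (by omega))⟩)
  refine ⟨w', hw', by rw [hl, Walk.drop_length, hm], fun j hj => ?_⟩
  rw [hget j hj, Walk.drop_getVert]

/-- A vertex that burns in round `i + t`, but not in round `i`, is reached by a short path. -/
theorem IsLegal.exists_short_path (hσ : IsLegal G r f σ) {v : V} {i t : ℕ}
    (hv : v ∈ burning G r σ (i + t)) (hvi : v ∉ burning G r σ i) :
    ∃ w : (reduced G r (burning G r σ i) (guarded σ i)).Walk r v, w.IsPath ∧ w.length ≤ t ∧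
      ∀ x ∈ w.support, ∀ j, x ∉ guarded σ j := by
  obtain ⟨w, hw, hl, h1, h2⟩ := exists_fire_path hv
  have hi : i < w.length := by
    by_contra hi
    have := h1 w.length le_rfl
    rw [Walk.getVert_length] at this
    exact hvi (burning_mono G r σ (by omega) this)
  obtain ⟨w', hw', hl', hget⟩ := hσ.exists_reduced_fire_path hw rfl h1 h2 hi
  refine ⟨w', hw', by omega, fun x hx j => ?_⟩
  obtain ⟨n, rfl, hn⟩ := Walk.mem_support_iff_exists_getVert.1 hx
  rcases Nat.eq_zero_or_pos n with rfl | hn0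
  · rw [Walk.getVert_zero]
    exact hσ.notMem_guarded (root_mem_burning G r σ 0)
  · rw [hget n hn0]
    exact hσ.notMem_guarded (h1 (i + n) (by omega))

end Fire

/-! ### Comparison of two plays -/

/-- The play `σ` follows the algorithm, and `ω` is another play on the same instance. -/
structure Compared (G : SimpleGraph V) (r : V) (f : ℕ → ℕ) (σ ω : ℕ → Finset V) : Prop where
  atMostOneCycle : AtMostOneCycle G
  legal : IsLegal G r f σ
  legal' : IsLegal G r f ω
  round : ∀ i, AlgARound G r (burning G r σ i) (guarded σ i) (f i) (σ i : Set V)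

/-- The vertices that are saved by `ω` and not by `σ`. -/
def lost (G : SimpleGraph V) (r : V) (σ ω : ℕ → Finset V) : Set V :=
  {x | (∀ i, x ∉ burning G r ω i) ∧ ∃ i, x ∈ burning G r σ i}

/-- The number of vertices that become unreachable for the fire by the moves of round `i`. -/
noncomputable def gain (G : SimpleGraph V) (r : V) (σ : ℕ → Finset V) (i : ℕ) : ℕ :=
  (region G r (guarded σ i) \ region G r (guarded σ (i + 1))).ncard

/-- The graph that the algorithm sees at the beginning of round `i`. -/
abbrev roundGraph (G : SimpleGraph V) (r : V) (σ : ℕ → Finset V) (i : ℕ) : SimpleGraph V :=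
  reduced G r (burning G r σ i) (guarded σ i)

/-- The lost vertices that some vertex protected by `ω` cuts off from the fire of `σ`. -/
def dominated (G : SimpleGraph V) (r : V) (σ ω : ℕ → Finset V) : Set V :=
  {x ∈ lost G r σ ω | ∃ i, ∃ y ∈ ω i, y ∉ burning G r σ i ∧
    x ∉ region G r (guarded σ i ∪ {y})}

/-! ### Gains per round and the charge for dominated vertices -/

section Gain

variable [Finite V] {G : SimpleGraph V} {r : V} {f : ℕ → ℕ} {σ ω : ℕ → Finset V}

theorem profit_le_add (G : SimpleGraph V) (r : V) (σ ω : ℕ → Finset V) :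
    profit G r ω ≤ profit G r σ + (lost G r σ ω).ncard := by
  refine (Set.ncard_le_ncard (t := {v | ∀ i, v ∉ burning G r σ i} ∪ lost G r σ ω) ?_
    (Set.toFinite _)).trans (Set.ncard_union_le _ _)
  intro x hx
  by_cases h : ∃ i, x ∈ burning G r σ i
  · exact Or.inr ⟨hx, h⟩
  · exact Or.inl (not_exists.1 h)

theorem IsLegal.ncard_compl_region_le (hσ : IsLegal G r f σ) (i : ℕ) :
    (region G r (guarded σ i))ᶜ.ncard ≤ profit G r σ :=
  Set.ncard_le_ncard (fun _ hx j hj => hx (hσ.burning_subset_region j i hj)) (Set.toFinite _)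

theorem ncard_compl_region_succ (i : ℕ) :
    (region G r (guarded σ (i + 1)))ᶜ.ncard =
      (region G r (guarded σ i))ᶜ.ncard + gain G r σ i := by
  have hdisj : Disjoint (region G r (guarded σ i))ᶜ
      (region G r (guarded σ i) \ region G r (guarded σ (i + 1))) :=
    Set.disjoint_left.2 fun x hx hx' => hx hx'.1
  rw [gain, ← Set.ncard_union_eq hdisj (Set.toFinite _) (Set.toFinite _)]
  congr 1
  ext x
  have := @region_anti _ G r _ _ (guarded_mono σ (Nat.le_succ i)) x
  simp only [Set.mem_compl_iff, Set.mem_union, Set.mem_sdiff]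
  tauto

/-- The gains count disjoint sets of vertices, and what has been cut off never burns. -/
theorem IsLegal.sum_gain_le (hσ : IsLegal G r f σ) (n : ℕ) :
    ∑ i ∈ Finset.range n, gain G r σ i ≤ profit G r σ := by
  refine le_trans ?_ (hσ.ncard_compl_region_le n)
  induction n with
  | zero => simp
  | succ n ih =>
    rw [Finset.sum_range_succ, ncard_compl_region_succ]
    omega

theorem IsLegal.gain_le (hσ : IsLegal G r f σ) (i : ℕ) : gain G r σ i ≤ profit G r σ := by
  have h1 := hσ.ncard_compl_region_le (i + 1)
  rw [ncard_compl_region_succ] at h1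
  omega

theorem exists_burning_eventually (G : SimpleGraph V) (r : V) (σ : ℕ → Finset V) :
    ∃ n, ∀ x i, x ∈ burning G r σ i → x ∈ burning G r σ n := by
  classical
  have : Fintype V := Fintype.ofFinite V
  have h : ∀ x, ∃ n, ∀ i, x ∈ burning G r σ i → x ∈ burning G r σ n := by
    intro x
    by_cases hx : ∃ i, x ∈ burning G r σ i
    · obtain ⟨i, hi⟩ := hx
      exact ⟨i, fun _ _ => hi⟩
    · exact ⟨0, fun i hi => absurd ⟨i, hi⟩ hx⟩
  choose n hn using h
  exact ⟨Finset.univ.sup n, fun x i hi =>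
    burning_mono G r σ (Finset.le_sup (Finset.mem_univ x)) (hn x i hi)⟩

theorem ncard_biUnion_le_sum {ι α : Type} [Finite α] (s : Finset ι) (t : ι → Set α) :
    (⋃ i ∈ s, t i).ncard ≤ ∑ i ∈ s, (t i).ncard := by
  classical
  induction s using Finset.induction_on with
  | empty => simp
  | insert a s ha ih =>
    rw [Finset.set_biUnion_insert, Finset.sum_insert ha]
    exact (Set.ncard_union_le _ _).trans (by omega)

namespace Compared

/-- For each `y`, `f i` times the number of vertices it dominates is at most `2√n` times the gain.
Summing over the at most `f i` vertices of `ω i` lets the factor `f i` cancel. -/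
theorem dominated_round_le (h : Compared G r f σ ω) (i : ℕ) :
    ({x ∈ lost G r σ ω | ∃ y ∈ ω i, y ∉ burning G r σ i ∧
      x ∉ region G r (guarded σ i ∪ {y})}.ncard : ℝ) ≤
      2 * √(Nat.card V : ℝ) * gain G r σ i := by
  classical
  set T := {x ∈ lost G r σ ω | ∃ y ∈ ω i, y ∉ burning G r σ i ∧
      x ∉ region G r (guarded σ i ∪ {y})} with hT
  have hS := h.legal.isState i
  have hpos : 0 ≤ 2 * √(Nat.card V : ℝ) * gain G r σ i := by positivity
  have hcard := (h.legal' i).1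
  rcases Nat.eq_zero_or_pos (f i) with h0 | h0
  · have hω : ω i = ∅ := Finset.card_eq_zero.1 (by omega)
    have : T = ∅ := by
      ext x
      simp [hT, hω]
    rw [this]
    simpa using hpos
  set K : V → Set V := fun y => {x ∈ T | y ∉ burning G r σ i ∧
      x ∉ region G r (guarded σ i ∪ {y})} with hK
  have hTK : T ⊆ ⋃ y ∈ ω i, K y := by
    intro x hx
    obtain ⟨y, hy, hyx⟩ := hx.2
    exact Set.mem_biUnion (Finset.mem_coe.2 hy) ⟨hx, hyx⟩
  have h1 : T.ncard ≤ ∑ y ∈ ω i, (K y).ncard :=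
    (Set.ncard_le_ncard hTK (Set.toFinite _)).trans (ncard_biUnion_le_sum _ _)
  have h2 : ∀ y ∈ ω i, (f i : ℝ) * (K y).ncard ≤ 2 * √(Nat.card V : ℝ) * gain G r σ i := by
    intro y _
    rcases (K y).eq_empty_or_nonempty with he | ⟨x, hx⟩
    · rw [he]
      simpa using hpos
    have hreg : ∀ x ∈ K y, x ∈ region G r (guarded σ (i + 1)) := by
      intro x hx
      obtain ⟨j, hj⟩ := hx.1.1.2
      exact h.legal.burning_subset_region j _ hj
    -- The fire of `σ` still has a way to `x` after this round, and `y` separates `x` from `r`, so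
    -- `y` is on that way.
    have hy : y ∈ region G r (guarded σ (i + 1)) := by
      obtain ⟨w, hw, hwS⟩ := exists_path_of_mem_region
        (h.legal.notMem_guarded (root_mem_burning G r σ 0)) (hreg x hx)
      by_contra hy
      refine hx.2.2 (mem_region_of_walk w fun v hv hvS => ?_)
      rcases hvS with hvS | rfl
      · exact hwS v hv (guarded_mono σ (Nat.le_succ i) hvS)
      · exact hy (mem_region_of_walk (w.takeUntil _ hv) fun u hu =>
          hwS u (Walk.support_takeUntil_subset_support _ hv hu))
    rw [guarded_succ] at hy
    have h3 := (h.round i).mul_ncard_le h.atMostOneCycle hS hx.2.1 hy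
    rw [← guarded_succ] at h3
    refine le_trans (mul_le_mul_of_nonneg_left ?_ (Nat.cast_nonneg _)) h3
    have h4 : K y ⊆ region G r (guarded σ (i + 1)) \ region G r (guarded σ i ∪ {y}) :=
      fun z hz => ⟨hreg z hz, hz.2.2⟩
    exact_mod_cast Set.ncard_le_ncard h4 (Set.toFinite _)
  have h3 : (f i : ℝ) * T.ncard ≤ f i * (2 * √(Nat.card V : ℝ) * gain G r σ i) := by
    calc (f i : ℝ) * T.ncard ≤ f i * ∑ y ∈ ω i, ((K y).ncard : ℝ) :=
          mul_le_mul_of_nonneg_left (by exact_mod_cast h1) (Nat.cast_nonneg _)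
      _ = ∑ y ∈ ω i, (f i : ℝ) * (K y).ncard := Finset.mul_sum _ _ _
      _ ≤ ∑ _y ∈ ω i, 2 * √(Nat.card V : ℝ) * gain G r σ i := Finset.sum_le_sum h2
      _ = (ω i).card * (2 * √(Nat.card V : ℝ) * gain G r σ i) := by
          rw [Finset.sum_const, nsmul_eq_mul]
      _ ≤ f i * (2 * √(Nat.card V : ℝ) * gain G r σ i) :=
          mul_le_mul_of_nonneg_right (by exact_mod_cast hcard) hpos
  exact le_of_mul_le_mul_left h3 (by exact_mod_cast h0)

theorem dominated_le (h : Compared G r f σ ω) :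
    ((dominated G r σ ω).ncard : ℝ) ≤ 2 * √(Nat.card V : ℝ) * profit G r σ := by
  obtain ⟨n, hn⟩ := exists_burning_eventually G r σ
  have hsub : dominated G r σ ω ⊆ ⋃ i ∈ Finset.range n, {x ∈ lost G r σ ω | ∃ y ∈ ω i,
      y ∉ burning G r σ i ∧ x ∉ region G r (guarded σ i ∪ {y})} := by
    rintro x ⟨hx, i, y, hy, hyB, hxy⟩
    refine Set.mem_biUnion (x := i) ?_ ⟨hx, y, hy, hyB, hxy⟩
    -- From round `n` on the fire is stationary, so `x` would burn already and could not be cut off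
    -- by `y`.
    by_contra hi
    have hi : n ≤ i := by simpa using hi
    obtain ⟨j, hj⟩ := hx.2
    exact hxy (((h.legal.isState i).union (by rintro _ rfl; exact hyB)).subset_region
      (burning_mono G r σ hi (hn x j hj)))
  have h1 := (Set.ncard_le_ncard hsub (Set.toFinite _)).trans (ncard_biUnion_le_sum _ _)
  calc ((dominated G r σ ω).ncard : ℝ)
      ≤ ∑ i ∈ Finset.range n, (({x ∈ lost G r σ ω | ∃ y ∈ ω i,
      y ∉ burning G r σ i ∧ x ∉ region G r (guarded σ i ∪ {y})} : Set V).ncard : ℝ) := by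
        exact_mod_cast h1
    _ ≤ ∑ i ∈ Finset.range n, 2 * √(Nat.card V : ℝ) * (gain G r σ i : ℝ) :=
        Finset.sum_le_sum fun i _ => h.dominated_round_le i
    _ = 2 * √(Nat.card V : ℝ) * ((∑ i ∈ Finset.range n, gain G r σ i : ℕ) : ℝ) := by
        rw [← Finset.mul_sum]; push_cast; rfl
    _ ≤ 2 * √(Nat.card V : ℝ) * profit G r σ := by
        refine mul_le_mul_of_nonneg_left ?_ (by positivity)
        exact_mod_cast h.legal.sum_gain_le n

end Compared

end Gain

/-! ### Lifting cycles and paths out of the reduced graph -/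

theorem IsState.adj_of_reduced {G : SimpleGraph V} {r : V} {B P : Set V}
    {c d : V} (hcd : (reduced G r B P).Adj c d) (hd : d ≠ r) :
    ∃ x, G.Adj x d ∧ contract B r x = c := by
  obtain ⟨_, x, y, hxy, _, _, hx, hy⟩ := reduced_adj.1 hcd
  refine ⟨x, ?_, hx⟩
  by_cases hyB : y ∈ B
  · exact absurd (hy.symm.trans (contract_of_mem hyB)) hd
  · rw [contract_of_notMem hyB] at hy
    exact hy ▸ hxy

/-- A cycle of the reduced graph comes from a cycle that avoids the protected vertices. -/
theorem IsState.exists_lifted_cycle {G : SimpleGraph V} {r : V} {B P : Set V}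
    (h : IsState G r B P) {u : V} {p : (reduced G r B P).Walk u u} (hp : p.IsCycle) {e : Sym2 V}
    (he : e ∈ p.edges) : ∃ (v : V) (q : (removeVerts G P).Walk v v), q.IsCycle ∧
      ∃ f ∈ q.edges, f.map (contract B r) = e := by
  have hred : reduced G r B P = reduced (removeVerts G P) r B ∅ := by
    ext a b
    rw [reduced_adj, reduced_adj]
    refine and_congr_right fun _ => exists_congr fun x => exists_congr fun y => ?_
    simp only [removeVerts, Set.mem_empty_iff_false, not_false_eq_true, true_and]
    tauto
  have h' : IsState (removeVerts G P) r B ∅ := by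
    refine ⟨h.root, by simp, fun b hb => ?_⟩
    refine Reachable.mono (fun x y hxy => ?_) (h.conn b hb)
    exact ⟨⟨hxy.1, h.disj _ (not_not.1 hxy.2.1), h.disj _ (not_not.1 hxy.2.2)⟩, hxy.2⟩
  induction e with
  | _ a b =>
  obtain ⟨hab, hreach⟩ := adj_and_reachable_delete_edges_iff_exists_cycle.2 ⟨u, p, hp, he⟩
  rw [hred] at hab hreach
  obtain ⟨hne, x, y, hxy, _, _, hxa, hyb⟩ := reduced_adj.1 hab
  have hdiag : ∀ v, s(v, v) ∉ ({s(a, b)} : Set (Sym2 V)) := by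
    intro v hv
    rw [Set.mem_singleton_iff, Sym2.eq_iff] at hv
    rcases hv with ⟨h1, h2⟩ | ⟨h1, h2⟩
    · exact hne (h1.symm.trans h2)
    · exact hne (h2.symm.trans h1)
  have hmap : Sym2.map (contract B r) s(x, y) = s(a, b) := by rw [Sym2.map_mk, hxa, hyb]
  have h1 : ((removeVerts G P).deleteEdges {s(x, y)}).Reachable x y := by
    refine Reachable.mono (deleteEdges_anti ?_) (h'.lift_reachable hdiag hreach hxa hyb)
    rintro f rfl
    exact hmap
  obtain ⟨v, q, hq, hqe⟩ := adj_and_reachable_delete_edges_iff_exists_cycle.1 ⟨hxy, h1⟩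
  exact ⟨v, q, hq, _, hqe, hmap⟩

/-- Once a vertex of the root cycle is protected, there is no root cycle any more. -/
theorem not_isRootCycle_of_mem {G : SimpleGraph V} (hG : AtMostOneCycle G) {r u : V}
    {B P B' P' C : Set V} (h : IsState G r B P) (h' : IsState G r B' P')
    (hC : IsRootCycle (reduced G r B P) r C) (hu : u ∈ C) (hur : u ≠ r) (huP : u ∈ P') :
    ¬ ∃ C', IsRootCycle (reduced G r B' P') r C' := by
  rintro ⟨_, p', hp', -⟩
  obtain ⟨p, hp, rfl⟩ := hC
  -- Both root cycles lift to cycles of `G` and hence have the same lifted edges. One of these edges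
  -- ends in `u`, but the lift of the later cycle avoids `P'`.
  obtain ⟨v', q', hq', -⟩ := h'.exists_lifted_cycle hp'
    (Walk.mk_start_snd_mem_edges hp'.not_nil)
  obtain ⟨f, hf, huf⟩ : ∃ f ∈ p.edges, u ∈ f :=
    (Walk.mem_support_iff_exists_mem_edges_of_not_nil hp.not_nil).1 hu
  obtain ⟨v, q, hq, f', hf', rfl⟩ := h.exists_lifted_cycle hp hf
  have hqG := (Walk.isCycle_mapLe (removeVerts_le G P)).2 hq
  have hqG' := (Walk.isCycle_mapLe (removeVerts_le G P')).2 hq'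
  have hmem := (hG _ _ _ _ hqG hqG' f').1 (by rwa [Walk.edges_mapLe_eq_edges])
  rw [Walk.edges_mapLe_eq_edges] at hmem
  obtain ⟨x, hx, hxu⟩ := Sym2.mem_map.1 huf
  have hxu' : x = u := by
    by_cases hxB : x ∈ B
    · exact absurd (hxu.symm.trans (contract_of_mem hxB)) hur
    · rwa [contract_of_notMem hxB] at hxu
  subst hxu'
  induction f' with
  | _ a b =>
  have hab := Walk.adj_of_mem_edges _ hmem
  rcases Sym2.mem_iff.1 hx with rfl | rfl
  · exact hab.2.1 huP
  · exact hab.2.2 huP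

namespace Compared

variable {G : SimpleGraph V} {r : V} {f : ℕ → ℕ} {σ ω : ℕ → Finset V}

/-- The fire reaches a lost vertex through a vertex that `ω` protects in time. -/
theorem exists_protected (h : Compared G r f σ ω) {x : V} (hx : x ∈ lost G r σ ω) :
    ∃ i, ∃ y ∈ ω i, y ∉ burning G r σ i ∧ ∀ i' ≤ i, ∃ w : (roundGraph G r σ i').Walk r x,
      w.IsPath ∧ y ∈ w.support ∧ ∀ v ∈ w.support, ∀ j, v ∉ guarded σ j := by
  obtain ⟨n, hn⟩ := hx.2
  obtain ⟨w, hw, hl, h1, h2⟩ := exists_fire_path hn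
  -- The blocker has index `j > i` on the fire path. So it does not burn in `σ` in round `i`, and it
  -- remains on the rest of that path in the graphs of all rounds up to `i`.
  obtain ⟨j, i, hij, hj, hmem⟩ := exists_blocking hx.1 w
  refine ⟨i, _, hmem, fun hB => ?_, fun i' hi' => ?_⟩
  · have := h2 (j - 1) (by omega)
    rw [Nat.sub_add_cancel (by omega)] at this
    exact this (burning_mono G r σ (by omega) hB)
  · obtain ⟨w', hw', hl', hget⟩ :=
      h.legal.exists_reduced_fire_path hw rfl h1 h2 (i := i') (by omega)
    refine ⟨w', hw', ?_, fun v hv k => ?_⟩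
    · have := hget (j - i') (by omega)
      rw [Nat.add_sub_cancel' (by omega)] at this
      rw [← this]
      exact Walk.getVert_mem_support _ _
    · obtain ⟨n, rfl, hn⟩ := Walk.mem_support_iff_exists_getVert.1 hv
      rcases Nat.eq_zero_or_pos n with rfl | hn0
      · rw [Walk.getVert_zero]
        exact h.legal.notMem_guarded (root_mem_burning G r σ 0)
      · rw [hget n hn0]
        exact h.legal.notMem_guarded (h1 (i' + n) (by omega))

/-- A path of the graph of round `i₀` that ends in a vertex saved by `ω` is blocked by `ω`, either
before round `i₀`, or on the path itself. -/
theorem blocked (h : Compared G r f σ ω) {x : V} (hx : ∀ i, x ∉ burning G r ω i) {i₀ : ℕ}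
    (w : (roundGraph G r σ i₀).Walk r x) (hw : w.IsPath) :
    (∃ i < i₀, ∃ y ∈ ω i, y ∉ burning G r σ i ∧ ∃ w' : (roundGraph G r σ i).Walk r x,
      w'.IsPath ∧ y ∈ w'.support) ∨
    ∃ l i, 1 ≤ l ∧ l ≤ w.length ∧ i₀ ≤ i ∧ i < i₀ + l ∧ w.getVert l ∈ ω i := by
  have hS := h.legal.isState i₀
  cases w with
  | nil => exact absurd (root_mem_burning G r ω 0) (hx 0)
  | @cons _ b _ hab q =>
    rw [Walk.cons_isPath_iff] at hw
    have hqr : ∀ v ∈ q.support, v ≠ r := fun v hv hvr => hw.2 (hvr ▸ hv)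
    have hq : ∀ v ∈ q.support, v ∉ burning G r σ i₀ ∧ v ∉ guarded σ i₀ := by
      classical
      exact fun v hv => IsState.notMem_of_reachable
        ((Adj.reachable hab).trans ⟨q.takeUntil v hv⟩) (hqr v hv)
    obtain ⟨a, hab', ha⟩ := IsState.adj_of_reduced hab (hqr b (Walk.start_mem_support _))
    have haB : a ∈ burning G r σ i₀ := by
      by_contra haB
      rw [contract_of_notMem haB] at ha
      exact haB (ha ▸ hS.root)
    have hedge : ∀ e ∈ q.edges, e ∈ G.edgeSet := by
      intro e he
      induction e with
      | _ c d =>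
      have hc := Walk.fst_mem_support_of_mem_edges _ he
      obtain ⟨c', hcd, hc'⟩ := IsState.adj_of_reduced (Walk.adj_of_mem_edges _ he)
        (hqr d (Walk.snd_mem_support_of_mem_edges _ he))
      have hcB : c' ∉ burning G r σ i₀ := by
        intro hcB
        rw [contract_of_mem hcB] at hc'
        exact hqr c hc hc'.symm
      rw [contract_of_notMem hcB] at hc'
      exact hc' ▸ hcd
    -- The path is prolonged in `G`: `c` leads the fire from `r` to the burning vertex `a`, where
    -- the lift of the given path starts.
    obtain ⟨c, hc, hcl, h1, h2⟩ := exists_fire_path haB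
    set q' : G.Walk b x := q.transfer G hedge with hq'
    have hq's : q'.support = q.support := Walk.support_transfer _ _
    have hcB : ∀ v ∈ c.support, v ∈ burning G r σ i₀ := by
      intro v hv
      obtain ⟨n, rfl, hn⟩ := Walk.mem_support_iff_exists_getVert.1 hv
      exact burning_mono G r σ (by omega) (h1 n hn)
    set full : G.Walk r x := c.append (Walk.cons hab' q') with hfull
    have hpath : full.IsPath := by
      refine isPath_append hc ?_ fun v hv hv' => ?_
      · rw [Walk.cons_isPath_iff, hq's]
        exact ⟨hw.1.transfer _, fun haq => (hq a haq).1 haB⟩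
      · rcases List.mem_cons.1 (by simpa using hv') with rfl | hv'
        · rfl
        · exact absurd (hcB v hv) (hq v (hq's ▸ hv')).1
    have hget1 : ∀ k ≤ c.length, full.getVert k = c.getVert k := by
      intro k hk
      rw [hfull, Walk.getVert_append]
      split_ifs with hlt
      · rfl
      · obtain rfl : k = c.length := by omega
        simp
    have hget2 : ∀ k, full.getVert (c.length + (k + 1)) = q.getVert k := by
      intro k
      rw [hfull, Walk.getVert_append, if_neg (by omega), Nat.add_sub_cancel_left,
        Walk.getVert_cons_succ, Walk.getVert_eq_getD_support, Walk.getVert_eq_getD_support, hq's]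
    have hlen : full.length = c.length + (q.length + 1) := by
      rw [hfull, Walk.length_append, Walk.length_cons, hq', Walk.length_transfer]
    obtain ⟨j, i, hij, hj, hmem⟩ := exists_blocking hx full
    -- Since `c` has length at most `i₀`, a blocker placed in round `i ≥ i₀` has index beyond `c`.
    by_cases hi : i₀ ≤ i
    · right
      obtain ⟨k, rfl⟩ : ∃ k, j = c.length + (k + 1) := ⟨j - c.length - 1, by omega⟩
      refine ⟨k + 1, i, by omega, by rw [Walk.length_cons]; omega, hi, by omega, ?_⟩
      rw [Walk.getVert_cons_succ, ← hget2 k]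
      exact hmem
    · left
      have hSi := h.legal.isState i
      -- In round `i` the vertex with index `i ⊓ c.length` burns and none after it does, so the rest
      -- is a path in the graph of round `i`.
      have hnot : ∀ k, i ⊓ c.length < k → k ≤ full.length →
          full.getVert k ∉ burning G r σ i ∧ full.getVert k ∉ guarded σ i := by
        intro k hk hkl
        by_cases hkc : k ≤ c.length
        · rw [hget1 k hkc]
          refine ⟨fun hB => ?_, h.legal.notMem_guarded (h1 k hkc)⟩
          have := h2 (k - 1) (by omega)
          rw [Nat.sub_add_cancel (by omega)] at this
          exact this (burning_mono G r σ (by omega) hB)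
        · obtain ⟨k', rfl⟩ : ∃ k', k = c.length + (k' + 1) := ⟨k - c.length - 1, by omega⟩
          rw [hget2 k']
          have := hq _ (Walk.getVert_mem_support q k')
          exact ⟨fun hB => this.1 (burning_mono G r σ (by omega) hB),
            fun hP => this.2 (guarded_mono σ (by omega) hP)⟩
      have hx' : x ∉ burning G r σ i := by
        have := hnot full.length (by omega) le_rfl
        rw [Walk.getVert_length] at this
        exact this.1
      obtain ⟨w', hw', hl', hget'⟩ := hSi.exists_contracted_path (full.drop (i ⊓ c.length))
        (hpath.drop _) (by
          rw [hget1 _ (by omega)]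
          exact burning_mono G r σ (by omega) (h1 (i ⊓ c.length) (by omega))) hx' (by
          intro k hk hkl
          rw [Walk.drop_length] at hkl
          rw [Walk.drop_getVert]
          exact hnot _ (by omega) (by omega))
      refine ⟨i, by omega, _, hmem, (hnot j (by omega) hj).1, w', hw', ?_⟩
      have := hget' (j - i ⊓ c.length) (by omega)
      rw [Walk.drop_getVert, Nat.add_sub_cancel' (by omega)] at this
      rw [← this]
      exact Walk.getVert_mem_support _ _

end Compared

/-! ### Broken cycles and the tolerance -/

/-- The graph that is left of a root cycle after it has been broken. -/
abbrev brokenGraph (H : SimpleGraph V) (r : V) (C : Set V) (u : V) : SimpleGraph V :=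
  (H.induce (brokenVerts H r C u)).spanningCoe

theorem brokenGraph_adj {H : SimpleGraph V} {r : V} {C : Set V} {u a b : V} :
    (brokenGraph H r C u).Adj a b ↔
      a ∈ brokenVerts H r C u ∧ b ∈ brokenVerts H r C u ∧ H.Adj a b := by
  simp only [brokenGraph, SimpleGraph.map_adj, comap_adj, Function.Embedding.subtype_apply]
  constructor
  · rintro ⟨x, y, h, rfl, rfl⟩
    exact ⟨x.2, y.2, h⟩
  · rintro ⟨ha, hb, h⟩
    exact ⟨⟨a, ha⟩, ⟨b, hb⟩, h, rfl, rfl⟩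

/-- `u` covers itself and so is missing from the broken graph; walks there avoid it. -/
theorem exists_path_of_brokenGraph {H : SimpleGraph V} {r : V} {C : Set V} {u x : V} (hu : u ≠ r)
    (w : (brokenGraph H r C u).Walk r x) :
    ∃ w' : H.Walk r x, w'.IsPath ∧ w'.length ≤ w.length ∧ u ∉ w'.support := by
  classical
  have hle : brokenGraph H r C u ≤ H := fun a b h => (brokenGraph_adj.1 h).2.2
  refine ⟨(w.mapLe hle).bypass, Walk.bypass_isPath _, ?_, fun h => ?_⟩
  · exact (Walk.length_bypass_le_length _).trans (by simp)
  · have hu' : u ∈ w.support := by simpa using Walk.support_bypass_subset_support _ h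
    have hmem : u ∈ brokenVerts H r C u := by
      obtain ⟨w'⟩ : (brokenGraph H r C u).Reachable u r := ⟨(w.takeUntil u hu').reverse⟩
      cases w' with
      | nil => exact absurd rfl hu
      | cons h _ => exact (brokenGraph_adj.1 h).1
    rcases hmem with hmem | hmem
    · exact hu hmem
    · exact hmem.2 (self_mem_covered hu ⟨(w.mapLe hle).takeUntil u (by simpa using hu')⟩)

/-- Beyond the largest distance the count is 0. Positivity of `m` matters: otherwise every `d`
qualifies, and the natural `sSup` of an unbounded set is 0. -/
theorem bddAbove_brokenCount [Finite V] (H : SimpleGraph V) (r : V) (C : Set V) (u : V) {m : ℝ}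
    (hm : 0 < m) : BddAbove {d : ℕ | m ≤ brokenCount H r C u d} := by
  have : Fintype V := Fintype.ofFinite V
  refine ⟨Finset.univ.sup fun v => (brokenGraph H r C u).dist r v, fun d hd => ?_⟩
  by_contra! hlt
  have h0 : brokenCount H r C u d = 0 := by
    rw [brokenCount, Set.ncard_eq_zero (Set.toFinite _)]
    ext v
    simp only [Set.mem_ofPred_eq, Set.mem_empty_iff_false, iff_false, not_and, not_le]
    intro _
    exact lt_of_le_of_lt (Finset.le_sup (f := fun v => (brokenGraph H r C u).dist r v)
      (Finset.mem_univ v)) hlt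
  have hd' : m ≤ brokenCount H r C u d := hd
  rw [h0] at hd'
  simp at hd'
  linarith

theorem tol_lt [Finite V] {H : SimpleGraph V} {r : V} {C : Set V} {u : V} {m : ℝ} (hm : 0 < m)
    {d : ℕ} (hd : tol H r C u m ≤ d) : (brokenCount H r C u (d + 1) : ℝ) < m := by
  by_contra! hcon
  have : d + 1 ≤ tol H r C u m := le_csSup (bddAbove_brokenCount H r C u hm) hcon
  omega

theorem le_brokenCount_tol [Finite V] {H : SimpleGraph V} {r : V} {C : Set V} {u : V} {m : ℝ}
    (hm : 0 < m) (h : 1 ≤ tol H r C u m) : m ≤ brokenCount H r C u (tol H r C u m) := by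
  -- A positive tolerance excludes the empty set, whose supremum is 0 by convention.
  have hne : {d : ℕ | m ≤ brokenCount H r C u d}.Nonempty := by
    by_contra hne
    rw [Set.not_nonempty_iff_eq_empty] at hne
    rw [tol, hne] at h
    simp at h
  exact Nat.sSup_mem hne (bddAbove_brokenCount H r C u hm)

section RootCycle

variable {H : SimpleGraph V} {r x : V} {p : H.Walk r r}

theorem mem_covered_of_mem_path (hH : AtMostOneCycle H) (hp : p.IsCycle)
    (hx : x ∈ covered H r {v | v ∈ p.support}) {w : H.Walk r x} (hw : w.IsPath) {v : V}
    (hv : v ∈ w.support) (hvr : v ≠ r) : v ∈ covered H r {v | v ∈ p.support} := by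
  classical
  obtain ⟨e, he, τ, hτ⟩ := exists_isTail p hp hx.1.symm
  have h1 := (mem_covered_cycle_iff hH hp he hτ).1 hx
  have hcyc : ∀ i, p.getVert i = v → v ∈ covered H r {v | v ∈ p.support} := by
    intro i hi
    obtain ⟨j, hj, hjv⟩ := (mem_support_iff_getVert hp).1 (hi ▸ Walk.getVert_mem_support p i)
    subst hjv
    refine (mem_covered_cycle_iff hH hp hj (isTail_nil p j)).2 ?_
    by_contra h0
    obtain rfl : j = 0 := by omega
    simp at hvr
  have htail : v ∈ τ.support → v ∈ covered H r {v | v ∈ p.support} := fun hvτ =>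
    (mem_covered_cycle_iff hH hp he (τ := τ.takeUntil v hvτ) ⟨hτ.1.takeUntil hvτ, fun a ha hap =>
      hτ.2 a (Walk.support_takeUntil_subset_support _ hvτ ha) hap⟩).2 h1
  rcases eq_leftPath_or_rightPath hH hp he hτ hw with rfl | ⟨_, rfl⟩
  · rcases (mem_support_leftPath_iff he).1 hv with ⟨i, _, hi⟩ | h
    · exact hcyc i hi
    · exact htail h
  · rcases (mem_support_rightPath_iff he).1 hv with ⟨i, _, _, hi⟩ | h
    · exact hcyc i hi
    · exact htail h

/-- The initial part of `w` up to a vertex covered by `a` would contain `a`. So a path avoiding `a`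
survives in the broken graph. -/
theorem brokenGraph_dist_le (hH : AtMostOneCycle H) (hp : p.IsCycle)
    (hx : x ∈ covered H r {v | v ∈ p.support}) {w : H.Walk r x} (hw : w.IsPath) {a : V}
    (haw : a ∉ w.support) :
    (∀ v ∈ w.support, v ∈ brokenVerts H r {v | v ∈ p.support} a) ∧
      ∃ w' : (brokenGraph H r {v | v ∈ p.support} a).Walk r x, w'.length = w.length := by
  classical
  have hmem : ∀ v ∈ w.support, v ∈ brokenVerts H r {v | v ∈ p.support} a := by
    intro v hv
    by_cases hvr : v = r
    · exact Or.inl hvr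
    · refine Or.inr ⟨mem_covered_of_mem_path hH hp hx hw hv hvr, fun hva => ?_⟩
      exact haw (Walk.support_takeUntil_subset_support _ hv
        (mem_path_of_covered hva (hw.takeUntil hv)).1)
  refine ⟨hmem, w.transfer _ fun e he => ?_, by simp⟩
  induction e with
  | _ c d =>
  exact brokenGraph_adj.2 ⟨hmem c (Walk.fst_mem_support_of_mem_edges _ he),
    hmem d (Walk.snd_mem_support_of_mem_edges _ he), Walk.adj_of_mem_edges _ he⟩

variable {e : ℕ} {τ : H.Walk (p.getVert e) x}

theorem eq_leftPath (hH : AtMostOneCycle H) (hp : p.IsCycle) (he : e < p.length)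
    (hτ : IsTail p e τ) {w : H.Walk r x} (hw : w.IsPath)
    (hu : p.getVert (p.length - 1) ∉ w.support) : w = leftPath p e τ := by
  refine (eq_leftPath_or_rightPath hH hp he hτ hw).resolve_right ?_
  rintro ⟨_, rfl⟩
  exact hu ((mem_support_rightPath_iff he).2 (Or.inl ⟨p.length - 1, by omega, by omega, rfl⟩))

theorem eq_rightPath (hH : AtMostOneCycle H) (hp : p.IsCycle) (he : e < p.length) (h1 : 1 ≤ e)
    (hτ : IsTail p e τ) {w : H.Walk r x} (hw : w.IsPath)
    (hu : p.getVert 1 ∉ w.support) : w = rightPath p e τ := by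
  rcases eq_leftPath_or_rightPath hH hp he hτ hw with rfl | ⟨_, h⟩
  · exact absurd ((mem_support_leftPath_iff he).2 (Or.inl ⟨1, h1, rfl⟩)) hu
  · exact h

theorem getVert_rightPath_of_lt {l : ℕ} (hl : l < p.length - e) :
    (rightPath p e τ).getVert l = p.getVert (p.length - l) := by
  rw [rightPath, Walk.getVert_append, if_pos (by simpa using hl), Walk.getVert_reverse,
    Walk.drop_getVert, Walk.drop_length]
  congr 1
  omega

theorem getVert_rightPath_of_le {l : ℕ} (hl : p.length - e ≤ l) :
    (rightPath p e τ).getVert l ∈ τ.support := by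
  rw [rightPath, Walk.getVert_append, if_neg (by simpa using hl)]
  exact Walk.getVert_mem_support _ _

/-- A vertex whose way against the direction of the cycle is long is counted by the tolerance of
the first vertex of the cycle. -/
theorem rightPath_length_le_dist (hH : AtMostOneCycle H) (hp : p.IsCycle) (he : e < p.length)
    (h2 : 2 ≤ e) (hτ : IsTail p e τ) :
    x ∈ brokenVerts H r {v | v ∈ p.support} (p.getVert 1) ∧
      (rightPath p e τ).length ≤
        (brokenGraph H r {v | v ∈ p.support} (p.getVert 1)).dist r x := by
  have h1r := getVert_ne_root hp le_rfl (by omega)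
  have hnot : p.getVert 1 ∉ (rightPath p e τ).support := by
    intro h
    rcases (mem_support_rightPath_iff he).1 h with ⟨i, hi, hi', hi1⟩ | h
    · rcases hi'.lt_or_eq with hi' | rfl
      · have := getVert_inj hp hi' (by omega) hi1
        omega
      · rw [Walk.getVert_length] at hi1
        exact h1r hi1.symm
    · have := getVert_inj hp (by omega) he (hτ.2 _ h (Walk.getVert_mem_support _ _))
      omega
  have hx := (mem_covered_cycle_iff hH hp he hτ).2 (by omega)
  obtain ⟨hmem, w, hw⟩ := brokenGraph_dist_le hH hp hx (rightPath_isPath hp (by omega) hτ) hnot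
  refine ⟨hmem x (Walk.end_mem_support _), ?_⟩
  -- `dist` is 0 between unreachable vertices, so the distance must be realised by a walk. It yields
  -- a path avoiding the first cycle vertex, which can only be the right path.
  obtain ⟨w', hw'⟩ := Reachable.exists_walk_length_eq_dist ⟨w⟩
  obtain ⟨q, hq, hql, hq1⟩ := exists_path_of_brokenGraph h1r w'
  rw [eq_rightPath hH hp he (by omega) hτ hq hq1] at hql
  omega

end RootCycle

/-! ### Rounds in which the root cycle is broken -/

/-- In round `i₀` the algorithm breaks the root cycle `p` by protecting its last vertex, and no
vertex protected by `ω` before round `i₀` was bypassed. -/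
structure BreakRound (G : SimpleGraph V) (r : V) (f : ℕ → ℕ) (σ ω : ℕ → Finset V) (i₀ : ℕ)
    (p : (roundGraph G r σ i₀).Walk r r) : Prop where
  compared : Compared G r f σ ω
  isCycle : p.IsCycle
  le_one : f i₀ ≤ 1
  last_mem : p.getVert (p.length - 1) ∈ σ i₀
  light : ∀ y, y ≠ r → (roundGraph G r σ i₀).Reachable r y →
    (weight (roundGraph G r σ i₀) r {y} : ℝ) <
      √(weight (roundGraph G r σ i₀) r {v | v ∈ p.support} : ℝ)
  tol_le : tol (roundGraph G r σ i₀) r {v | v ∈ p.support} (p.getVert 1)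
      √(weight (roundGraph G r σ i₀) r {v | v ∈ p.support} : ℝ) ≤
    tol (roundGraph G r σ i₀) r {v | v ∈ p.support} (p.getVert (p.length - 1))
      √(weight (roundGraph G r σ i₀) r {v | v ∈ p.support} : ℝ)
  not_bypassed : ∀ i < i₀, ∀ y ∈ ω i, ∀ x, ¬ Bypassed (roundGraph G r σ i) r y x

/-- If `y` were on all paths to `x`, then `x` would be dominated. -/
theorem Compared.bypassed {G : SimpleGraph V} {r : V} {f : ℕ → ℕ} {σ ω : ℕ → Finset V}
    (h : Compared G r f σ ω) {x y : V} {i : ℕ} (hx : x ∈ lost G r σ ω \ dominated G r σ ω)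
    (hy : y ∈ ω i) (hyB : y ∉ burning G r σ i)
    (hw : ∃ w : (roundGraph G r σ i).Walk r x, w.IsPath ∧ y ∈ w.support) :
    Bypassed (roundGraph G r σ i) r y x := by
  obtain ⟨w, hw, hyw⟩ := hw
  have hxr : x ≠ r := by
    rintro rfl
    exact hx.1.1 0 (root_mem_burning G x ω 0)
  have hxB := (IsState.notMem_of_reachable ⟨w⟩ hxr).1
  refine ⟨fun hyr => hyB (hyr ▸ root_mem_burning G r σ i), ?_, w, hw, hyw⟩
  refine ((h.legal.isState i).mem_region_reduced (by rintro _ rfl; exact hyB) hxB).2 ?_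
  by_contra hcon
  exact hx.2 ⟨hx.1, i, y, hy, hyB, hcon⟩

namespace BreakRound

variable {G : SimpleGraph V} {r : V} {f : ℕ → ℕ} {σ ω : ℕ → Finset V} {i₀ : ℕ}
  {p : (roundGraph G r σ i₀).Walk r r}

theorem atMostOneCycle (h : BreakRound G r f σ ω i₀ p) : AtMostOneCycle (roundGraph G r σ i₀) :=
  (h.compared.legal.isState i₀).atMostOneCycle h.compared.atMostOneCycle

theorem last_mem_guarded (h : BreakRound G r f σ ω i₀ p) {i : ℕ} (hi : i₀ < i) :
    p.getVert (p.length - 1) ∈ guarded σ i := ⟨i₀, hi, h.last_mem⟩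

theorem ne_root (h : BreakRound G r f σ ω i₀ p) {e : ℕ} (h1 : 1 ≤ e) (he : e < p.length)
    {x : V} {τ : (roundGraph G r σ i₀).Walk (p.getVert e) x} (hτ : IsTail p e τ) :
    x ≠ r := fun hx => hτ.root_notMem h.isCycle he h1 (hx ▸ Walk.end_mem_support τ)

theorem notMem_burning (h : BreakRound G r f σ ω i₀ p) {e : ℕ} (h1 : 1 ≤ e) (he : e < p.length)
    {x : V} {τ : (roundGraph G r σ i₀).Walk (p.getVert e) x} (hτ : IsTail p e τ) :
    x ∉ burning G r σ i₀ :=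
  (IsState.notMem_of_reachable ((reachable_getVert p e).trans ⟨τ⟩) (h.ne_root h1 he hτ)).1

/-- After round `i₀` the fire can only follow the direction of the cycle. -/
theorem notMem_of_mem_leftPath (h : BreakRound G r f σ ω i₀ p) {e : ℕ} (h1 : 1 ≤ e)
    (he : e < p.length) {x : V} {τ : (roundGraph G r σ i₀).Walk (p.getVert e) x}
    (hτ : IsTail p e τ) {i : ℕ} (hi : i₀ < i) {S : Set V}
    (hS : ∀ v ∈ S, v ∉ burning G r σ i) (hx : x ∈ region G r (guarded σ i ∪ S)) {v : V}
    (hv : v ∈ (leftPath p e τ).support) : v ∉ guarded σ i ∪ S := by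
  have hT : ∀ v ∈ guarded σ i ∪ S, v ∉ burning G r σ i₀ := by
    rintro v (hv | hv) hvB
    · exact h.compared.legal.notMem_guarded hvB hv
    · exact hS v hv (burning_mono G r σ hi.le hvB)
  have hsub : guarded σ i₀ ∪ (guarded σ i ∪ S) = guarded σ i ∪ S :=
    Set.union_eq_self_of_subset_left
      ((guarded_mono σ hi.le).trans Set.subset_union_left)
  have hxH := ((h.compared.legal.isState i₀).mem_region_reduced hT
    (h.notMem_burning h1 he hτ)).2 (by rwa [hsub])
  obtain ⟨w, hw, hwT⟩ := exists_path_of_mem_region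
    (fun hr => hT r hr (root_mem_burning G r σ i₀)) hxH
  have := eq_leftPath h.atMostOneCycle h.isCycle he hτ hw
    fun hu => hwT _ hu (Or.inl (h.last_mem_guarded hi))
  exact hwT v (this ▸ hv)

/-- The fire of `σ` comes along the left path, which `ω` blocks in round `i₀`. Under `ω` the fire
could also take the right path, so that path needs a second, later blocker. -/
theorem exists_blocking (h : BreakRound G r f σ ω i₀ p) {x : V}
    (hx : x ∈ lost G r σ ω \ dominated G r σ ω) :
    ∃ e, ∃ τ : (roundGraph G r σ i₀).Walk (p.getVert e) x, IsTail p e τ ∧ 2 ≤ e ∧ e < p.length ∧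
      ∃ l t, 1 ≤ t ∧ t < l ∧ l ≤ (rightPath p e τ).length ∧
        (rightPath p e τ).getVert l ∈ ω (i₀ + t) := by
  have hc := h.compared
  obtain ⟨i, y, hy, hyB, hpath⟩ := hc.exists_protected hx.1
  obtain ⟨w, hw, hyw, -⟩ := hpath i le_rfl
  have hby := hc.bypassed hx hy hyB ⟨w, hw, hyw⟩
  have hi : i₀ ≤ i := by
    by_contra! hi
    exact h.not_bypassed i hi y hy x hby
  obtain ⟨w₀, hw₀, hyw₀, hw₀g⟩ := hpath i₀ hi
  obtain ⟨e, he, τ, hτ⟩ := exists_isTail p h.isCycle ⟨w₀⟩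
  have hleft := eq_leftPath h.atMostOneCycle h.isCycle he hτ hw₀
    fun hu => hw₀g _ hu (i₀ + 1) (h.last_mem_guarded (Nat.lt_succ_self _))
  rw [hleft] at hyw₀
  have hxr : x ≠ r := by
    rintro rfl
    exact hx.1.1 0 (root_mem_burning G x ω 0)
  -- After round `i₀` the left path is the only way to `x`, so a vertex on it would cut `x` off and
  -- not be bypassed.
  obtain rfl : i₀ = i := by
    by_contra hne
    have h1 : 1 ≤ e := by
      by_contra h0
      have hyB₀ : y ∉ burning G r σ i₀ := fun hB => hyB (burning_mono G r σ hi hB)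
      have hby₀ := hc.legal.isState i₀
      have hxB := (IsState.notMem_of_reachable ⟨w₀⟩ hxr).1
      have hreg : x ∈ region (roundGraph G r σ i₀) r {y} := by
        refine (hby₀.mem_region_reduced (by rintro _ rfl; exact hyB₀) hxB).2 ?_
        have := ((hc.legal.isState i).mem_region_reduced (by rintro _ rfl; exact hyB)
          (IsState.notMem_of_reachable ⟨w⟩ hxr).1).1 hby.2.1
        exact region_anti G r (Set.union_subset_union_left _ (guarded_mono σ hi)) this
      exact h0 (Bypassed.mem_cycle h.atMostOneCycle h.isCycle he hτ
        ⟨hby.1, hreg, _, leftPath_isPath h.isCycle he hτ, hyw₀⟩).1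
    have hreg := ((hc.legal.isState i).mem_region_reduced (by rintro _ rfl; exact hyB)
          (IsState.notMem_of_reachable ⟨w⟩ hxr).1).1 hby.2.1
    exact h.notMem_of_mem_leftPath h1 he hτ (lt_of_le_of_ne hi hne)
      (by rintro _ rfl; exact hyB) hreg hyw₀ (Or.inr rfl)
  have h1 := (hby.mem_cycle h.atMostOneCycle h.isCycle he hτ).1
  -- The tail belongs to both ways and `y` to one only, so `y` is a cycle vertex of index `a` with
  -- `1 ≤ a < e`; this is where `2 ≤ e` comes from.
  have hyτ : y ∉ τ.support := by
    obtain ⟨_, w', _, hw', _, hy'⟩ := hby.exists_paths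
    exact fun hy => hy' (mem_support_of_mem_tail h.atMostOneCycle h.isCycle he hτ hw' hy)
  obtain ⟨a, hae, rfl⟩ := ((mem_support_leftPath_iff he).1 hyw₀).resolve_right hyτ
  have ha1 : 1 ≤ a := by
    by_contra h0
    obtain rfl : a = 0 := by omega
    exact hby.1 (Walk.getVert_zero p)
  have hae' : a ≠ e := by
    rintro rfl
    exact hyτ (Walk.start_mem_support _)
  have hyright : p.getVert a ∉ (rightPath p e τ).support := by
    intro hmem
    rcases (mem_support_rightPath_iff he).1 hmem with ⟨j, hj, hj', hja⟩ | hmem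
    · rcases hj'.lt_or_eq with hj' | rfl
      · have := getVert_inj h.isCycle hj' (by omega) hja
        omega
      · rw [Walk.getVert_length] at hja
        exact hby.1 hja.symm
    · exact hyτ hmem
  refine ⟨e, τ, hτ, by omega, he, ?_⟩
  rcases hc.blocked hx.1.1 _ (rightPath_isPath h.isCycle h1 hτ) with
    ⟨i, hi, y, hy, hyB, hw'⟩ | ⟨l, i, hl1, hl, hi, hil, hmem⟩
  · exact absurd (hc.bypassed hx hy hyB hw') (h.not_bypassed i hi y hy x)
  · obtain ⟨t, rfl⟩ := Nat.exists_eq_add_of_le hi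
    refine ⟨l, t, ?_, by omega, hl, hmem⟩
    -- The only firefighter of round `i₀` stands on `p.getVert a`, off the right path.
    by_contra h0
    obtain rfl : t = 0 := by omega
    have hcard := (hc.legal' i₀).1.trans h.le_one
    have := Finset.card_le_one.1 hcard _ hy _ hmem
    exact hyright (this ▸ Walk.getVert_mem_support _ _)

theorem weight_pos (h : BreakRound G r f σ ω i₀ p) :
    0 < √(weight (roundGraph G r σ i₀) r {v | v ∈ p.support} : ℝ) := by
  have h3 := h.isCycle.three_le_length
  exact lt_of_le_of_lt (Nat.cast_nonneg _)
    (h.light _ (getVert_ne_root h.isCycle le_rfl (by omega)) (reachable_getVert p 1))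

variable [Finite V]

theorem one_le_profit (h : BreakRound G r f σ ω i₀ p) : 1 ≤ profit G r σ := by
  refine Nat.succ_le_of_lt ((Set.ncard_pos (Set.toFinite _)).2 ⟨p.getVert (p.length - 1), ?_⟩)
  exact fun i hi => h.compared.legal.notMem_guarded hi (h.last_mem_guarded (Nat.lt_succ_self i₀))

/-- A firefighter that comes `t` rounds after the cycle was broken saves a part of the cycle. -/
theorem length_le_profit (h : BreakRound G r f σ ω i₀ p) {t : ℕ} (ht : 1 ≤ t)
    (hf : 1 ≤ f (i₀ + t)) : p.length ≤ profit G r σ + t + 2 := by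
  classical
  have hc := h.compared
  have hp := h.isCycle
  have hi : i₀ < i₀ + t := by omega
  -- By round `i₀ + t` the fire has reached at most index `t`, and the last vertex is protected: the
  -- indices `t + 1, …, p.length - 2` are at stake.
  set Y : Set V := p.getVert '' (Finset.Ico (t + 1) (p.length - 1) : Finset ℕ) with hY
  have hcard : Y.ncard = p.length - 1 - (t + 1) := by
    rw [hY, Set.InjOn.ncard_image, Set.ncard_coe_finset, Nat.card_Ico]
    intro a ha b hb hab
    simp only [Finset.coe_Ico, Set.mem_Ico] at ha hb
    exact getVert_inj hp (by omega) (by omega) hab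
  have hYB : ∀ l, t + 1 ≤ l → l < p.length - 1 → p.getVert l ∉ burning G r σ (i₀ + t) := by
    intro l hl hl' hB
    obtain ⟨w, hw, hwl, hwg⟩ := hc.legal.exists_short_path hB
      (h.notMem_burning (by omega) (by omega) (isTail_nil p l))
    have := eq_leftPath h.atMostOneCycle hp (by omega) (isTail_nil p l) hw
      fun hu => hwg _ hu (i₀ + 1) (h.last_mem_guarded (Nat.lt_succ_self _))
    rw [this, leftPath, Walk.length_append, Walk.take_length, Walk.length_nil] at hwl
    omega
  have hsub : Y ⊆ (region G r (guarded σ (i₀ + t + 1)))ᶜ ∨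
      Y.ncard ≤ (region G r (guarded σ (i₀ + t + 1)))ᶜ.ncard := by
    -- If one of these vertices is reachable, so is the one of index `t + 1`, which covers all the
    -- reachable others. As the root cycle is gone, the greedy choice gains at least its weight.
    -- Otherwise all of `Y` has been cut off already.
    by_cases hex : ∃ l, t + 1 ≤ l ∧ l < p.length - 1 ∧ p.getVert l ∈ region G r (guarded σ (i₀ + t))
    · right
      obtain ⟨l, hl, hl', hreg⟩ := hex
      have hS := hc.legal.isState (i₀ + t)
      have hmem : ∀ j ≤ l, p.getVert j ∉ guarded σ (i₀ + t) := by
        intro j hj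
        have := h.notMem_of_mem_leftPath (by omega) (by omega) (isTail_nil p l) hi (S := ∅)
          (by simp)
          (by simpa using hreg) ((mem_support_leftPath_iff (by omega)).2 (Or.inl ⟨j, hj, rfl⟩))
        simpa using this
      set y := p.getVert (t + 1) with hy
      have hyB := hYB (t + 1) le_rfl (by omega)
      have hyr : y ≠ r := getVert_ne_root hp (by omega) (by omega)
      have hyreg : y ∈ region G r (guarded σ (i₀ + t)) := by
        have hT : ∀ v ∈ guarded σ (i₀ + t), v ∉ burning G r σ i₀ :=
          fun v hv hvB => hc.legal.notMem_guarded hvB hv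
        have hsub' : guarded σ i₀ ∪ guarded σ (i₀ + t) = guarded σ (i₀ + t) :=
          Set.union_eq_self_of_subset_left (guarded_mono σ hi.le)
        rw [← hsub']
        refine ((hc.legal.isState i₀).mem_region_reduced hT
          (h.notMem_burning (by omega) (by omega) (isTail_nil p (t + 1)))).1 ?_
        refine mem_region_of_walk (leftPath p (t + 1) Walk.nil) fun v hv => ?_
        rcases (mem_support_leftPath_iff (by omega)).1 hv with ⟨j, hj, rfl⟩ | hv
        · exact hmem j (by omega)
        · rw [Walk.support_nil, List.mem_singleton] at hv
          exact hv ▸ hmem (t + 1) hl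
      obtain ⟨Q, -, hQ, hQw⟩ := (hc.round (i₀ + t)).exists_first_choice hS hf hyB hyreg
      have hno := not_isRootCycle_of_mem hc.atMostOneCycle (hc.legal.isState i₀) hS
        ⟨p, hp, rfl⟩ (Walk.getVert_mem_support p (p.length - 1))
        (getVert_ne_root hp (by omega) (by omega)) (h.last_mem_guarded hi)
      have hw := hQ.weight_le_of_no_rootCycle hno hyr ((hS.reachable_iff hyB).2 hyreg)
      have hyB' : ∀ v ∈ ({y} : Set V), v ∉ burning G r σ (i₀ + t) := by rintro _ rfl; exact hyB
      rw [weight, hS.covered_reduced' hyB'] at hw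
      rw [ncard_compl_region_succ, gain, guarded_succ]
      have hYsub : Y ⊆ (region G r (guarded σ (i₀ + t)))ᶜ ∪
          (region G r (guarded σ (i₀ + t)) \ region G r (guarded σ (i₀ + t) ∪ {y})) := by
        rintro _ ⟨j, hj, rfl⟩
        simp only [Finset.coe_Ico, Set.mem_Ico] at hj
        by_cases hjr : p.getVert j ∈ region G r (guarded σ (i₀ + t))
        · refine Or.inr ⟨hjr, fun hjy => ?_⟩
          exact h.notMem_of_mem_leftPath (by omega) (by omega) (isTail_nil p j) hi hyB' hjy
            ((mem_support_leftPath_iff (by omega)).2 (Or.inl ⟨t + 1, hj.1, rfl⟩)) (Or.inr rfl)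
        · exact Or.inl hjr
      have := (Set.ncard_le_ncard hYsub (Set.toFinite _)).trans (Set.ncard_union_le _ _)
      omega
    · left
      push Not at hex
      rintro _ ⟨j, hj, rfl⟩ hjr
      simp only [Finset.coe_Ico, Set.mem_Ico] at hj
      exact hex j hj.1 hj.2 (region_anti G r (guarded_mono σ (Nat.le_succ _)) hjr)
  have hle := hsub.elim (fun hs => Set.ncard_le_ncard hs (Set.toFinite _)) id
  have := hle.trans (hc.legal.ncard_compl_region_le (i₀ + t + 1))
  omega

/-- Within the tolerance, each firefighter saves a vertex, or everything that is left is saved. -/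
theorem le_gain_or_weight_le (h : BreakRound G r f σ ω i₀ p) {s : ℝ}
    (hs : s = √(weight (roundGraph G r σ i₀) r {v | v ∈ p.support} : ℝ)) :
    (∀ t, 1 ≤ t → t < tol (roundGraph G r σ i₀) r {v | v ∈ p.support} (p.getVert (p.length - 1)) s →
      f (i₀ + t) ≤ gain G r σ (i₀ + t)) ∨
    s ≤ profit G r σ := by
  have hc := h.compared
  have hp := h.isCycle
  have h3 := hp.three_le_length
  by_cases hcon : ∀ t, 1 ≤ t →
      t < tol (roundGraph G r σ i₀) r {v | v ∈ p.support} (p.getVert (p.length - 1)) s →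
      f (i₀ + t) ≤ gain G r σ (i₀ + t)
  · exact Or.inl hcon
  right
  push Not at hcon
  obtain ⟨t, ht, htd, hgain⟩ := hcon
  -- A round that gains fewer vertices than it has firefighters must have run out of available
  -- vertices, so everything not burning is saved.
  have hall : ∀ y, y ∉ burning G r σ (i₀ + t) → y ∉ region G r (guarded σ (i₀ + t + 1)) := by
    intro y hyB hy
    rw [guarded_succ] at hy
    have := (hc.round (i₀ + t)).le_gain (hc.legal.isState _) hyB hy
    rw [← guarded_succ] at this
    exact absurd this (not_le.2 hgain)
  have hs0 : 0 < s := hs ▸ h.weight_pos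
  -- At least `s` vertices are at distance at least the tolerance, hence more than `t`, from `r` in
  -- the broken graph. The fire has not reached them.
  refine (le_brokenCount_tol hs0 (le_trans ht htd.le)).trans ?_
  refine Nat.cast_le.2 ((Set.ncard_le_ncard ?_ (Set.toFinite _)).trans
    (hc.legal.ncard_compl_region_le (i₀ + t + 1)))
  rintro x ⟨hx, hdist⟩
  refine hall x fun hxB => ?_
  rcases hx with rfl | hx
  · rw [dist_self] at hdist
    omega
  obtain ⟨e, he, τ, hτ⟩ := exists_isTail p hp hx.1.1.symm
  have h1 := (mem_covered_cycle_iff h.atMostOneCycle hp he hτ).1 hx.1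
  obtain ⟨w, hw, hwl, hwg⟩ := hc.legal.exists_short_path hxB (h.notMem_burning h1 he hτ)
  obtain ⟨-, w', hw'⟩ := brokenGraph_dist_le h.atMostOneCycle hp hx.1 hw
    fun hu => hwg _ hu (i₀ + 1) (h.last_mem_guarded (Nat.lt_succ_self _))
  have := hdist.trans (SimpleGraph.dist_le w')
  omega

/-- Since the algorithm chose to break the cycle, every single vertex covers fewer than `√w(C)`
vertices. -/
theorem ncard_le_of_covered (h : BreakRound G r f σ ω i₀ p) {X : Set V} (T : Finset V)
    (hX : ∀ x ∈ X, ∃ y ∈ T, x ∈ covered (roundGraph G r σ i₀) r {y}) :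
    (X.ncard : ℝ) ≤
      T.card * √(weight (roundGraph G r σ i₀) r {v | v ∈ p.support} : ℝ) := by
  classical
  have hsub : X ⊆ ⋃ y ∈ T, covered (roundGraph G r σ i₀) r {y} := fun x hx => by
    obtain ⟨y, hy, hxy⟩ := hX x hx
    exact Set.mem_biUnion (Finset.mem_coe.2 hy) hxy
  have h1 : X.ncard ≤ ∑ y ∈ T, weight (roundGraph G r σ i₀) r {y} :=
    (Set.ncard_le_ncard hsub (Set.toFinite _)).trans (ncard_biUnion_le_sum _ _)
  calc (X.ncard : ℝ) ≤ ∑ y ∈ T, (weight (roundGraph G r σ i₀) r {y} : ℝ) := by exact_mod_cast h1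
    _ ≤ ∑ _y ∈ T, √(weight (roundGraph G r σ i₀) r {v | v ∈ p.support} : ℝ) := by
        refine Finset.sum_le_sum fun y _ => ?_
        by_cases hy : (covered (roundGraph G r σ i₀) r {y}).Nonempty
        · obtain ⟨x, hx⟩ := hy
          obtain ⟨w, hw⟩ := hx.1.symm.exists_isPath
          obtain ⟨hyw, hyr⟩ := mem_path_of_covered hx hw
          exact (h.light y hyr ⟨w.takeUntil y hyw⟩).le
        · rw [weight, Set.not_nonempty_iff_eq_empty.1 hy]
          simp
    _ = _ := by rw [Finset.sum_const, nsmul_eq_mul]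

/-- The lost vertices whose second way is blocked on the cycle. -/
theorem ncard_blocked_cycle_le (h : BreakRound G r f σ ω i₀ p) {X : Set V}
    (hX : ∀ x ∈ X, ∃ e, ∃ τ : (roundGraph G r σ i₀).Walk (p.getVert e) x, IsTail p e τ ∧ 1 ≤ e ∧
      e < p.length ∧ ∃ j t, 1 ≤ t ∧ e < j ∧ j + t < p.length ∧ p.getVert j ∈ ω (i₀ + t)) :
    (X.ncard : ℝ) ≤
      profit G r σ * √(weight (roundGraph G r σ i₀) r {v | v ∈ p.support} : ℝ) := by
  classical
  set T := (Finset.Ico 1 p.length).filter fun e => ∃ j t, 1 ≤ t ∧ e < j ∧ j + t < p.length ∧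
    p.getVert j ∈ ω (i₀ + t) with hT
  have hcard : (T.image p.getVert).card ≤ profit G r σ := by
    refine Finset.card_image_le.trans ?_
    rcases T.eq_empty_or_nonempty with h0 | hne
    · rw [h0]
      exact Nat.zero_le _
    -- The largest index `e` bounds the number of branches: `e + 1 ≤ j`, `j + t + 1 ≤ p.length` and
    -- `p.length ≤ profit + t + 2` give `e ≤ profit`.
    obtain ⟨e, he, hmax⟩ := T.exists_max_image id hne
    obtain ⟨-, j, t, ht, hej, hjt, hmem⟩ := Finset.mem_filter.1 he
    have hf : 1 ≤ f (i₀ + t) :=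
      (Finset.card_pos.2 ⟨_, hmem⟩).trans_le (h.compared.legal' (i₀ + t)).1
    have h1 := h.length_le_profit ht hf
    have h2 : T.card ≤ e := by
      refine (Finset.card_le_card (t := Finset.Icc 1 e) fun a ha => ?_).trans (by simp)
      exact Finset.mem_Icc.2 ⟨(Finset.mem_Ico.1 (Finset.mem_filter.1 ha).1).1, hmax a ha⟩
    omega
  refine (h.ncard_le_of_covered (T.image p.getVert) fun x hx => ?_).trans
    (mul_le_mul_of_nonneg_right (by exact_mod_cast hcard) (Real.sqrt_nonneg _))
  obtain ⟨e, τ, hτ, h1, he, hj⟩ := hX x hx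
  exact ⟨_, Finset.mem_image_of_mem _ (Finset.mem_filter.2 ⟨Finset.mem_Ico.2 ⟨h1, he⟩, hj⟩),
    mem_covered_of_mem_tail h.atMostOneCycle h.isCycle he h1 hτ (Walk.start_mem_support _)⟩

/-- The lost vertices that are blocked within the tolerance on their tails. -/
theorem ncard_blocked_tail_le (h : BreakRound G r f σ ω i₀ p) {X : Set V} {d : ℕ}
    (hd : d = tol (roundGraph G r σ i₀) r {v | v ∈ p.support} (p.getVert (p.length - 1))
      √(weight (roundGraph G r σ i₀) r {v | v ∈ p.support} : ℝ))
    (hX : ∀ x ∈ X, ∃ e, ∃ τ : (roundGraph G r σ i₀).Walk (p.getVert e) x, IsTail p e τ ∧ 1 ≤ e ∧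
      e < p.length ∧ ∃ t, 1 ≤ t ∧ t < d ∧ ∃ y ∈ τ.support, y ∈ ω (i₀ + t)) :
    (X.ncard : ℝ) ≤
      profit G r σ * √(weight (roundGraph G r σ i₀) r {v | v ∈ p.support} : ℝ) := by
  classical
  -- Either the blockers of rounds `i₀ + 1, …, i₀ + d - 1` are at most as many as the vertices
  -- gained, or the profit is at least `√w(C)` and the trivial bound `w(C)` suffices.
  rcases h.le_gain_or_weight_le rfl with hgain | hle
  · rw [← hd] at hgain
    set T := (Finset.Ico 1 d).biUnion fun t => ω (i₀ + t) with hT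
    have hcard : T.card ≤ profit G r σ := by
      calc T.card ≤ ∑ t ∈ Finset.Ico 1 d, (ω (i₀ + t)).card := Finset.card_biUnion_le
        _ ≤ ∑ t ∈ Finset.Ico 1 d, gain G r σ (i₀ + t) := by
            refine Finset.sum_le_sum fun t ht => ?_
            rw [Finset.mem_Ico] at ht
            exact (h.compared.legal' (i₀ + t)).1.trans (hgain t ht.1 ht.2)
        _ = ∑ i ∈ Finset.Ico (i₀ + 1) (i₀ + d), gain G r σ i :=
            (Finset.sum_Ico_add (gain G r σ) 1 d i₀).trans (by rw [add_comm 1, add_comm d])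
        _ ≤ ∑ i ∈ Finset.range (i₀ + d), gain G r σ i := by
            refine Finset.sum_le_sum_of_subset fun i hi => ?_
            rw [Finset.mem_Ico] at hi
            exact Finset.mem_range.2 hi.2
        _ ≤ profit G r σ := h.compared.legal.sum_gain_le _
    refine (h.ncard_le_of_covered T fun x hx => ?_).trans
      (mul_le_mul_of_nonneg_right (by exact_mod_cast hcard) (Real.sqrt_nonneg _))
    obtain ⟨e, τ, hτ, h1, he, t, ht, htd, y, hy, hyω⟩ := hX x hx
    exact ⟨y, Finset.mem_biUnion.2 ⟨t, Finset.mem_Ico.2 ⟨ht, htd⟩, hyω⟩,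
      mem_covered_of_mem_tail h.atMostOneCycle h.isCycle he h1 hτ hy⟩
  · have h1 : X.ncard ≤ weight (roundGraph G r σ i₀) r {v | v ∈ p.support} := by
      refine Set.ncard_le_ncard (fun x hx => ?_) (Set.toFinite _)
      obtain ⟨e, τ, hτ, h1, he, -⟩ := hX x hx
      exact (mem_covered_cycle_iff h.atMostOneCycle h.isCycle he hτ).2 h1
    calc (X.ncard : ℝ) ≤ weight (roundGraph G r σ i₀) r {v | v ∈ p.support} := by
          exact_mod_cast h1
      _ = √(weight (roundGraph G r σ i₀) r {v | v ∈ p.support} : ℝ) *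
          √(weight (roundGraph G r σ i₀) r {v | v ∈ p.support} : ℝ) :=
          (Real.mul_self_sqrt (Nat.cast_nonneg _)).symm
      _ ≤ _ := mul_le_mul_of_nonneg_right hle (Real.sqrt_nonneg _)

/-- The lost vertices whose second way is longer than the tolerance. -/
theorem ncard_long_le (h : BreakRound G r f σ ω i₀ p) {X : Set V} {d : ℕ}
    (hd : d = tol (roundGraph G r σ i₀) r {v | v ∈ p.support} (p.getVert (p.length - 1))
      √(weight (roundGraph G r σ i₀) r {v | v ∈ p.support} : ℝ))
    (hX : ∀ x ∈ X, ∃ e, ∃ τ : (roundGraph G r σ i₀).Walk (p.getVert e) x, IsTail p e τ ∧ 2 ≤ e ∧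
      e < p.length ∧ d + 1 ≤ (rightPath p e τ).length) :
    (X.ncard : ℝ) ≤
      profit G r σ * √(weight (roundGraph G r σ i₀) r {v | v ∈ p.support} : ℝ) := by
  have h1 : X.ncard ≤ brokenCount (roundGraph G r σ i₀) r {v | v ∈ p.support} (p.getVert 1)
      (d + 1) := by
    refine Set.ncard_le_ncard (fun x hx => ?_) (Set.toFinite _)
    obtain ⟨e, τ, hτ, h2, he, hlen⟩ := hX x hx
    obtain ⟨hmem, hdist⟩ := rightPath_length_le_dist h.atMostOneCycle h.isCycle he h2 hτ
    exact ⟨hmem, hlen.trans hdist⟩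
  -- The protected vertex has the larger tolerance, so `d + 1` exceeds that of the first cycle
  -- vertex.
  have h2 := tol_lt h.weight_pos (h.tol_le.trans hd.ge)
  have h3 : (X.ncard : ℝ) ≤ √(weight (roundGraph G r σ i₀) r {v | v ∈ p.support} : ℝ) :=
    le_trans (by exact_mod_cast h1) h2.le
  have h4 : (1 : ℝ) ≤ profit G r σ := by exact_mod_cast h.one_le_profit
  exact h3.trans (le_mul_of_one_le_left (Real.sqrt_nonneg _) h4)

theorem ncard_le (h : BreakRound G r f σ ω i₀ p) :
    ((lost G r σ ω \ dominated G r σ ω).ncard : ℝ) ≤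
      3 * √(Nat.card V : ℝ) * profit G r σ := by
  set d := tol (roundGraph G r σ i₀) r {v | v ∈ p.support} (p.getVert (p.length - 1))
      √(weight (roundGraph G r σ i₀) r {v | v ∈ p.support} : ℝ) with hd
  set X₁ : Set V := {x | ∃ e, ∃ τ : (roundGraph G r σ i₀).Walk (p.getVert e) x, IsTail p e τ ∧
    1 ≤ e ∧ e < p.length ∧ ∃ j t, 1 ≤ t ∧ e < j ∧ j + t < p.length ∧
      p.getVert j ∈ ω (i₀ + t)} with hX₁
  set X₂ : Set V := {x | ∃ e, ∃ τ : (roundGraph G r σ i₀).Walk (p.getVert e) x, IsTail p e τ ∧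
    1 ≤ e ∧ e < p.length ∧ ∃ t, 1 ≤ t ∧ t < d ∧ ∃ y ∈ τ.support, y ∈ ω (i₀ + t)} with hX₂
  set X₃ : Set V := {x | ∃ e, ∃ τ : (roundGraph G r σ i₀).Walk (p.getVert e) x, IsTail p e τ ∧
    2 ≤ e ∧ e < p.length ∧ d + 1 ≤ (rightPath p e τ).length} with hX₃
  have hsub : lost G r σ ω \ dominated G r σ ω ⊆ X₁ ∪ X₂ ∪ X₃ := by
    intro x hx
    obtain ⟨e, τ, hτ, h2, he, l, t, ht, htl, hl, hmem⟩ := h.exists_blocking hx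
    by_cases hle : l < p.length - e
    · rw [getVert_rightPath_of_lt hle] at hmem
      -- Index `l` of the right path is index `j = p.length - l` of the cycle, so `t < l` reads `j +
      -- t < p.length`.
      exact Or.inl (Or.inl ⟨e, τ, hτ, by omega, he, p.length - l, t, ht, by omega, by omega, hmem⟩)
    · by_cases htd : t < d
      · exact Or.inl (Or.inr ⟨e, τ, hτ, by omega, he, t, ht, htd, _,
          getVert_rightPath_of_le (not_lt.1 hle), hmem⟩)
      · exact Or.inr ⟨e, τ, hτ, h2, he, by omega⟩
  have h1 := h.ncard_blocked_cycle_le (X := X₁) fun x hx => hx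
  have h2 := h.ncard_blocked_tail_le (X := X₂) hd fun x hx => hx
  have h3 := h.ncard_long_le (X := X₃) hd fun x hx => hx
  have h4 : ((lost G r σ ω \ dominated G r σ ω).ncard : ℝ) ≤ X₁.ncard + X₂.ncard + X₃.ncard := by
    have h5 := Set.ncard_le_ncard hsub (Set.toFinite _)
    have h6 := Set.ncard_union_le (X₁ ∪ X₂) X₃
    have h7 := Set.ncard_union_le X₁ X₂
    exact_mod_cast h5.trans (by omega)
  have h5 : (profit G r σ : ℝ) *
      √(weight (roundGraph G r σ i₀) r {v | v ∈ p.support} : ℝ) ≤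
      profit G r σ * √(Nat.card V : ℝ) :=
    mul_le_mul_of_nonneg_left (sqrt_weight_le _ _ _) (Nat.cast_nonneg _)
  linarith

end BreakRound

/-! ### The competitive ratio -/

/-- Reversing the cycle if necessary makes the protected neighbour its last vertex, so one
orientation suffices. -/
theorem exists_cycle_last_eq {r : V} {H : SimpleGraph V} {C : Set V} {u : V} (hH : AtMostOneCycle H)
    (hC : IsRootCycle H r C) (hu : u ∈ H.neighborSet r ∩ C) :
    ∃ p : H.Walk r r, p.IsCycle ∧ C = {v | v ∈ p.support} ∧ u = p.getVert (p.length - 1) := by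
  obtain ⟨p, hp, rfl⟩ := hC
  have h3 := hp.three_le_length
  rw [neighborSet_inter_eq hH hp] at hu
  rcases hu with rfl | rfl
  · refine ⟨p.reverse, hp.reverse, by simp, ?_⟩
    rw [Walk.getVert_reverse, Walk.length_reverse]
    congr 1
    omega
  · exact ⟨p, hp, rfl, rfl⟩

section Competitive

variable [Finite V] {G : SimpleGraph V} {r : V} {f : ℕ → ℕ} {σ ω : ℕ → Finset V}

/-- Being bypassed carries over to earlier rounds: the fire path extends back, and regions were
larger. Hence all these vertices are bypassed in the single graph of round `i₀`, the first round in
which `ω` protects a bypassed vertex. -/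
theorem Compared.ncard_not_dominated_le (h : Compared G r f σ ω) :
    ((lost G r σ ω \ dominated G r σ ω).ncard : ℝ) ≤
      3 * √(Nat.card V : ℝ) * profit G r σ := by
  classical
  have hpos : 0 ≤ √(Nat.card V : ℝ) * profit G r σ := by positivity
  rcases (lost G r σ ω \ dominated G r σ ω).eq_empty_or_nonempty with h0 | ⟨x₀, hx₀⟩
  · rw [h0, Set.ncard_empty, Nat.cast_zero]
    linarith
  have key : ∀ x ∈ lost G r σ ω \ dominated G r σ ω, ∃ i, ∃ y ∈ ω i, y ∉ burning G r σ i ∧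
      ∀ i' ≤ i, Bypassed (roundGraph G r σ i') r y x := by
    intro x hx
    obtain ⟨i, y, hy, hyB, hpath⟩ := h.exists_protected hx.1
    refine ⟨i, y, hy, hyB, fun i' hi' => ?_⟩
    obtain ⟨w, hw, hyw, -⟩ := hpath i le_rfl
    obtain ⟨w', hw', hyw', -⟩ := hpath i' hi'
    have hby := h.bypassed hx hy hyB ⟨w, hw, hyw⟩
    have hxr : x ≠ r := by
      rintro rfl
      exact hx.1.1 0 (root_mem_burning G x ω 0)
    refine ⟨hby.1, ?_, w', hw', hyw'⟩
    have hyB' : y ∉ burning G r σ i' := fun hB => hyB (burning_mono G r σ hi' hB)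
    refine ((h.legal.isState i').mem_region_reduced (by rintro _ rfl; exact hyB')
      (IsState.notMem_of_reachable ⟨w'⟩ hxr).1).2 ?_
    exact region_anti G r (Set.union_subset_union_left _ (guarded_mono σ hi'))
      (((h.legal.isState i).mem_region_reduced (by rintro _ rfl; exact hyB)
        (IsState.notMem_of_reachable ⟨w⟩ hxr).1).1 hby.2.1)
  have hex : ∃ i, ∃ y ∈ ω i, ∃ x, Bypassed (roundGraph G r σ i) r y x := by
    obtain ⟨i, y, hy, -, hby⟩ := key x₀ hx₀
    exact ⟨i, y, hy, x₀, hby i le_rfl⟩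
  set i₀ := Nat.find hex with hi₀
  have hmin : ∀ i < i₀, ∀ y ∈ ω i, ∀ x, ¬ Bypassed (roundGraph G r σ i) r y x :=
    fun i hi y hy x hby => Nat.find_min hex hi ⟨y, hy, x, hby⟩
  obtain ⟨y₀, hy₀, z, hz⟩ := Nat.find_spec hex
  have hf : 1 ≤ f i₀ := (Finset.card_pos.2 ⟨_, hy₀⟩).trans_le (h.legal' i₀).1
  have hbyp : ∀ x ∈ lost G r σ ω \ dominated G r σ ω,
      ∃ y, Bypassed (roundGraph G r σ i₀) r y x := by
    intro x hx
    obtain ⟨i, y, hy, -, hby⟩ := key x hx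
    exact ⟨y, hby i₀ (not_lt.1 fun hi => hmin i hi y hy x (hby i le_rfl))⟩
  have hS := h.legal.isState i₀
  have hH := hS.atMostOneCycle h.atMostOneCycle
  obtain ⟨y, hxy⟩ := hbyp x₀ hx₀
  have hxr : x₀ ≠ r := by
    rintro rfl
    exact hx₀.1.1 0 (root_mem_burning G x₀ ω 0)
  have hxB := (IsState.notMem_of_reachable hxy.reachable hxr).1
  obtain ⟨Q, hQσ, hQ, hQw⟩ := (h.round i₀).exists_first_choice hS hf hxB
    ((hS.reachable_iff hxB).1 hxy.reachable)
  rcases hQ.bypassed_bound hH hbyp with hle | ⟨hf1, C, u, hB, rfl⟩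
  · have h1 : weight (roundGraph G r σ i₀) r Q ≤ profit G r σ := by
      refine hQw.trans (le_trans (le_of_eq ?_) (h.legal.gain_le i₀))
      rw [gain, guarded_succ]
    have h2 : (weight (roundGraph G r σ i₀) r Q : ℝ) ≤ profit G r σ := by exact_mod_cast h1
    have h3 := mul_le_mul_of_nonneg_left h2 (by positivity : 0 ≤ 2 * √(Nat.card V : ℝ))
    linarith
  · obtain ⟨p, hp, rfl, rfl⟩ := exists_cycle_last_eq hH hB.rootCycle hB.mem
    have h3 := hp.three_le_length
    refine BreakRound.ncard_le (i₀ := i₀) (p := p) ⟨h, hp, hf1.le, hQσ rfl, hB.light,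
      hB.tol_le _ ?_, hmin⟩
    rw [neighborSet_inter_eq hH hp]
    exact Or.inl rfl

/-- Dominated vertices cost `2√n` and the others `3√n` times the profit, so the constant 6 is not
tight here. -/
theorem Compared.profit_le (h : Compared G r f σ ω) :
    (profit G r ω : ℝ) ≤ (6 * √(Nat.card V : ℝ) + 1) * profit G r σ := by
  have h1 : (profit G r ω : ℝ) ≤ profit G r σ + (lost G r σ ω).ncard := by
    exact_mod_cast profit_le_add G r σ ω
  have h2 : ((lost G r σ ω).ncard : ℝ) ≤
      (dominated G r σ ω).ncard + (lost G r σ ω \ dominated G r σ ω).ncard := by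
    have := Set.ncard_union_le (dominated G r σ ω) (lost G r σ ω \ dominated G r σ ω)
    rw [Set.union_sdiff_cancel (fun x hx => hx.1)] at this
    exact_mod_cast this
  have h3 := h.dominated_le
  have h4 := h.ncard_not_dominated_le
  have hpos : 0 ≤ √(Nat.card V : ℝ) * profit G r σ := by positivity
  linarith

theorem OnlineAlgorithm.IsAlgA.isCompetitiveOn {A : OnlineAlgorithm} (hA : A.IsAlgA) :
    A.IsCompetitiveOn (fun _ G => IsOneAlmostTree G) (fun n => 6 * √(n : ℝ) + 1) := by
  intro V _ G hG r f
  obtain ⟨ω, hω, hopt⟩ : ∃ ω, IsLegal G r f ω ∧ profit G r ω = opt G r f := by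
    refine Nat.sSup_mem (s := {k | ∃ σ, IsLegal G r f σ ∧ profit G r σ = k})
      ⟨_, _, A.legal V G r f, rfl⟩ ⟨Nat.card V, ?_⟩
    rintro _ ⟨σ, -, rfl⟩
    exact Set.ncard_le_card _
  rw [← hopt]
  exact Compared.profit_le ⟨hG.atMostOneCycle, A.legal V G r f, hω, hA V G hG r f⟩

end Competitive

/-! ### Tadpole graphs -/

/-- Deleting an edge leaves no way across the gap between its two consecutive labels, so every edge
is a bridge. -/
theorem isAcyclic_of_int {G : SimpleGraph V} {φ : V → ℤ} (hφ : Function.Injective φ)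
    (h : ∀ a b, G.Adj a b → φ b = φ a + 1 ∨ φ a = φ b + 1) : G.IsAcyclic := by
  have key : ∀ a b, φ b = φ a + 1 → ¬ (G.deleteEdges {s(a, b)}).Reachable a b := by
    rintro a b hab ⟨w⟩
    have : ∀ {x y : V} (_ : (G.deleteEdges {s(a, b)}).Walk x y), φ x ≤ φ a → φ y ≤ φ a := by
      intro x y w
      induction w with
      | nil => exact id
      | @cons x y _ hxy _ ih =>
        intro hx
        refine ih ?_
        rw [deleteEdges_adj] at hxy
        by_contra! hy
        rcases h x y hxy.1 with h1 | h1
        · obtain rfl : x = a := hφ (by omega)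
          obtain rfl : y = b := hφ (by omega)
          exact hxy.2 rfl
        · omega
    have := this w le_rfl
    omega
  rw [isAcyclic_iff_forall_adj_isBridge]
  intro a b hab
  rw [isBridge_iff]
  rcases h a b hab with h1 | h1
  · exact key a b h1
  · rw [Sym2.eq_swap, reachable_comm]
    exact key b a h1

/-- Every cycle contains `uv`. If `cd` were on `p` but not on `q`, the rest of `q` would replace
`uv` in `G` without `cd`. Then `cd` would lie on a cycle even after the deletion of `uv`. -/
theorem atMostOneCycle_of_isAcyclic {G : SimpleGraph V} {u v : V}
    (h : (G.deleteEdges {s(u, v)}).IsAcyclic) : AtMostOneCycle G := by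
  have hmem : ∀ {a : V} {p : G.Walk a a}, p.IsCycle → s(u, v) ∈ p.edges := by
    intro a p hp
    by_contra hcon
    refine h (p.transfer _ fun e he => ?_) (hp.transfer _)
    rw [edgeSet_deleteEdges]
    exact ⟨p.edges_subset_edgeSet he, fun heq => hcon (heq ▸ he)⟩
  have key : ∀ (a b : V) (p : G.Walk a a) (q : G.Walk b b), p.IsCycle → q.IsCycle →
      ∀ e, e ∈ p.edges → e ∈ q.edges := by
    intro a b p q hp hq e he
    by_contra hcon
    induction e with
    | _ c d =>
    obtain ⟨hcd, hreach⟩ := adj_and_reachable_delete_edges_iff_exists_cycle.2 ⟨a, p, hp, he⟩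
    have hqe : ∀ f ∈ q.edges, f ∈ (G.deleteEdges {s(c, d)}).edgeSet := by
      intro f hf
      rw [edgeSet_deleteEdges]
      exact ⟨q.edges_subset_edgeSet hf, fun heq => hcon (heq ▸ hf)⟩
    obtain ⟨-, huv⟩ := adj_and_reachable_delete_edges_iff_exists_cycle.2
      ⟨b, q.transfer _ hqe, hq.transfer hqe, by simpa using hmem hq⟩
    have hne : s(c, d) ≠ s(u, v) := fun heq => hcon (heq ▸ hmem hq)
    have hlift : ∀ {x y : V} (_ : (G.deleteEdges {s(c, d)}).Walk x y),
        ((G.deleteEdges {s(u, v)}).deleteEdges {s(c, d)}).Reachable x y := by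
      intro x y w
      induction w with
      | nil => exact Reachable.refl _
      | @cons x y _ hxy _ ih =>
        refine Reachable.trans ?_ ih
        by_cases heq : s(x, y) = s(u, v)
        · have huv' : ((G.deleteEdges {s(u, v)}).deleteEdges {s(c, d)}).Reachable u v := by
            rwa [deleteEdges_deleteEdges, Set.union_comm, ← deleteEdges_deleteEdges]
          rcases Sym2.eq_iff.1 heq with ⟨rfl, rfl⟩ | ⟨rfl, rfl⟩
          · exact huv'
          · exact huv'.symm
        · rw [deleteEdges_adj] at hxy
          exact Adj.reachable (deleteEdges_adj.2 ⟨deleteEdges_adj.2 ⟨hxy.1, heq⟩, hxy.2⟩)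
    obtain ⟨w⟩ := hreach
    obtain ⟨x, c', hc', -⟩ := adj_and_reachable_delete_edges_iff_exists_cycle.1
      ⟨deleteEdges_adj.2 ⟨hcd, hne⟩, hlift w⟩
    exact h c' hc'
  exact fun a b p q hp hq e => ⟨key a b p q hp hq e, key b a q p hq hp e⟩

theorem AtMostOneCycle.of_iso {W : Type} {G : SimpleGraph V} {H : SimpleGraph W} (φ : G ≃g H)
    (h : AtMostOneCycle H) : AtMostOneCycle G := by
  intro u v p q hp hq e
  have hinj : Function.Injective φ.toHom := φ.injective
  have := h _ _ (p.map φ.toHom) (q.map φ.toHom) (hp.map hinj) (hq.map hinj) (e.map φ.toHom)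
  simpa only [Walk.edges_map, List.mem_map_of_injective (Sym2.map.injective hinj)] using this

section Tadpole

variable {k l : ℕ}

theorem cycleGraph_adj_iff {a b : Fin (k + 3)} : (cycleGraph (k + 3)).Adj a b ↔
    b.val = a.val + 1 ∨ a.val = b.val + 1 ∨ (a.val = 0 ∧ b.val = k + 2) ∨
      (b.val = 0 ∧ a.val = k + 2) := by
  rw [cycleGraph_adj']
  have ha := a.isLt
  have hb := b.isLt
  rcases lt_trichotomy a b with hab | rfl | hab
  · have h1 := Fin.coe_sub_iff_lt.2 hab
    have h2 := Fin.coe_sub_iff_le.2 hab.le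
    rw [Fin.lt_def] at hab
    omega
  · rw [sub_self, Fin.val_zero]
    omega
  · have h1 := Fin.coe_sub_iff_lt.2 hab
    have h2 := Fin.coe_sub_iff_le.2 hab.le
    rw [Fin.lt_def] at hab
    omega

theorem tadpoleGraph_adj_inl {a b : Fin (k + 3)} :
    (tadpoleGraph k l).Adj (.inl a) (.inl b) ↔ b.val = a.val + 1 ∨ a.val = b.val + 1 ∨
      (a.val = 0 ∧ b.val = k + 2) ∨ (b.val = 0 ∧ a.val = k + 2) := by
  rw [← cycleGraph_adj_iff]
  simp [tadpoleGraph, edge_adj]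

theorem tadpoleGraph_adj_inr {a b : Fin (l + 1)} :
    (tadpoleGraph k l).Adj (.inr a) (.inr b) ↔ b.val = a.val + 1 ∨ a.val = b.val + 1 := by
  have : (tadpoleGraph k l).Adj (.inr a) (.inr b) ↔ (pathGraph (l + 1)).Adj a b := by
    simp [tadpoleGraph, edge_adj]
  rw [this, pathGraph_adj]
  omega

theorem tadpoleGraph_adj_inl_inr {a : Fin (k + 3)} {b : Fin (l + 1)} :
    (tadpoleGraph k l).Adj (.inl a) (.inr b) ↔ a.val = 0 ∧ b.val = 0 := by
  simp [tadpoleGraph, edge_adj]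

theorem tadpoleGraph_connected (k l : ℕ) : (tadpoleGraph k l).Connected := by
  have hl : ∀ a, (tadpoleGraph k l).Reachable (.inl 0) (.inl a) := fun a =>
    (cycleGraph_preconnected 0 a).map
      (⟨Sum.inl, fun h => tadpoleGraph_adj_inl.2 (cycleGraph_adj_iff.1 h)⟩ :
        cycleGraph (k + 3) →g tadpoleGraph k l)
  have hr : ∀ b, (tadpoleGraph k l).Reachable (.inl 0) (.inr b) := fun b =>
    (Adj.reachable (tadpoleGraph_adj_inl_inr.2 ⟨rfl, rfl⟩)).trans <|
      (pathGraph_preconnected (l + 1) 0 b).map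
        (⟨Sum.inr, fun h => tadpoleGraph_adj_inr.2 (by rw [pathGraph_adj] at h; omega)⟩ :
          pathGraph (l + 1) →g tadpoleGraph k l)
  have h : ∀ x, (tadpoleGraph k l).Reachable (.inl 0) x := fun x => x.casesOn hl hr
  exact ⟨fun x y => (h x).symm.trans (h y)⟩

theorem tadpoleGraph_atMostOneCycle (k l : ℕ) : AtMostOneCycle (tadpoleGraph k l) := by
  -- Without the edge closing the cycle the tadpole is a path: the cycle is labelled downwards from
  -- 0, the tail upwards from 1.
  refine atMostOneCycle_of_isAcyclic (u := .inl 0) (v := .inl (Fin.last (k + 2)))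
    (isAcyclic_of_int (φ := Sum.elim (fun a => -(a.val : ℤ)) fun b => (b.val : ℤ) + 1) ?_ ?_)
  · rintro (a | a) (b | b) hab <;> simp only [Sum.elim_inl, Sum.elim_inr] at hab
    · exact congrArg _ (Fin.ext (by omega))
    · omega
    · omega
    · exact congrArg _ (Fin.ext (by omega))
  · rintro (a | a) (b | b) hab <;> rw [deleteEdges_adj] at hab <;>
      simp only [Sum.elim_inl, Sum.elim_inr]
    · have h1 := tadpoleGraph_adj_inl.1 hab.1
      have h2 : ¬ ((a.val = 0 ∧ b.val = k + 2) ∨ (a.val = k + 2 ∧ b.val = 0)) := by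
        rintro (⟨ha, hb⟩ | ⟨ha, hb⟩)
        · exact hab.2 (by rw [Fin.ext (b := 0) ha, Fin.ext (b := Fin.last (k + 2)) hb]; rfl)
        · exact hab.2 (by
            rw [Fin.ext (b := Fin.last (k + 2)) ha, Fin.ext (b := 0) hb, Sym2.eq_swap]; rfl)
      omega
    · have h1 := tadpoleGraph_adj_inl_inr.1 hab.1
      omega
    · have h1 := tadpoleGraph_adj_inl_inr.1 hab.1.symm
      omega
    · have h1 := tadpoleGraph_adj_inr.1 hab.1
      omega

end Tadpole

theorem IsTadpole.isOneAlmostTree {G : SimpleGraph V} (h : IsTadpole G) : IsOneAlmostTree G := by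
  obtain ⟨k, l, ⟨φ⟩⟩ := h
  exact ⟨φ.connected_iff.2 (tadpoleGraph_connected k l),
    (tadpoleGraph_atMostOneCycle k l).of_iso φ⟩

/-! ### The lower bound on tadpole graphs -/

theorem profit_le_opt [Finite V] {G : SimpleGraph V} {r : V} {f : ℕ → ℕ} {σ : ℕ → Finset V}
    (hσ : IsLegal G r f σ) : profit G r σ ≤ opt G r f := by
  refine le_csSup ⟨Nat.card V, ?_⟩ ⟨σ, hσ, rfl⟩
  rintro _ ⟨σ, -, rfl⟩
  exact Set.ncard_le_card _

section Tadpole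

variable {k l h : ℕ}

theorem ncard_range_inr (k l : ℕ) :
    (Set.range (Sum.inr : Fin (l + 1) → Fin (k + 3) ⊕ Fin (l + 1))).ncard = l + 1 := by
  rw [← Set.image_univ, Set.ncard_image_of_injective _ Sum.inr_injective, Set.ncard_univ]
  simp

theorem ncard_insert_range_inr (k l : ℕ) :
    (insert (Sum.inl 0) (Set.range (Sum.inr : Fin (l + 1) → Fin (k + 3) ⊕ Fin (l + 1)))).ncard =
      l + 2 := by
  rw [Set.ncard_insert_of_notMem (by simp), ncard_range_inr]

/-- A single firefighter on the junction saves the path of the tadpole. -/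
theorem le_opt_first (hh : 1 ≤ h) (hk : h < k + 3) :
    l + 2 ≤ opt (tadpoleGraph k l) (.inl ⟨h, hk⟩) (fun i => if i = 0 then 1 else 0) := by
  set σ : ℕ → Finset (Fin (k + 3) ⊕ Fin (l + 1)) := fun i => if i = 0 then {.inl 0} else ∅ with hσ
  have hB : ∀ i, ∀ v ∈ burning (tadpoleGraph k l) (.inl ⟨h, hk⟩) σ i,
      ∃ j : Fin (k + 3), 1 ≤ j.val ∧ v = .inl j := by
    intro i
    induction i with
    | zero =>
      rintro _ rfl
      exact ⟨_, hh, rfl⟩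
    | succ i ih =>
      rintro v (hv | ⟨hv, x, hx, hxv⟩)
      · exact ih v hv
      · obtain ⟨j, hj, rfl⟩ := ih x hx
        rcases v with a | b
        · refine ⟨a, Nat.one_le_iff_ne_zero.2 fun ha => hv ⟨0, by omega, ?_⟩, rfl⟩
          rw [Fin.ext (b := 0) ha]
          simp [hσ]
        · have := tadpoleGraph_adj_inl_inr.1 hxv
          omega
  have hlegal : IsLegal (tadpoleGraph k l) (.inl ⟨h, hk⟩) (fun i => if i = 0 then 1 else 0) σ := by
    intro i
    by_cases hi : i = 0
    · simp only [hσ, hi, if_true, Finset.card_singleton, le_refl, true_and, Finset.mem_singleton]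
      rintro _ rfl hv
      obtain ⟨j, hj, hj'⟩ := hB 0 _ hv
      rw [← Sum.inl.inj hj'] at hj
      exact absurd hj (by simp)
    · simp [hσ, hi]
  refine le_trans ?_ (profit_le_opt hlegal)
  rw [← ncard_insert_range_inr k l]
  refine Set.ncard_le_ncard (fun v hv i hi => ?_) (Set.toFinite _)
  obtain ⟨j, hj, rfl⟩ := hB i v hi
  rcases hv with hv | ⟨b, hb⟩
  · rw [Sum.inl.inj hv] at hj
    exact absurd hj (by simp)
  · exact absurd hb (by simp)

/-- With two firefighters in time, the half of the cycle can be saved. -/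
theorem le_opt_second (hh : 1 ≤ h) (hk : h + 1 < k + 3) :
    k + 2 - h ≤ opt (tadpoleGraph k l) (.inl ⟨h, by omega⟩)
      (fun i => if i = 0 ∨ i = h then 1 else 0) := by
  set r : Fin (k + 3) ⊕ Fin (l + 1) := .inl ⟨h, by omega⟩ with hr
  set σ : ℕ → Finset (Fin (k + 3) ⊕ Fin (l + 1)) := fun i => if i = 0 then {.inl ⟨h + 1, hk⟩}
    else if i = h then {.inl (Fin.last (k + 2))} else ∅ with hσ
  -- The firefighter on `h + 1` stops one direction. The other front moves one vertex per round and
  -- reaches the junction no earlier than round `h`, when the last cycle vertex gets protected just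
  -- in time.
  have hB : ∀ t, (∀ j, .inl j ∈ burning (tadpoleGraph k l) r σ t → j.val ≤ h ∧ h ≤ j.val + t) ∧
      ∀ b, .inr b ∈ burning (tadpoleGraph k l) r σ t → h < t := by
    intro t
    induction t with
    | zero =>
      refine ⟨fun j hj => ?_, fun b hb => ?_⟩
      · rw [Sum.inl.inj (hj : _ = r)]
        simp
      · have hb : Sum.inr b = r := hb
        exact absurd hb Sum.inr_ne_inl
    | succ t ih =>
      refine ⟨fun j hj => ?_, fun b hb => ?_⟩
      · rcases hj with hj | ⟨hj, x | x, hx, hxj⟩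
        · have := ih.1 j hj
          omega
        · have h1 := ih.1 x hx
          have h2 := tadpoleGraph_adj_inl.1 hxj
          have h3 : j.val ≠ h + 1 := fun h0 => hj ⟨0, by omega, by
            rw [Fin.ext (b := ⟨h + 1, hk⟩) h0]; simp [hσ]⟩
          have h4 : h ≤ t → j.val ≠ k + 2 := fun ht h0 => hj ⟨h, by omega, by
            rw [Fin.ext (b := Fin.last (k + 2)) h0]; simp [hσ, show h ≠ 0 by omega]⟩
          omega
        · have h1 := ih.2 x hx
          have h2 := tadpoleGraph_adj_inl_inr.1 hxj.symm
          omega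
      · rcases hb with hb | ⟨-, x | x, hx, hxb⟩
        · have := ih.2 b hb
          omega
        · have h1 := ih.1 x hx
          have h2 := tadpoleGraph_adj_inl_inr.1 hxb
          omega
        · have := ih.2 x hx
          omega
  have hlegal : IsLegal (tadpoleGraph k l) r (fun i => if i = 0 ∨ i = h then 1 else 0) σ := by
    intro i
    by_cases h0 : i = 0
    · simp only [hσ, h0, true_or, if_true, Finset.card_singleton, le_refl, true_and,
        Finset.mem_singleton]
      rintro _ rfl hv
      have := ((hB 0).1 _ hv).1
      simp at this
    by_cases hi : i = h
    · simp only [hσ, hi, or_true, if_true, show h ≠ 0 by omega, if_false,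
        Finset.card_singleton, le_refl, true_and, Finset.mem_singleton]
      rintro _ rfl hv
      have := ((hB h).1 _ hv).1
      simp at this
      omega
    · simp [hσ, h0, hi]
  refine le_trans ?_ (profit_le_opt hlegal)
  have hcard : ((Sum.inl : Fin (k + 3) → Fin (k + 3) ⊕ Fin (l + 1)) ''
      ↑(Finset.Ioi (⟨h, by omega⟩ : Fin (k + 3)))).ncard = k + 2 - h := by
    rw [Set.ncard_image_of_injective _ Sum.inl_injective, Set.ncard_coe_finset, Fin.card_Ioi]
    simp
  rw [← hcard]
  refine Set.ncard_le_ncard ?_ (Set.toFinite _)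
  rintro _ ⟨j, hj, rfl⟩ i hi
  have h1 := ((hB i).1 j hi).1
  simp [Fin.lt_def] at hj
  omega

/-- A firefighter on the cycle cannot save more than one vertex. -/
theorem eq_of_notMem_burning (hk : h < k + 3) {i : Fin (k + 3)} (hi : i.val ≠ 0) (hih : i.val ≠ h)
    {σ : ℕ → Finset (Fin (k + 3) ⊕ Fin (l + 1))} (hσ : ∀ t, ∀ v ∈ σ t, v = .inl i)
    {v : Fin (k + 3) ⊕ Fin (l + 1)}
    (hv : ∀ t, v ∉ burning (tadpoleGraph k l) (.inl ⟨h, hk⟩) σ t) : v = .inl i := by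
  -- The burnt set is closed under adjacency except at `i`. A cycle without one vertex is connected,
  -- and the path hangs on `0 ≠ i`.
  set R := {v | ∃ t, v ∈ burning (tadpoleGraph k l) (.inl ⟨h, hk⟩) σ t} with hR
  have hstep : ∀ {a b}, a ∈ R → (tadpoleGraph k l).Adj a b → b ≠ .inl i → b ∈ R := by
    rintro a b ⟨t, ht⟩ hab hb
    exact ⟨t + 1, mem_burning_succ ht hab fun ⟨j, _, hj⟩ => hb (hσ j b hj)⟩
  have hne : ∀ {a : Fin (k + 3)}, a.val ≠ i.val →
      (Sum.inl a : Fin (k + 3) ⊕ Fin (l + 1)) ≠ .inl i :=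
    fun ha heq => ha (congrArg Fin.val (Sum.inl.inj heq))
  have hup : ∀ a : Fin (k + 3), .inl a ∈ R → ∀ n (hn : a.val + n < k + 3),
      (i.val < a.val ∨ a.val + n < i.val) → .inl ⟨a.val + n, hn⟩ ∈ R := by
    intro a ha n
    induction n with
    | zero => exact fun _ _ => ha
    | succ n ih =>
      intro hn hai
      refine hstep (ih (by omega) (by omega)) (tadpoleGraph_adj_inl.2 (Or.inl ?_)) (hne ?_)
      · simp; omega
      · simp; omega
  have hdown : ∀ a : Fin (k + 3), .inl a ∈ R → ∀ n, n ≤ a.val →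
      (a.val < i.val ∨ i.val + n < a.val) → ∀ b : Fin (k + 3), b.val + n = a.val → .inl b ∈ R := by
    intro a ha n
    induction n with
    | zero =>
      intro _ _ b hb
      rwa [Fin.ext (a := b) (b := a) (by omega)]
    | succ n ih =>
      intro hn hai b hb
      refine hstep (ih (by omega) (by omega) ⟨b.val + 1, by omega⟩ (by simp; omega))
        (tadpoleGraph_adj_inl.2 (Or.inr (Or.inl ?_))) (hne ?_)
      · simp
      · omega
  have hup' : ∀ a b : Fin (k + 3), .inl a ∈ R → a.val ≤ b.val →
      (i.val < a.val ∨ b.val < i.val) → .inl b ∈ R := by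
    intro a b ha hab hi
    have := hup a ha (b.val - a.val) (by omega) (by omega)
    rwa [Fin.ext (a := ⟨a.val + (b.val - a.val), _⟩) (b := b) (by simp; omega)] at this
  have hdown' : ∀ a b : Fin (k + 3), .inl a ∈ R → b.val ≤ a.val →
      (a.val < i.val ∨ i.val < b.val) → .inl b ∈ R := fun a b ha hab hi =>
    hdown a ha (a.val - b.val) (by omega) (by omega) b (by omega)
  have hroot : (.inl ⟨h, hk⟩ : Fin (k + 3) ⊕ Fin (l + 1)) ∈ R := ⟨0, rfl⟩
  have hi' := i.isLt
  have h0 : (.inl 0 : Fin (k + 3) ⊕ Fin (l + 1)) ∈ R := by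
    rcases lt_or_gt_of_ne hih with hlt | hlt
    · refine hstep (hup' _ (Fin.last (k + 2)) hroot (by simp; omega) (Or.inl hlt))
        (tadpoleGraph_adj_inl.2 (by simp)) (hne (by simp; omega))
    · exact hdown' _ 0 hroot (by simp) (Or.inl hlt)
  have hcyc : ∀ b : Fin (k + 3), b.val ≠ i.val → .inl b ∈ R := by
    intro b hb
    rcases lt_or_gt_of_ne hb with hlt | hlt
    · exact hup' 0 b h0 (by simp) (Or.inr hlt)
    · have hlast : (.inl (Fin.last (k + 2)) : Fin (k + 3) ⊕ Fin (l + 1)) ∈ R :=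
        hstep h0 (tadpoleGraph_adj_inl.2 (by simp)) (hne (by simp; omega))
      exact hdown' _ b hlast (by simp; omega) (Or.inr hlt)
  have hpath : ∀ n (hn : n < l + 1), .inr ⟨n, hn⟩ ∈ R := by
    intro n
    induction n with
    | zero => exact fun hn => hstep h0 (tadpoleGraph_adj_inl_inr.2 ⟨rfl, rfl⟩) (by simp)
    | succ n ih =>
      exact fun hn => hstep (ih (by omega)) (tadpoleGraph_adj_inr.2 (by simp)) (by simp)
  by_contra hcon
  rcases v with b | b
  · obtain ⟨t, ht⟩ := hcyc b fun hb => hcon (congrArg _ (Fin.ext hb))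
    exact hv t ht
  · obtain ⟨t, ht⟩ := hpath b.val b.isLt
    exact hv t ht

/-- Without a firefighter on the cycle, the cycle burns down. -/
theorem mem_burning_cycle (hk : h < k + 3) (hh : k + 2 ≤ 2 * h)
    {σ : ℕ → Finset (Fin (k + 3) ⊕ Fin (l + 1))}
    (hσ : ∀ t < h, ∀ j : Fin (k + 3), 1 ≤ j.val → .inl j ∉ σ t) {j : Fin (k + 3)}
    (hj : 1 ≤ j.val) : .inl j ∈ burning (tadpoleGraph k l) (.inl ⟨h, hk⟩) σ h := by
  -- The two fronts are at `h - t` and `h + t`; by `k + 2 ≤ 2 * h`, `h` rounds suffice for both.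
  have key : ∀ t ≤ h, ∀ j : Fin (k + 3), 1 ≤ j.val → (j.val + t = h ∨ j.val = h + t) →
      .inl j ∈ burning (tadpoleGraph k l) (.inl ⟨h, hk⟩) σ t := by
    intro t
    induction t with
    | zero =>
      intro _ j _ hjt
      rw [Fin.ext (a := j) (b := ⟨h, hk⟩) (by simp; omega)]
      exact rfl
    | succ t ih =>
      intro ht j hj hjt
      have hng : (.inl j : Fin (k + 3) ⊕ Fin (l + 1)) ∉ guarded σ (t + 1) := by
        rintro ⟨t', ht', hmem⟩
        exact hσ t' (by omega) j hj hmem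
      rcases hjt with hjt | hjt
      · exact mem_burning_succ (ih (by omega) ⟨j.val + 1, by omega⟩ (by simp) (by simp; omega))
          (tadpoleGraph_adj_inl.2 (by simp)) hng
      · exact mem_burning_succ (ih (by omega) ⟨j.val - 1, by omega⟩ (by simp; omega)
          (by simp; omega)) (tadpoleGraph_adj_inl.2 (by simp; omega)) hng
  have := j.isLt
  rcases le_total j.val h with hjh | hjh
  · exact burning_mono _ _ _ (by omega : h - j.val ≤ h) (key (h - j.val) (by omega) j hj (by omega))
  · exact burning_mono _ _ _ (by omega : j.val - h ≤ h) (key (j.val - h) (by omega) j hj (by omega))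

end Tadpole

/-- The adversary: after the first firefighter it stops, or it sends one further firefighter. -/
theorem OnlineAlgorithm.exists_bad_instance (A : OnlineAlgorithm) {k l h : ℕ} (h2 : 2 ≤ h)
    (hk : h + 1 < k + 3) (hh : k + 2 ≤ 2 * h) :
    ∃ f, (l + 2 ≤ opt (tadpoleGraph k l) (.inl ⟨h, by omega⟩) f ∧
      profit (tadpoleGraph k l) (.inl ⟨h, by omega⟩)
        (A.move _ (tadpoleGraph k l) (.inl ⟨h, by omega⟩) f) ≤ 1) ∨
      (k + 2 - h ≤ opt (tadpoleGraph k l) (.inl ⟨h, by omega⟩) f ∧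
      profit (tadpoleGraph k l) (.inl ⟨h, by omega⟩)
        (A.move _ (tadpoleGraph k l) (.inl ⟨h, by omega⟩) f) ≤ l + 2) := by
  set r : Fin (k + 3) ⊕ Fin (l + 1) := .inl ⟨h, by omega⟩ with hr
  set f₁ : ℕ → ℕ := fun i => if i = 0 then 1 else 0 with hf₁
  set f₂ : ℕ → ℕ := fun i => if i = 0 ∨ i = h then 1 else 0 with hf₂
  have h1 := A.legal _ (tadpoleGraph k l) r f₁
  have h2' := A.legal _ (tadpoleGraph k l) r f₂
  -- The two sequences agree in round 0, so the adversary may choose between them after seeing the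
  -- first move.
  have h12 : A.move _ (tadpoleGraph k l) r f₁ 0 = A.move _ (tadpoleGraph k l) r f₂ 0 :=
    A.online _ _ _ _ _ _ fun j hj => by simp [hf₁, hf₂, Nat.le_zero.1 hj]
  have hempty : ∀ {f : ℕ → ℕ} {t : ℕ}, f t = 0 → A.move _ (tadpoleGraph k l) r f t = ∅ := by
    intro f t ht
    exact Finset.card_eq_zero.1 (Nat.le_zero.1 (ht ▸ (A.legal _ (tadpoleGraph k l) r f t).1))
  have hcard : (A.move _ (tadpoleGraph k l) r f₁ 0).card ≤ 1 := (h1 0).1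
  by_cases hex : ∀ j : Fin (k + 3), 1 ≤ j.val → .inl j ∉ A.move _ (tadpoleGraph k l) r f₁ 0
  · by_cases hm : ∀ v, v ∉ A.move _ (tadpoleGraph k l) r f₁ 0
    · refine ⟨f₁, Or.inl ⟨le_opt_first (by omega) (by omega), ?_⟩⟩
      refine le_trans ?_ (Set.ncard_singleton (Sum.inl 1 : Fin (k + 3) ⊕ Fin (l + 1))).le
      refine Set.ncard_le_ncard (fun v hv => ?_) (Set.toFinite _)
      -- Nothing was protected, so any cycle vertex other than `0` and the source serves; `1` does
      -- because `2 ≤ h`.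
      refine eq_of_notMem_burning (h := h) (by omega) (i := 1) (by simp) (by simp; omega) ?_ hv
      intro t v hvt
      by_cases ht : t = 0
      · exact absurd (ht ▸ hvt) (hm v)
      · rw [hempty (by simp [hf₁, ht])] at hvt
        exact absurd hvt (by simp)
    · refine ⟨f₂, Or.inr ⟨le_opt_second (by omega) hk, ?_⟩⟩
      rw [← ncard_insert_range_inr k l]
      refine Set.ncard_le_ncard (fun v hv => ?_) (Set.toFinite _)
      rcases v with j | b
      · left
        by_contra hj
        refine hv h (mem_burning_cycle (by omega) hh (fun t ht j hj => ?_) (j := j) ?_)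
        · by_cases ht0 : t = 0
          · rw [ht0, ← h12]
            exact hex j hj
          · rw [hempty (by simp [hf₂, ht0, ht.ne])]
            simp
        · exact Nat.one_le_iff_ne_zero.2 fun h0 => hj (congrArg _ (Fin.ext h0))
      · exact Or.inr ⟨b, rfl⟩
  · push Not at hex
    obtain ⟨i, hi, hmem⟩ := hex
    refine ⟨f₁, Or.inl ⟨le_opt_first (by omega) (by omega), ?_⟩⟩
    refine le_trans ?_ (Set.ncard_singleton (Sum.inl i : Fin (k + 3) ⊕ Fin (l + 1))).le
    refine Set.ncard_le_ncard (fun v hv => ?_) (Set.toFinite _)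
    refine eq_of_notMem_burning (h := h) (by omega) (i := i) (by omega) ?_ ?_ hv
    · intro hih
      refine (h1 0).2 _ hmem ?_
      rw [Fin.ext (a := i) (b := ⟨h, by omega⟩) hih]
      exact rfl
    · intro t v hvt
      by_cases ht : t = 0
      · rw [ht] at hvt
        exact Finset.card_le_one.1 hcard _ hvt _ hmem
      · rw [hempty (by simp [hf₁, ht])] at hvt
        exact absurd hvt (by simp)

/-- The path has `s = ⌊√n⌋` vertices. The two outcomes force a ratio of at least `s + 1 ≥ √n`, or at
least `(n / 4) / (s + 1)` with `s + 1 ≤ 2√n`, whence `1 / 8`. -/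
theorem OnlineAlgorithm.sqrt_le_of_isCompetitiveOn {A : OnlineAlgorithm} {c : ℕ → ℝ}
    (hA : A.IsCompetitiveOn (fun _ G => IsTadpole G) c) {n : ℕ} (hn : 16 ≤ n) :
    1 / 8 * √(n : ℝ) ≤ c n := by
  set s := Nat.sqrt n with hs
  have hs1 : s * s ≤ n := Nat.sqrt_le n
  have hs2 : n < (s + 1) * (s + 1) := Nat.lt_succ_sqrt n
  have hs4 : 4 ≤ s := Nat.le_sqrt.2 hn
  have hs3 : 4 * s ≤ n := (Nat.mul_le_mul_right s hs4).trans hs1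
  obtain ⟨l, hl⟩ : ∃ l, s = l + 1 := ⟨s - 1, by omega⟩
  obtain ⟨k, hk⟩ : ∃ k, n = k + 3 + (l + 1) := ⟨n - (l + 1) - 3, by omega⟩
  obtain ⟨f, hf⟩ := A.exists_bad_instance (k := k) (l := l) (h := (k + 3) / 2) (by omega)
    (by omega) (by omega)
  have hc := hA _ (tadpoleGraph k l) ⟨k, l, ⟨Iso.refl⟩⟩ (.inl ⟨(k + 3) / 2, by omega⟩) f
  have hcard : Nat.card (Fin (k + 3) ⊕ Fin (l + 1)) = n := by simp [hk]
  rw [hcard] at hc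
  have hsqrt : √(n : ℝ) ≤ s + 1 := by
    rw [Real.sqrt_le_left (by positivity)]
    exact_mod_cast (by nlinarith : n ≤ (s + 1) ^ 2)
  have hsqrt' : (s : ℝ) ≤ √(n : ℝ) :=
    Real.le_sqrt_of_sq_le (by exact_mod_cast (by nlinarith : s ^ 2 ≤ n))
  have hsl : (s : ℝ) = l + 1 := by exact_mod_cast hl
  have hs0 : (4 : ℝ) ≤ s := by exact_mod_cast hs4
  have hpos : (0 : ℝ) ≤ profit (tadpoleGraph k l) (.inl ⟨(k + 3) / 2, by omega⟩)
        (A.move _ (tadpoleGraph k l) (.inl ⟨(k + 3) / 2, by omega⟩) f) := Nat.cast_nonneg _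
  rcases hf with ⟨h1, h2⟩ | ⟨h1, h2⟩
  · have h1' : ((l : ℝ) + 2) ≤ opt (tadpoleGraph k l) (.inl ⟨(k + 3) / 2, by omega⟩) f := by
      exact_mod_cast h1
    have h2' : (profit (tadpoleGraph k l) (.inl ⟨(k + 3) / 2, by omega⟩)
        (A.move _ (tadpoleGraph k l) (.inl ⟨(k + 3) / 2, by omega⟩) f) : ℝ) ≤ 1 := by
      exact_mod_cast h2
    have hc0 : 0 ≤ c n := by
      by_contra! hneg
      nlinarith
    nlinarith
  · have hopt : (n : ℝ) / 4 ≤ opt (tadpoleGraph k l) (.inl ⟨(k + 3) / 2, by omega⟩) f := by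
      rw [div_le_iff₀ (by norm_num)]
      exact_mod_cast (by omega :
        n ≤ opt (tadpoleGraph k l) (.inl ⟨(k + 3) / 2, _⟩) f * 4)
    have h2' : (profit (tadpoleGraph k l) (.inl ⟨(k + 3) / 2, by omega⟩)
        (A.move _ (tadpoleGraph k l) (.inl ⟨(k + 3) / 2, by omega⟩) f) : ℝ) ≤ l + 2 := by
      exact_mod_cast h2
    have hn0 : (16 : ℝ) ≤ n := by exact_mod_cast hn
    -- The sign of `c` is not assumed; it follows from a positive optimum, and is needed to multiply
    -- the bound on the profit.
    have hc0 : 0 ≤ c n := by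
      by_contra! hneg
      nlinarith
    have h3 : (n : ℝ) / 4 ≤ c n * (2 * √(n : ℝ)) :=
      hopt.trans (hc.trans (mul_le_mul_of_nonneg_left (by linarith) hc0))
    have h4 : √(n : ℝ) * √(n : ℝ) = n := Real.mul_self_sqrt (by positivity)
    have h5 : 0 < √(n : ℝ) := by positivity
    refine le_of_mul_le_mul_right ?_ h5
    nlinarith

end Firefighting

theorem mainTheorem2 :
    (∃ A : Firefighting.OnlineAlgorithm, A.IsAlgA) ∧
    (∀ A : Firefighting.OnlineAlgorithm, A.IsAlgA →
      A.IsCompetitiveOn (fun _ G => Firefighting.IsOneAlmostTree G)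
        (fun n => 6 * √(n : ℝ) + 1)) ∧
    (∀ (V : Type) (G : SimpleGraph V),
      Firefighting.IsTadpole G → Firefighting.IsOneAlmostTree G) ∧
    (∃ ε : ℝ, 0 < ε ∧ ∀ (A : Firefighting.OnlineAlgorithm) (c : ℕ → ℝ),
      A.IsCompetitiveOn (fun _ G => Firefighting.IsTadpole G) c →
        ∀ᶠ n : ℕ in Filter.atTop, ε * √(n : ℝ) ≤ c n) :=
  ⟨Firefighting.exists_isAlgA, fun _ hA => hA.isCompetitiveOn, fun _ _ h => h.isOneAlmostTree,
    1 / 8, by norm_num, fun _ _ hA => Filter.eventually_atTop.2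
      ⟨16, fun _ hn => Firefighting.OnlineAlgorithm.sqrt_le_of_isCompetitiveOn hA hn⟩⟩
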